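/- Let $n=m+d$, write $t=(z,w)\in\mathbb C^m\times\mathbb C^d$ with $z=x+iy$, $w=u+iv$, and let $M$ be a real analytic generic submanifold of a polydisc $\{|t|<\rho\}$ of $\mathbb C^n$ through the origin, of codimension $d$ and CR dimension $m$, given as a graph $v=\varphi(x,y,u)$ with $\varphi$ real analytic for $|(x,y,u)|<2\rho$, and also by complex defining equations $\bar w=\Theta(\bar z,z,w)$ with $\Theta=\Theta(\zeta,z,w)$ holomorphic in the polydisc of radius $2\rho$. Let $\overline\Theta$ denote the series $\Theta$ with conjugated coefficients, and for $k=1,\dots,m$ put $$L_k=\frac{\partial}{\partial z_k}+\sum_{j=1}^d\frac{\partial\overline\Theta_j}{\partial z_k}(z,\bar z,\bar w)\frac{\partial}{\partial w_j},\qquad \mathcal L_k=\frac{\partial}{\partial z_k}+\sum_{j=1}^d\frac{\partial\overline\Theta_j}{\partial z_k}(z,\zeta,\xi)\frac{\partial}{\partial w_j},\qquad \underline{\mathcal L}_k=\frac{\partial}{\partial \zeta_k}+\sum_{j=1}^d\frac{\partial\Theta_j}{\partial \zeta_k}(\zeta,z,w)\frac{\partial}{\partial \xi_j}.$$ Here $\tau=(\zeta,\xi)\in\mathbb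 C^m\times\mathbb C^d$ complexifies $\bar t$. Let $\mathcal M=\{(t,\tau):|t|,|\tau|<\rho,\ \xi=\Theta(\zeta,z,w)\}$ be the extrinsic complexification of $M$, $p^c=(p,\bar p)$, $\underline\Lambda=\{(t,\tau):\tau=\bar t\}$ and $\pi_t(t,\tau)=t$. For a system of vector fields over $\mathbb K=\mathbb R$ or $\mathbb C$, the local orbit of a point is the set of endpoints of concatenations, starting at this point, of at most $K$ flows of elements of the system with times in $\mathbb K$ of modulus less than $\delta$. Let $\mathcal O_{CR}(M,p)$ be the local orbit of $p\in M$ under the real vector fields $\mathrm{Re}\,L_k$, $\mathrm{Im}\,L_k$ $(1\le k\le m)$ on $M$, and $\mathcal O_{\mathcal L,\underline{\mathcal L}}(\mathcal M,p^c)$ the local orbit of $p^c$ under the holomorphic vector fields $\mathcal L_k,\underline{\mathcal L}_k$ $(1\le k\le m)$ on $\mathcal M$. Then for every $p\in M$ in some neighbourhood of the origin, every $K\ge 3(2m+d)$, and all sufficiently small time bounds $\delta>0$ (chosen independently for the two orbits; how small may depend on $p$ and $K$): (1) near $p$ the CR orbit $\mathcal O_{CR}(M,p)$ is a real analytic submanifold,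 and near $p^c$ its extrinsic complexification is $\mathcal O_{\mathcal L,\underline{\mathcal L}}(\mathcal M,p^c)$; that is, there are finitely many real power series $\chi_l(t,\bar t)$ with linearly independent differentials at $p$ such that $\mathcal O_{CR}(M,p)=\{\chi_l(t,\bar t)=0\ \forall l\}$ near $p$ and $\mathcal O_{\mathcal L,\underline{\mathcal L}}(\mathcal M,p^c)=\{\chi_l(t,\tau)=0\ \forall l\}$ near $p^c$; (2) $\mathcal O_{CR}(M,p)=\pi_t\bigl(\underline\Lambda\cap\mathcal O_{\mathcal L,\underline{\mathcal L}}(\mathcal M,p^c)\bigr)$ near $p$. In particular, if $M$ is real algebraic, that is, if each $\varphi_j$ is an algebraic function in the sense of Nash, then $\mathcal O_{\mathcal L,\underline{\mathcal L}}(\mathcal M,p^c)$ is a complex algebraic submanifold near $p^c$ and $\mathcal O_{CR}(M,p)$ is a real algebraic submanifold near $p$ (zero sets of finitely many algebraic functions in the sense of Nash with linearly independent differentials). -/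

import Mathlib

open Filter Topology Metric

noncomputable section

namespace CROrbit

/-! ### Local orbits of finite systems of vector fields -/

section Orbit

variable (𝕂 : Type) [RCLike 𝕂] {E : Type} [NormedAddCommGroup E] [NormedSpace 𝕂 E] {ι : Type}

/-- `y` is the point `exp (s X) (x)` of the flow of the vector field `X` on `S`, for a time `s ∈ 𝕂`
with `|s| < δ`: the integral curve of `X` starting at `x` is defined for all times of modulus less
than `δ`, stays in `S`, and passes through `y` at the time `s`. For `𝕂 = ℂ` the time is complex and
the integral curve is holomorphic. -/
def FlowStep (X : E → E) (S : Set E) (δ : ℝ) (x y : E) : Prop :=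
  ∃ γ : 𝕂 → E, γ 0 = x ∧
    (∀ s ∈ ball (0 : 𝕂) δ, γ s ∈ S ∧ HasDerivAt γ (X (γ s)) s) ∧
    ∃ s ∈ ball (0 : 𝕂) δ, γ s = y

/-- Endpoints of concatenations of exactly `k` flows (with times of modulus less than `δ`) of
elements of the system `X`, starting at `p`. -/
def flowChain (X : ι → E → E) (S : Set E) (δ : ℝ) (p : E) : ℕ → Set E
  | 0 => {p}
  | k + 1 => {y | ∃ x ∈ flowChain X S δ p k, ∃ a, FlowStep 𝕂 (X a) S δ x y}

/-- The local orbit of `p` under the system `X` of vector fields on `S`: endpoints of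
concatenations of at most `K` flows of elements of `X` with times in the disc of radius `δ`. -/
def localOrbit (X : ι → E → E) (S : Set E) (K : ℕ) (δ : ℝ) (p : E) : Set E :=
  ⋃ k ≤ K, flowChain 𝕂 X S δ p k

end Orbit

/-! ### Algebraic functions and algebraic submanifolds -/

section Algebraic

variable (𝕂 : Type) [RCLike 𝕂] {E : Type} [NormedAddCommGroup E] [NormedSpace 𝕂 E]

/-- `f` is `𝕂`-algebraic (in the sense of Nash) near `x`: it is `𝕂`-analytic at `x` and satisfies
near `x` a nontrivial polynomial equation `P (y₁, …, y_N, f y) = 0`, where the `y_i` are linear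
coordinates on the space (the notion does not depend on the choice of these coordinates). -/
def IsAlgebraicAt (f : E → 𝕂) (x : E) : Prop :=
  AnalyticAt 𝕂 f x ∧
    ∃ (N : ℕ) (b : Module.Basis (Fin N) 𝕂 E) (P : MvPolynomial (Option (Fin N)) 𝕂), P ≠ 0 ∧
      ∀ᶠ y in 𝓝 x, MvPolynomial.eval (fun o => o.elim (f y) (fun i => b.repr y i)) P = 0

/-- Near its point `x`, the set `N` is a `𝕂`-algebraic submanifold: it is the zero set of finitely
many `𝕂`-algebraic functions whose differentials at `x` are linearly independent. -/
def IsAlgebraicSubmanifoldAt (N : Set E) (x : E) : Prop :=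
  ∃ (c : ℕ) (r : E → Fin c → 𝕂),
    (∀ l, IsAlgebraicAt 𝕂 (fun y => r y l) x) ∧
    r x = 0 ∧ Function.Surjective (fderiv 𝕂 r x) ∧
    ∀ᶠ y in 𝓝 x, y ∈ N ↔ r y = 0

end Algebraic

/-! ### Local generic submanifolds -/

/-- `ℂⁿ = ℂᵐ × ℂᵈ` with coordinates `t = (z, w)` and the polydisc norm `max |t_i|`. Complex
conjugation of all the coordinates is `star`. -/
abbrev CSpace (m d : ℕ) : Type := (Fin m → ℂ) × (Fin d → ℂ)

/-- `ℝ²ᵐ⁺ᵈ` with coordinates `(x, y, u)` and the maximum norm. -/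
abbrev RSpace (m d : ℕ) : Type := (Fin m → ℝ) × (Fin m → ℝ) × (Fin d → ℝ)

/-- The parametrization `(x, y, u) ↦ (x + i y, u + i φ(x, y, u))` of the graph `v = φ(x, y, u)`. -/
def graphMap {m d : ℕ} (φ : RSpace m d → Fin d → ℝ) (q : RSpace m d) : CSpace m d :=
  (fun k => (q.1 k : ℂ) + Complex.I * (q.2.1 k : ℂ),
    fun j => (q.2.2 j : ℂ) + Complex.I * (φ q j : ℂ))

/-- A local real analytic generic submanifold of `ℂᵐ × ℂᵈ` through the origin, of codimension `d`
and CR dimension `m`: a graph `v = φ(x, y, u)`, where `z = x + i y` and `w = u + i v`, over a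
polydisc of radius `radius`, with `T_p M + i T_p M = ℂⁿ` at every point `p`; the tangent space
`T_p M` is the range of the differential of the parametrization of the graph. -/
structure LocalGenericSubmanifold (m d : ℕ) where
  radius : ℝ
  radius_pos : 0 < radius
  φ : RSpace m d → Fin d → ℝ
  analytic : AnalyticOnNhd ℝ φ (ball 0 (2 * radius))
  zero : φ 0 = 0
  generic : ∀ q, graphMap φ q ∈ ball (0 : CSpace m d) radius →
    Submodule.span ℂ (Set.range (fderiv ℝ (graphMap φ) q)) = ⊤

namespace LocalGenericSubmanifold

variable {m d : ℕ} (M : LocalGenericSubmanifold m d)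

/-- The points of `M`. -/
def carrier : Set (CSpace m d) :=
  {t | t ∈ ball 0 M.radius ∧
    ∀ j, (t.2 j).im = M.φ (fun k => (t.1 k).re, fun k => (t.1 k).im, fun j' => (t.2 j').re) j}

/-- `M` is real algebraic: the functions `φ_j` are real algebraic (near the origin, hence, by
analytic continuation, on the whole polydisc). -/
def IsRealAlgebraic : Prop := ∀ j, IsAlgebraicAt ℝ (fun q => M.φ q j) 0

/-- The equations `w̄ = Θ(z̄, z, w)` are complex defining equations of `M`, where
`Θ = Θ(ζ, z, w)` is holomorphic. (The function `Θ` is obtained by solving the real equations for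
`w̄`, which is possible, after shrinking the radius, as soon as `T₀M = {v = 0}`.) -/
def IsComplexDefining (Θ : (Fin m → ℂ) × CSpace m d → Fin d → ℂ) : Prop :=
  AnalyticOnNhd ℂ Θ (ball 0 (2 * M.radius)) ∧
    ∀ t ∈ ball (0 : CSpace m d) M.radius, t ∈ M.carrier ↔ star t.2 = Θ (star t.1, t)

end LocalGenericSubmanifold

/-! ### Complexified CR vector fields, CR orbits and complexified orbits -/

section Complexification

variable {m d : ℕ}

/-- The function obtained from `Θ` by conjugating the coefficients of its power series. -/
def conjCoeff (Θ : (Fin m → ℂ) × CSpace m d → Fin d → ℂ) :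
    (Fin m → ℂ) × CSpace m d → Fin d → ℂ :=
  fun x => star (Θ (star x))

/-- The coefficients of the vector field
`∂/∂z_k + ∑ⱼ (∂Θ̄_j/∂z_k)(z, ζ, ξ) ∂/∂w_j` at the point `(t, τ) = ((z, w), (ζ, ξ))`. -/
def coeffL (Θ : (Fin m → ℂ) × CSpace m d → Fin d → ℂ) (k : Fin m) (t τ : CSpace m d) :
    CSpace m d :=
  (Pi.single k 1, fderiv ℂ (conjCoeff Θ) (t.1, τ) (Pi.single k 1, 0))

/-- The coefficients of the vector field
`∂/∂ζ_k + ∑ⱼ (∂Θ_j/∂ζ_k)(ζ, z, w) ∂/∂ξ_j` at the point `(t, τ) = ((z, w), (ζ, ξ))`. -/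
def coeffLbar (Θ : (Fin m → ℂ) × CSpace m d → Fin d → ℂ) (k : Fin m) (t τ : CSpace m d) :
    CSpace m d :=
  (Pi.single k 1, fderiv ℂ Θ (τ.1, t) (Pi.single k 1, 0))

/-- The `2m` real vector fields `Re L_k`, `Im L_k`, where
`L_k = ∂/∂z_k + ∑ⱼ (∂Θ̄_j/∂z_k)(z, z̄, w̄) ∂/∂w_j`. A real vector field `(A + Ā)` with
`A = ∑ a_i ∂/∂t_i` is identified with the velocity `a ∈ ℂⁿ`; thus `Re L = (L + L̄)/2` has the
velocity `ℓ/2`, and `Im L = (L - L̄)/(2i)` has the velocity `ℓ/(2i)`. -/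
def crField (Θ : (Fin m → ℂ) × CSpace m d → Fin d → ℂ) :
    Fin m ⊕ Fin m → CSpace m d → CSpace m d
  | Sum.inl k => fun t => (1 / 2 : ℂ) • coeffL Θ k t (star t)
  | Sum.inr k => fun t => (1 / (2 * Complex.I) : ℂ) • coeffL Θ k t (star t)

/-- The `2m` holomorphic vector fields `𝓛_k` (first summand) and `𝓛̲_k` (second summand) on
`ℂⁿ × ℂⁿ`, the complexifications of `L_k` and of its conjugate. -/
def complexField (Θ : (Fin m → ℂ) × CSpace m d → Fin d → ℂ) :
    Fin m ⊕ Fin m → CSpace m d × CSpace m d → CSpace m d × CSpace m d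
  | Sum.inl k => fun q => (coeffL Θ k q.1 q.2, 0)
  | Sum.inr k => fun q => (0, coeffLbar Θ k q.1 q.2)

/-- The extrinsic complexification `𝓜 = {(z, w, ζ, ξ) : ξ = Θ(ζ, z, w)}` of `M`. -/
def complexification (M : LocalGenericSubmanifold m d)
    (Θ : (Fin m → ℂ) × CSpace m d → Fin d → ℂ) : Set (CSpace m d × CSpace m d) :=
  {q | q.1 ∈ ball 0 M.radius ∧ q.2 ∈ ball 0 M.radius ∧ q.2.2 = Θ (q.2.1, q.1)}

/-- The local CR orbit `𝒪_CR(M, p)`: the orbit of `p` in `M` under the real flows of the vector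
fields `Re L_k`, `Im L_k`. -/
def crOrbit (M : LocalGenericSubmanifold m d) (Θ : (Fin m → ℂ) × CSpace m d → Fin d → ℂ)
    (K : ℕ) (δ : ℝ) (p : CSpace m d) : Set (CSpace m d) :=
  localOrbit ℝ (crField Θ) M.carrier K δ p

/-- The local orbit of `q` in `𝓜` under the complex flows of the vector fields `𝓛_k`, `𝓛̲_k`. -/
def complexOrbit (M : LocalGenericSubmanifold m d) (Θ : (Fin m → ℂ) × CSpace m d → Fin d → ℂ)
    (K : ℕ) (δ : ℝ) (q : CSpace m d × CSpace m d) : Set (CSpace m d × CSpace m d) :=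
  localOrbit ℂ (complexField Θ) (complexification M Θ) K δ q

/-- The point `p^c = (p, p̄)`. -/
def pc (p : CSpace m d) : CSpace m d × CSpace m d := (p, star p)

/-- The antiholomorphic involution `σ(t, τ) = (τ̄, t̄)`. -/
def sigma (q : CSpace m d × CSpace m d) : CSpace m d × CSpace m d := (star q.2, star q.1)

/-- The antiholomorphic diagonal `{τ = t̄}`. -/
def antidiagonal (m d : ℕ) : Set (CSpace m d × CSpace m d) := {q | q.2 = star q.1}

/-- Near `p`, the set `N ⊆ ℂⁿ` is a real analytic submanifold, and near `p^c` the set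
`N' ⊆ ℂⁿ × ℂⁿ` is its extrinsic complexification: `N = {χ(t, t̄) = 0}` and `N' = {χ(t, τ) = 0}` for
finitely many power series `χ_l(t, τ)` that are real (that is, `χ_l(t, t̄)` is real; equivalently,
the conjugate of `χ_l(t, τ)` is `χ_l(τ̄, t̄)`) and have linearly independent differentials. -/
def IsExtrinsicComplexificationAt (p : CSpace m d) (N : Set (CSpace m d))
    (N' : Set (CSpace m d × CSpace m d)) : Prop :=
  ∃ (c : ℕ) (χ : CSpace m d × CSpace m d → Fin c → ℂ),
    AnalyticAt ℂ χ (pc p) ∧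
    (∀ᶠ q in 𝓝 (pc p), star (χ q) = χ (sigma q)) ∧
    χ (pc p) = 0 ∧
    Function.Surjective (fderiv ℂ χ (pc p)) ∧
    (∀ᶠ t in 𝓝 p, t ∈ N ↔ χ (t, star t) = 0) ∧
    ∀ᶠ q in 𝓝 (pc p), q ∈ N' ↔ χ q = 0

end Complexification

end CROrbit

end

namespace CROrbit

/-! Germs of submanifolds are handled as fixed point sets of analytic retractions `R`. Inclusion of
fixed point sets becomes an identity such as `R ∘ R' = R'`, and the tangent space is the range of
the differential.

Local orbits (`IsFlowSystem.exists_orbit_retraction`, in the spirit of Nagano). Let `e` be the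
largest dimension of an immersed concatenation of flows starting at `p` with arbitrarily small
times. At such an immersion every field is tangent to the image, otherwise one more flow would give
dimension `e + 1`. Hence flows do not leave the image, and concatenations that start on it have rank
at most `e`; minors are analytic, so the bound continues to concatenations starting at `p`
(`finrank_range_fderiv_le`). Following an immersed family and returning along the reversed flows
with frozen times gives an immersed family through `p`. The rank bound makes all fields tangent to
its image, so uniqueness for ODEs keeps every short orbit inside. Conversely, for each `δ` another
such family with times less than `δ` lies in the orbit and has the same dimension, so the two germs
agree. This takes `2 e` flows, and `e ≤ 2m + d` because the orbit lies in `M`, respectively in its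
complexification; hence the bound on `K`.

Comparison (`exists_orbit_comparison`). Let `R` be the retraction onto the complexified orbit and
`R'` the one onto the CR orbit. The map `t ↦ (t, t̄)` carries CR curves to integral curves of
combinations of the fields `𝓛_k`, `𝓛̲_k`, hence into the fixed points of `R`. The antidiagonal is
maximally totally real, so `R'` complexifies to a holomorphic retraction `Q`, and identities for `Q`
need only be checked there: `R ∘ Q = Q`, `Q` commutes with `sigma`, and the holomorphic fields are
tangent to `Q`. Tangency puts the complexified orbit inside the fixed points of `Q`, so `R` and `Q`
fix the same germ, whose trace on the antidiagonal is the CR orbit. Averaging `R` with its conjugate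
gives real equations with independent differentials (`exists_real_equations`).

Algebraic case. `Θ` is algebraic because a polynomial relation on the totally real graph propagates
to its complexification. The flows of `𝓛_k`, `𝓛̲_k` are explicit in `Θ`. Algebraic maps are stable
under composition and local inversion, which covers the parametrization, the retraction and the
equations. The CR flows are never asked to be algebraic: the real equations are obtained by
restriction. -/

theorem _root_.AnalyticAt.clm_apply' {𝕂 E F G : Type*} [NontriviallyNormedField 𝕂]
    [NormedAddCommGroup E] [NormedSpace 𝕂 E] [NormedAddCommGroup F] [NormedSpace 𝕂 F]
    [NormedAddCommGroup G] [NormedSpace 𝕂 G] {f : E → F →L[𝕂] G} {g : E → F} {x : E}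
    (hf : AnalyticAt 𝕂 f x) (hg : AnalyticAt 𝕂 g x) : AnalyticAt 𝕂 (fun y => f y (g y)) x :=
  ((ContinuousLinearMap.id 𝕂 (F →L[𝕂] G)).analyticAt_bilinear (f x, g x)).comp₂ hf hg

/-! ### Germs of submanifolds as fixed point sets of retractions -/

section Retraction

variable {𝕂 : Type} [RCLike 𝕂] {E : Type} [NormedAddCommGroup E] [NormedSpace 𝕂 E]

/-- `R` is the germ at `q` of an analytic retraction; the germ of its fixed point set is the germ of
an analytic submanifold with tangent space the range of the differential of `R` at `q`. -/
structure IsLocalRetraction (𝕂 : Type) [RCLike 𝕂] {E : Type} [NormedAddCommGroup E]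
    [NormedSpace 𝕂 E] (R : E → E) (q : E) : Prop where
  analytic : AnalyticAt 𝕂 R q
  fixed : R q = q
  idem : ∀ᶠ x in 𝓝 q, R (R x) = R x

/-- The vector field `X` is tangent near `q` to the fixed point set of `R`. -/
def IsTangentTo (𝕂 : Type) [RCLike 𝕂] {E : Type} [NormedAddCommGroup E]
    [NormedSpace 𝕂 E] (X : E → E) (R : E → E) (q : E) : Prop :=
  ∀ᶠ x in 𝓝 q, R x = x → fderiv 𝕂 R x (X x) = X x

namespace IsLocalRetraction

variable {R R' : E → E} {q : E}

theorem tendsto (h : IsLocalRetraction 𝕂 R q) : Tendsto R (𝓝 q) (𝓝 q) := by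
  have := h.analytic.continuousAt.tendsto
  rwa [h.fixed] at this

/-- The pair `(f, R)` is an immersion at `q`: a vector killed by both differentials lies in the
range of the projection `dR` and in its kernel. So `(f, R)` is injective near `q`, and it takes the
same value at `x` and at `R x` when `f x = 0`. -/
theorem eq_of_fderiv_ker_le {F : Type} [NormedAddCommGroup F] [NormedSpace 𝕂 F]
    [FiniteDimensional 𝕂 E]
    (h : IsLocalRetraction 𝕂 R q) {f : E → F} (hf : AnalyticAt 𝕂 f q)
    (hfR : ∀ᶠ x in 𝓝 q, f (R x) = 0)
    (hker : ∀ v, fderiv 𝕂 f q v = 0 → v ∈ (fderiv 𝕂 R q).range) :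
    ∀ᶠ x in 𝓝 q, f x = 0 ↔ R x = x := by
  have hRR : (fderiv 𝕂 R q).comp (fderiv 𝕂 R q) = fderiv 𝕂 R q := by
    have h1 : HasFDerivAt (R ∘ R) ((fderiv 𝕂 R q).comp (fderiv 𝕂 R q)) q := by
      apply HasFDerivAt.comp
      · rw [h.fixed]; exact h.analytic.differentiableAt.hasFDerivAt
      · exact h.analytic.differentiableAt.hasFDerivAt
    exact (h1.congr_of_eventuallyEq (h.idem.mono fun x hx => hx.symm)).unique
      h.analytic.differentiableAt.hasFDerivAt
  let T : E →L[𝕂] F × E := (fderiv 𝕂 f q).prod (fderiv 𝕂 R q)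
  have hT : Function.Injective T := by
    rw [injective_iff_map_eq_zero]
    intro v hv
    have h1 : fderiv 𝕂 f q v = 0 := congrArg Prod.fst hv
    have h2 : fderiv 𝕂 R q v = 0 := congrArg Prod.snd hv
    obtain ⟨w, rfl⟩ := hker v h1
    have h3 := congrArg (fun A => A w) hRR
    simp only [ContinuousLinearMap.comp_apply] at h3
    exact h3.symm.trans h2
  have := FiniteDimensional.complete 𝕂 E
  obtain ⟨K, hK, hanti⟩ := (LinearMap.injective_iff_antilipschitz (f := (T : E →ₗ[𝕂] F × E))).1 hT
  have hs : HasStrictFDerivAt (fun x => (f x, R x)) T q :=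
    hf.hasStrictFDerivAt.prodMk h.analytic.hasStrictFDerivAt
  have ht : Tendsto (fun x => (x, R x)) (𝓝 q) (𝓝 (q, q)) := tendsto_id.prodMk_nhds h.tendsto
  -- Half of the reciprocal of the antilipschitz constant: at the pair `(x, R x)` this gives `‖x - R
  -- x‖ ≤ ‖x - R x‖ / 2`.
  have ho := (hs.isLittleO.comp_tendsto ht).bound (c := (K : ℝ)⁻¹ / 2) (by positivity)
  filter_upwards [ho, hfR, h.idem] with x hx hfx hRx
  constructor
  · intro h0
    simp only [Function.comp, h0, hfx, hRx] at hx
    have h1 : ‖x - R x‖ ≤ K * ‖T (x - R x)‖ := by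
      have := hanti.le_mul_dist (x - R x) 0
      simpa using this
    have h2 : ‖T (x - R x)‖ ≤ (K : ℝ)⁻¹ / 2 * ‖x - R x‖ := by
      have : ((0 : F), R x) - (0, R x) - T (x - R x) = - T (x - R x) := by simp
      rw [this, norm_neg] at hx
      exact hx
    have hK' : (0 : ℝ) < K := hK
    have h3 : ‖x - R x‖ ≤ ‖x - R x‖ / 2 := by
      calc ‖x - R x‖ ≤ K * ((K : ℝ)⁻¹ / 2 * ‖x - R x‖) := by
            exact h1.trans (by gcongr)
        _ = _ := by field_simp
    have h4 : ‖x - R x‖ = 0 := by linarith [norm_nonneg (x - R x)]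
    exact (sub_eq_zero.1 (norm_eq_zero.1 h4)).symm
  · intro h0
    rw [h0] at hfx; exact hfx

theorem eventually_comp (h : IsLocalRetraction 𝕂 R q) {P : E → Prop} (hP : ∀ᶠ x in 𝓝 q, P x) :
    ∀ᶠ x in 𝓝 q, P (R x) := h.tendsto.eventually hP

theorem fderiv_comp (h : IsLocalRetraction 𝕂 R q) (h' : IsLocalRetraction 𝕂 R' q)
    (hRR : ∀ᶠ x in 𝓝 q, R (R' x) = R' x) :
    (fderiv 𝕂 R q).comp (fderiv 𝕂 R' q) = fderiv 𝕂 R' q := by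
  have h1 : HasFDerivAt (R ∘ R') ((fderiv 𝕂 R q).comp (fderiv 𝕂 R' q)) q := by
    apply HasFDerivAt.comp
    · rw [h'.fixed]; exact h.analytic.differentiableAt.hasFDerivAt
    · exact h'.analytic.differentiableAt.hasFDerivAt
  exact (h1.congr_of_eventuallyEq (hRR.mono fun x hx => hx.symm)).unique
    h'.analytic.differentiableAt.hasFDerivAt

theorem range_fderiv_le (h : IsLocalRetraction 𝕂 R q) (h' : IsLocalRetraction 𝕂 R' q)
    (hRR : ∀ᶠ x in 𝓝 q, R (R' x) = R' x) :
    (fderiv 𝕂 R' q).range ≤ (fderiv 𝕂 R q).range := by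
  rintro _ ⟨v, rfl⟩
  exact ⟨fderiv 𝕂 R' q v, congrArg (fun A => A v) (h.fderiv_comp h' hRR)⟩

/-- Nested submanifolds of equal dimension have the same germ. The equations of the larger one are
`x - R x = 0`, whose differential has kernel inside the range of `dR`, and this equals the range of
`dR'` by the dimension count. -/
theorem eq_of_finrank_eq [FiniteDimensional 𝕂 E]
    (h : IsLocalRetraction 𝕂 R q) (h' : IsLocalRetraction 𝕂 R' q)
    (hRR : ∀ᶠ x in 𝓝 q, R (R' x) = R' x)
    (hdim : Module.finrank 𝕂 (fderiv 𝕂 R q).range ≤ Module.finrank 𝕂 (fderiv 𝕂 R' q).range) :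
    ∀ᶠ x in 𝓝 q, R x = x ↔ R' x = x := by
  have hrange : (fderiv 𝕂 R' q).range = (fderiv 𝕂 R q).range :=
    Submodule.eq_of_le_of_finrank_le (h.range_fderiv_le h' hRR) hdim
  have hid : fderiv 𝕂 (fun x => x - R x) q = ContinuousLinearMap.id 𝕂 E - fderiv 𝕂 R q := by
    have h2 := (hasFDerivAt_id (𝕜 := 𝕂) q).sub h.analytic.differentiableAt.hasFDerivAt
    exact h2.fderiv
  have := h'.eq_of_fderiv_ker_le (f := fun x => x - R x) (analyticAt_id.sub h.analytic)
    (hRR.mono fun x hx => by simp [hx]) (fun v hv => by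
      rw [hrange]
      rw [hid] at hv
      exact ⟨v, (sub_eq_zero.1 hv).symm⟩)
  filter_upwards [this] with x hx
  rw [← hx, sub_eq_zero, eq_comm]

end IsLocalRetraction

/-- The image of an analytic immersion is the fixed point set of an analytic retraction. -/
theorem exists_retraction_of_immersion [FiniteDimensional 𝕂 E] {V : Type} [NormedAddCommGroup V]
    [NormedSpace 𝕂 V] [FiniteDimensional 𝕂 V] {σ : V → E} {v₀ : V} (hσ : AnalyticAt 𝕂 σ v₀)
    (hinj : Function.Injective (fderiv 𝕂 σ v₀)) :
    ∃ (π : E →L[𝕂] V) (H : V → V), AnalyticAt 𝕂 H (π (σ v₀)) ∧ H (π (σ v₀)) = v₀ ∧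
      (∀ᶠ y in 𝓝 (π (σ v₀)), π (σ (H y)) = y) ∧
      IsLocalRetraction 𝕂 (fun x => σ (H (π x))) (σ v₀) ∧
      (∀ᶠ v in 𝓝 v₀, H (π (σ v)) = v) ∧
      (fderiv 𝕂 (fun x => σ (H (π x))) (σ v₀)).range = (fderiv 𝕂 σ v₀).range := by
  have := FiniteDimensional.complete 𝕂 E
  have := FiniteDimensional.complete 𝕂 V
  -- The projection `π` is a linear left inverse of `dσ`, so `π ∘ σ` has differential the identity
  -- and `H` can be its local inverse; then `σ ∘ H ∘ π` retracts onto the image of `σ`.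
  obtain ⟨g, hg⟩ := LinearMap.exists_leftInverse_of_injective (fderiv 𝕂 σ v₀ : V →ₗ[𝕂] E)
    (LinearMap.ker_eq_bot.2 hinj)
  let π : E →L[𝕂] V := LinearMap.toContinuousLinearMap g
  have hπ : ∀ v, π (fderiv 𝕂 σ v₀ v) = v := fun v => congrArg (fun A => A v) hg
  have hder : HasFDerivAt (fun v => π (σ v)) (ContinuousLinearEquiv.refl 𝕂 V : V →L[𝕂] V) v₀ := by
    have h1 := π.hasFDerivAt.comp v₀ hσ.differentiableAt.hasFDerivAt
    exact h1.congr_fderiv (by ext v; exact hπ v)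
  have han : AnalyticAt 𝕂 (fun v => π (σ v)) v₀ := (π.analyticAt _).comp hσ
  have hs : HasStrictFDerivAt (fun v => π (σ v)) (ContinuousLinearEquiv.refl 𝕂 V : V →L[𝕂] V) v₀ := by
    have := han.hasStrictFDerivAt
    rwa [hder.fderiv] at this
  let H := hs.localInverse
  have hHan : AnalyticAt 𝕂 H (π (σ v₀)) := by
    have h1 : ContDiffAt 𝕂 ⊤ (fun v => π (σ v)) v₀ := han.contDiffAt
    have h2 := h1.to_localInverse hder (by simp)
    exact h2.analyticAt
  have hH0 : H (π (σ v₀)) = v₀ := hs.localInverse_apply_image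
  have hr : ∀ᶠ y in 𝓝 (π (σ v₀)), π (σ (H y)) = y := hs.eventually_right_inverse
  have hl : ∀ᶠ v in 𝓝 v₀, H (π (σ v)) = v := hs.eventually_left_inverse
  have hl' : ∀ᶠ v in 𝓝 v₀, σ (H (π (σ v))) = σ v := hl.mono fun v hv => by rw [hv]
  have hfix : σ (H (π (σ v₀))) = σ v₀ := by rw [hH0]
  have hR : AnalyticAt 𝕂 (fun x => σ (H (π x))) (σ v₀) := by
    refine AnalyticAt.comp (g := σ) (f := fun x => H (π x)) (by rw [hH0]; exact hσ) ?_
    exact AnalyticAt.comp (g := H) (f := fun x => π x) hHan (π.analyticAt _)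
  refine ⟨π, H, hHan, hH0, hr, ⟨hR, hfix, ?_⟩, hl, ?_⟩
  · have : ∀ᶠ x in 𝓝 (σ v₀), π (σ (H (π x))) = π x := π.continuous.continuousAt.eventually hr
    exact this.mono fun x hx => by simp only [hx]
  · apply le_antisymm
    · have h1 : HasFDerivAt (fun x => σ (H (π x)))
          ((fderiv 𝕂 σ v₀).comp (fderiv 𝕂 (fun x => H (π x)) (σ v₀))) (σ v₀) := by
        refine HasFDerivAt.comp (g := σ) (f := fun x => H (π x)) _ ?_ ?_
        · rw [hH0]; exact hσ.differentiableAt.hasFDerivAt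
        · exact (AnalyticAt.comp (g := H) (f := fun x => π x) hHan
            (π.analyticAt _)).differentiableAt.hasFDerivAt
      rw [h1.fderiv]
      rintro _ ⟨v, rfl⟩
      exact ⟨_, rfl⟩
    · have h1 : HasFDerivAt (fun v => σ (H (π (σ v))))
          ((fderiv 𝕂 (fun x => σ (H (π x))) (σ v₀)).comp (fderiv 𝕂 σ v₀)) v₀ :=
        HasFDerivAt.comp (g := fun x => σ (H (π x))) (f := σ) _
          hR.differentiableAt.hasFDerivAt hσ.differentiableAt.hasFDerivAt
      have h2 := (h1.congr_of_eventuallyEq (hl'.mono fun v hv => hv.symm)).unique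
        hσ.differentiableAt.hasFDerivAt
      rintro _ ⟨v, rfl⟩
      exact ⟨fderiv 𝕂 σ v₀ v, congrArg (fun A => A v) h2⟩

end Retraction

/-! ### Short integral curves stay near their starting point -/

section Confinement

variable {𝕂 : Type} [RCLike 𝕂] {E : Type} [NormedAddCommGroup E] [NormedSpace 𝕂 E]
  [NormedSpace ℝ E] {X : E → E} {q : E}

/-- Integral curves starting near `q` stay near `q` for a short time. -/
theorem exists_confinement (hX : ContinuousAt X q) {U : Set E} (hU : U ∈ 𝓝 q) :
    ∃ W ∈ 𝓝 q, ∃ δ₀ > 0, ∀ (c : ℝ → E) (k : 𝕂), ‖k‖ < δ₀ → c 0 ∈ W →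
      (∀ r ∈ Set.Icc (0 : ℝ) 1, HasDerivAt c (k • X (c r)) r) →
      ∀ r ∈ Set.Icc (0 : ℝ) 1, c r ∈ U := by
  obtain ⟨η, hη, hηU⟩ := Metric.mem_nhds_iff.1 hU
  have h1 : ∀ᶠ x in 𝓝 q, ‖X x‖ < ‖X q‖ + 1 :=
    hX.norm.eventually_lt_const (by linarith)
  obtain ⟨η', hη', hX'⟩ := Metric.eventually_nhds_iff_ball.1 h1
  set ρ := min η η' with hρ
  have hρ0 : 0 < ρ := lt_min hη hη'
  set C := ‖X q‖ + 1
  have hC : 0 < C := by positivity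
  -- Start within `ρ / 2`; speed at most `C` and time below `ρ / (4C)` add less than `ρ / 4`, so the
  -- curve never reaches the boundary of the ball where the bound on `X` holds.
  refine ⟨ball q (ρ / 2), ball_mem_nhds _ (by positivity), ρ / (4 * C), by positivity, ?_⟩
  intro c k hk h0 hc r hr
  have hb := image_norm_le_of_norm_deriv_right_lt_deriv_boundary' (a := 0) (b := 1)
    (f := fun r => c r - c 0) (f' := fun r => k • X (c r)) (B := fun r => ρ / 4 * r)
    (B' := fun _ => ρ / 4)
    (fun r hr => ((hc r hr).sub_const _).continuousAt.continuousWithinAt)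
    (fun r hr => ((hc r (Set.Ico_subset_Icc_self hr)).sub_const _).hasDerivWithinAt) (by simp)
    (by fun_prop)
    (fun r _ => by simpa using ((hasDerivAt_id r).const_mul (ρ / 4)).hasDerivWithinAt)
    (fun r hr heq => by
      have h2 : c r ∈ ball q η' := by
        rw [mem_ball, dist_eq_norm]
        calc ‖c r - q‖ ≤ ‖c r - c 0‖ + ‖c 0 - q‖ := norm_sub_le_norm_sub_add_norm_sub _ _ _
          _ < ρ / 4 * 1 + ρ / 2 := by
            apply add_lt_add_of_le_of_lt
            · rw [heq]; have := hr.2; gcongr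
            · rwa [mem_ball, dist_eq_norm] at h0
          _ ≤ η' := by have := min_le_right η η'; linarith
      have h3 := hX' _ h2
      rw [norm_smul]
      calc ‖k‖ * ‖X (c r)‖ ≤ ‖k‖ * C := by gcongr
        _ < ρ / (4 * C) * C := by gcongr
        _ = ρ / 4 := by field_simp) hr
  apply hηU
  rw [mem_ball, dist_eq_norm]
  calc ‖c r - q‖ ≤ ‖c r - c 0‖ + ‖c 0 - q‖ := norm_sub_le_norm_sub_add_norm_sub _ _ _
    _ < ρ / 4 * 1 + ρ / 2 := by
      apply add_lt_add_of_le_of_lt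
      · refine hb.trans ?_
        have := hr.2
        gcongr
      · rwa [mem_ball, dist_eq_norm] at h0
    _ ≤ η := by have := min_le_left η η'; linarith

end Confinement

/-! ### Flows of tangent fields preserve fixed point sets -/

section Invariance

variable {𝕂 : Type} [RCLike 𝕂] {E : Type} [NormedAddCommGroup E] [NormedSpace 𝕂 E]
  [NormedSpace ℝ E] [IsScalarTower ℝ 𝕂 E] {R X : E → E} {q : E}

/-- Integral curves, staying near `q`, of a field tangent to the fixed point set of a retraction do
not leave this set. -/
theorem IsLocalRetraction.invariant [CompleteSpace E] (h : IsLocalRetraction 𝕂 R q)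
    (hX : AnalyticAt 𝕂 X q) (hXR : IsTangentTo 𝕂 X R q) :
    ∃ W ∈ 𝓝 q, ∀ (c : ℝ → E) (k : 𝕂),
      (∀ r ∈ Set.Icc (0 : ℝ) 1, c r ∈ W ∧ HasDerivAt c (k • X (c r)) r) → R (c 0) = c 0 →
      ∀ r ∈ Set.Icc (0 : ℝ) 1, R (c r) = c r := by
  -- The derivative of `c - R ∘ c` is `k • g (c)`, and `g` vanishes at `R (c)`. A Lipschitz bound on
  -- `g` then gives `‖g (c)‖ ≤ K ‖c - R (c)‖`, and Gronwall's inequality concludes.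
  let g : E → E := fun x => X x - fderiv 𝕂 R x (X x)
  have hg : AnalyticAt 𝕂 g q := hX.sub (h.analytic.fderiv.clm_apply' hX)
  obtain ⟨K, U, hU, hK⟩ := hg.hasStrictFDerivAt.exists_lipschitzOnWith
  have h1 : ∀ᶠ x in 𝓝 q, x ∈ U ∧ R x ∈ U ∧ DifferentiableAt 𝕂 R x ∧ g (R x) = 0 := by
    have h2 : ∀ᶠ x in 𝓝 q, R (R x) = R x → fderiv 𝕂 R (R x) (X (R x)) = X (R x) :=
      h.eventually_comp hXR
    have h3 : ∀ᶠ x in 𝓝 q, DifferentiableAt 𝕂 R x :=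
      h.analytic.eventually_analyticAt.mono fun x hx => hx.differentiableAt
    filter_upwards [hU, h.tendsto hU, h2, h3, h.idem] with x a b c d e
    exact ⟨a, b, d, by simp [g, c e]⟩
  refine ⟨_, h1, fun c k hc h0 => ?_⟩
  have hd : ∀ r ∈ Set.Icc (0 : ℝ) 1, HasDerivAt (fun r => c r - R (c r)) (k • g (c r)) r := by
    intro r hr
    obtain ⟨⟨_, _, hdiff, _⟩, hder⟩ := hc r hr
    have h2 : HasFDerivAt R ((fderiv 𝕂 R (c r)).restrictScalars ℝ) (c r) :=
      hdiff.hasFDerivAt.restrictScalars ℝ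
    have h3 := hder.sub (h2.comp_hasDerivAt r hder)
    refine h3.congr_deriv ?_ |>.congr_of_eventuallyEq (Eventually.of_forall fun _ => rfl)
    show k • X (c r) - fderiv 𝕂 R (c r) (k • X (c r)) = k • (X (c r) - fderiv 𝕂 R (c r) (X (c r)))
    rw [map_smul, smul_sub]
  intro r hr
  have := eq_zero_of_abs_deriv_le_mul_abs_self_of_eq_zero_right (a := 0) (b := 1)
    (f := fun r => c r - R (c r)) (f' := fun r => k • g (c r)) (K := ‖k‖ * K)
    (fun r hr => (hd r hr).continuousAt.continuousWithinAt)
    (fun r hr => (hd r (Set.Ico_subset_Icc_self hr)).hasDerivWithinAt) (by simp [h0])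
    (fun r hr => by
      obtain ⟨⟨a, b, _, d⟩, _⟩ := hc r (Set.Ico_subset_Icc_self hr)
      rw [norm_smul, mul_assoc]
      gcongr
      have := hK.dist_le_mul _ a _ b
      rwa [d, dist_zero_right, dist_eq_norm] at this) r hr
  exact (sub_eq_zero.1 this).symm

/-- Restriction of an integral curve to a ray. -/
theorem hasDerivAt_ray {γ : 𝕂 → E} {s : 𝕂} {r : ℝ}
    (h : HasDerivAt γ (X (γ (r • s))) (r • s)) :
    HasDerivAt (fun r : ℝ => γ (r • s)) (s • X (γ (r • s))) r := by
  have h1 : HasDerivAt (fun r : ℝ => r • s) s r := by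
    simpa using (hasDerivAt_id r).smul_const s
  exact HasDerivAt.scomp r h h1

/-- Complex times are treated as real ones: the integral curve is restricted to the segment from `0`
to `s`, with `s` absorbed into the field. -/
theorem FlowStep.exists_curve {S : Set E} {δ : ℝ} {x y : E} (h : FlowStep 𝕂 X S δ x y) :
    ∃ (c : ℝ → E) (k : 𝕂), ‖k‖ < δ ∧ c 0 = x ∧ c 1 = y ∧
      ∀ r ∈ Set.Icc (0 : ℝ) 1, c r ∈ S ∧ HasDerivAt c (k • X (c r)) r := by
  obtain ⟨γ, h0, hγ, s, hs, hy⟩ := h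
  rw [mem_ball_zero_iff] at hs
  refine ⟨fun r => γ (r • s), s, hs, by simp [h0], by simp [hy], fun r hr => ?_⟩
  have hrs : r • s ∈ ball (0 : 𝕂) δ := by
    rw [mem_ball_zero_iff, norm_smul, Real.norm_of_nonneg hr.1]
    calc r * ‖s‖ ≤ 1 * ‖s‖ := by gcongr; exact hr.2
      _ < δ := by rwa [one_mul]
  exact ⟨(hγ _ hrs).1, hasDerivAt_ray (hγ _ hrs).2⟩

variable {ι : Type} {Y : ι → E → E}

/-- A local orbit with small times of a system of fields tangent to the fixed point set of a
retraction is contained in this set. -/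
theorem IsLocalRetraction.localOrbit_subset [CompleteSpace E] [Finite ι]
    (h : IsLocalRetraction 𝕂 R q) (hY : ∀ a, AnalyticAt 𝕂 (Y a) q)
    (hYR : ∀ a, IsTangentTo 𝕂 (Y a) R q) {U : Set E} (hU : U ∈ 𝓝 q) (K : ℕ) :
    ∃ δ₀ > 0, ∀ δ ≤ δ₀, ∀ S : Set E, ∀ y ∈ localOrbit 𝕂 Y S K δ q, y ∈ U ∧ R y = y := by
  have step : ∀ U ∈ 𝓝 q, ∃ W ∈ 𝓝 q, ∃ δ₀ > 0, ∀ δ ≤ δ₀, ∀ (S : Set E) (a : ι) (x y : E),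
      x ∈ W → R x = x → FlowStep 𝕂 (Y a) S δ x y → y ∈ U ∧ R y = y := by
    intro U hU
    choose W₁ hW₁ hinv using fun a => h.invariant (hY a) (hYR a)
    choose W₂ hW₂ δ₂ hδ₂ hconf using fun a =>
      exists_confinement (𝕂 := 𝕂) (hY a).continuousAt (inter_mem hU (hW₁ a))
    have hδ : ∃ δ₀ > 0, ∀ a, δ₀ ≤ δ₂ a := by
      cases nonempty_fintype ι
      by_cases hι : Nonempty ι
      · obtain ⟨a, ha⟩ := Finite.exists_min δ₂
        exact ⟨δ₂ a, hδ₂ a, ha⟩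
      · exact ⟨1, one_pos, fun a => (hι ⟨a⟩).elim⟩
    obtain ⟨δ₀, hδ₀, hle⟩ := hδ
    refine ⟨⋂ a, W₂ a, Filter.iInter_mem.2 hW₂, δ₀, hδ₀, ?_⟩
    intro δ hδ S a x y hx hRx hxy
    obtain ⟨c, k, hk, hc0, hc1, hc⟩ := hxy.exists_curve
    have h1 := hconf a c k (hk.trans_le (hδ.trans (hle a)))
      (by rw [hc0]; exact Set.mem_iInter.1 hx a) (fun r hr => (hc r hr).2)
    have h2 := hinv a c k (fun r hr => ⟨(h1 r hr).2, (hc r hr).2⟩) (by rw [hc0, hRx]) 1 (by simp)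
    exact ⟨hc1 ▸ (h1 1 (by simp)).1, hc1 ▸ h2⟩
  have chain : ∀ k, ∀ U ∈ 𝓝 q, ∃ δ₀ > 0, ∀ δ ≤ δ₀, ∀ S : Set E,
      ∀ y ∈ flowChain 𝕂 Y S δ q k, y ∈ U ∧ R y = y := by
    intro k
    induction k with
    | zero =>
      intro U hU
      refine ⟨1, one_pos, fun δ _ S y hy => ?_⟩
      rw [show y = q from hy]
      exact ⟨mem_of_mem_nhds hU, h.fixed⟩
    | succ k ih =>
      intro U hU
      obtain ⟨W, hW, δ₁, hδ₁, h1⟩ := step U hU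
      obtain ⟨δ₂, hδ₂, h2⟩ := ih W hW
      refine ⟨min δ₁ δ₂, lt_min hδ₁ hδ₂, fun δ hδ S y hy => ?_⟩
      obtain ⟨x, hx, a, hxy⟩ := hy
      obtain ⟨hxW, hRx⟩ := h2 δ (hδ.trans (min_le_right _ _)) S x hx
      exact h1 δ (hδ.trans (min_le_left _ _)) S a x y hxW hRx hxy
  -- The admissible time depends on the number of flows, which is bounded by `K`; the smallest of
  -- the finitely many values works.
  choose δ₁ hδ₁ hc using fun k => chain k U hU
  obtain ⟨k₀, _, hk₀⟩ := Finset.exists_min_image (Finset.range (K + 1)) δ₁ ⟨0, by simp⟩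
  refine ⟨δ₁ k₀, hδ₁ k₀, fun δ hδ S y hy => ?_⟩
  simp only [localOrbit, Set.mem_iUnion] at hy
  obtain ⟨k, hk, hy⟩ := hy
  exact hc k δ (hδ.trans (hk₀ k (by simpa [Nat.lt_succ_iff] using hk))) S y hy

end Invariance

/-! ### Concatenations of flows as families with linear times -/

section Family

variable {𝕂 : Type} [RCLike 𝕂] {E ι : Type}

/-- Concatenation of flows, with times depending linearly on a parameter. -/
def flowFamily (Φ : ι → E × 𝕂 → E) {V : Type} [NormedAddCommGroup V] [NormedSpace 𝕂 V]
    (l : List (ι × (V →L[𝕂] 𝕂))) (x : E) (v : V) : E :=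
  l.foldl (fun y c => Φ c.1 (y, c.2 v)) x

/-- The concatenation of the reversed flows in the reversed order. -/
def reversal {V : Type} [NormedAddCommGroup V] [NormedSpace 𝕂 V]
    (l : List (ι × (V →L[𝕂] 𝕂))) : List (ι × (V →L[𝕂] 𝕂)) :=
  l.reverse.map fun c => (c.1, -c.2)

/-- Precomposition of the times with a linear map. -/
def pullTimes {V V' : Type} [NormedAddCommGroup V] [NormedSpace 𝕂 V] [NormedAddCommGroup V']
    [NormedSpace 𝕂 V'] (T : V' →L[𝕂] V) (l : List (ι × (V →L[𝕂] 𝕂))) :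
    List (ι × (V' →L[𝕂] 𝕂)) :=
  l.map fun c => (c.1, c.2.comp T)

variable {Φ : ι → E × 𝕂 → E} {V V' : Type} [NormedAddCommGroup V] [NormedSpace 𝕂 V]
  [NormedAddCommGroup V'] [NormedSpace 𝕂 V']

@[simp] theorem flowFamily_nil (x : E) (v : V) : flowFamily Φ [] x v = x := rfl

@[simp] theorem flowFamily_cons (c : ι × (V →L[𝕂] 𝕂)) (l : List (ι × (V →L[𝕂] 𝕂))) (x : E) (v : V) :
    flowFamily Φ (c :: l) x v = flowFamily Φ l (Φ c.1 (x, c.2 v)) v := rfl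

theorem flowFamily_append (l l' : List (ι × (V →L[𝕂] 𝕂))) (x : E) (v : V) :
    flowFamily Φ (l ++ l') x v = flowFamily Φ l' (flowFamily Φ l x v) v := by
  simp [flowFamily]

theorem flowFamily_pullTimes (T : V' →L[𝕂] V) (l : List (ι × (V →L[𝕂] 𝕂))) (x : E) (v : V') :
    flowFamily Φ (pullTimes T l) x v = flowFamily Φ l x (T v) := by
  simp [flowFamily, pullTimes, List.foldl_map]

theorem flowFamily_zero (l : List (ι × (V →L[𝕂] 𝕂))) {x : E} (hx : ∀ a, Φ a (x, 0) = x) :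
    flowFamily Φ l x 0 = x := by
  induction l with
  | nil => rfl
  | cons c l ih => simp [hx, ih]

@[simp] theorem length_reversal (l : List (ι × (V →L[𝕂] 𝕂))) :
    (reversal l).length = l.length := by simp [reversal]

@[simp] theorem length_pullTimes (T : V' →L[𝕂] V) (l : List (ι × (V →L[𝕂] 𝕂))) :
    (pullTimes T l).length = l.length := by simp [pullTimes]

theorem reversal_cons (c : ι × (V →L[𝕂] 𝕂)) (l : List (ι × (V →L[𝕂] 𝕂))) :
    reversal (c :: l) = reversal l ++ [(c.1, -c.2)] := by simp [reversal]

theorem reversal_reversal (l : List (ι × (V →L[𝕂] 𝕂))) : reversal (reversal l) = l := by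
  simp [reversal, Function.comp_def]

theorem norm_reversal {l : List (ι × (V →L[𝕂] 𝕂))} (h : ∀ c ∈ l, ‖c.2‖ ≤ 1) :
    ∀ c ∈ reversal l, ‖c.2‖ ≤ 1 := by
  intro c hc
  simp only [reversal, List.mem_map, List.mem_reverse] at hc
  obtain ⟨c', hc', rfl⟩ := hc
  simpa using h c' hc'

theorem norm_pullTimes {T : V' →L[𝕂] V} (hT : ‖T‖ ≤ 1) {l : List (ι × (V →L[𝕂] 𝕂))}
    (h : ∀ c ∈ l, ‖c.2‖ ≤ 1) : ∀ c ∈ pullTimes T l, ‖c.2‖ ≤ 1 := by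
  intro c hc
  simp only [pullTimes, List.mem_map] at hc
  obtain ⟨c', hc', rfl⟩ := hc
  calc ‖c'.2.comp T‖ ≤ ‖c'.2‖ * ‖T‖ := ContinuousLinearMap.opNorm_comp_le _ _
    _ ≤ 1 * 1 := by gcongr; exact h c' hc'
    _ = 1 := one_mul 1

end Family

/-! ### Uniform estimates for short concatenations -/

section FlowSystem

variable {𝕂 : Type} [RCLike 𝕂] {E : Type} [NormedAddCommGroup E] [NormedSpace 𝕂 E] {ι : Type}

/-- The maps `Φ a` are analytic local flows near `p` of the analytic vector fields `X a`, and they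
leave the set `A` invariant. -/
structure IsFlowSystem (𝕂 : Type) [RCLike 𝕂] {E : Type} [NormedAddCommGroup E] [NormedSpace 𝕂 E]
    {ι : Type} (X : ι → E → E) (Φ : ι → E × 𝕂 → E) (A : Set E) (p : E) : Prop where
  field : ∀ a, AnalyticAt 𝕂 (X a) p
  analytic : ∀ a, AnalyticAt 𝕂 (Φ a) (p, 0)
  zero : ∀ a, ∀ᶠ x in 𝓝 p, Φ a (x, 0) = x
  deriv : ∀ a, ∀ᶠ z in 𝓝 (p, (0 : 𝕂)), HasDerivAt (fun s => Φ a (z.1, s)) (X a (Φ a z)) z.2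
  inv : ∀ a, ∀ᶠ z in 𝓝 (p, (0 : 𝕂)), Φ a (Φ a z, -z.2) = z.1
  mem : ∀ a, ∀ᶠ z in 𝓝 (p, (0 : 𝕂)), z.1 ∈ A → Φ a z ∈ A

/-- Maps obtained from a constant map by applying successively flows with affine times, such that
all the intermediate points (and times) belong to `U`. -/
inductive IsChainMap (Φ : ι → E × 𝕂 → E) (U : Set (E × 𝕂)) (p : E) {V : Type}
    [NormedAddCommGroup V] [NormedSpace 𝕂 V] (v₀ : V) : (V → E) → Prop
  | const : IsChainMap Φ U p v₀ (fun _ => p)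
  | step (σ : V → E) (a : ι) (ℓ : V →L[𝕂] 𝕂) (c : 𝕂) : IsChainMap Φ U p v₀ σ →
      (σ v₀, ℓ v₀ + c) ∈ U → IsChainMap Φ U p v₀ (fun v => Φ a (σ v, ℓ v + c))

namespace IsFlowSystem

variable {X : ι → E → E} {Φ : ι → E × 𝕂 → E} {A : Set E} {p : E}

theorem apply_base (h : IsFlowSystem 𝕂 X Φ A p) (a : ι) : Φ a (p, 0) = p :=
  (h.zero a).self_of_nhds

variable [CompleteSpace E]

/-- All the properties of a flow system hold on a common neighbourhood. -/
theorem exists_ball [Finite ι] (h : IsFlowSystem 𝕂 X Φ A p) {U : Set E} (hU : U ∈ 𝓝 p) :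
    ∃ ρ > 0, ∀ a, ∀ x ∈ ball p ρ, ∀ s ∈ ball (0 : 𝕂) ρ,
      Φ a (x, s) ∈ U ∧ AnalyticAt 𝕂 (Φ a) (x, s) ∧ Φ a (x, 0) = x ∧
      HasDerivAt (fun s => Φ a (x, s)) (X a (Φ a (x, s))) s ∧ Φ a (Φ a (x, s), -s) = x ∧
      (x ∈ A → Φ a (x, s) ∈ A) ∧ AnalyticAt 𝕂 (X a) x := by
  have h1 : ∀ᶠ z in 𝓝 (p, (0 : 𝕂)), ∀ a,
      Φ a z ∈ U ∧ AnalyticAt 𝕂 (Φ a) z ∧ Φ a (z.1, 0) = z.1 ∧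
      HasDerivAt (fun s => Φ a (z.1, s)) (X a (Φ a z)) z.2 ∧ Φ a (Φ a z, -z.2) = z.1 ∧
      (z.1 ∈ A → Φ a z ∈ A) ∧ AnalyticAt 𝕂 (X a) z.1 := by
    rw [eventually_all]
    intro a
    have hf : Tendsto (fun z : E × 𝕂 => z.1) (𝓝 (p, 0)) (𝓝 p) := continuous_fst.tendsto _
    have hc : Tendsto (Φ a) (𝓝 (p, 0)) (𝓝 p) := by
      have := (h.analytic a).continuousAt.tendsto
      rwa [h.apply_base] at this
    filter_upwards [hc hU, (h.analytic a).eventually_analyticAt, hf.eventually (h.zero a),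
      h.deriv a, h.inv a, h.mem a, hf.eventually (h.field a).eventually_analyticAt]
      with z h1 h2 h3 h4 h5 h6 h7
    exact ⟨h1, h2, h3, h4, h5, h6, h7⟩
  obtain ⟨ρ, hρ, hb⟩ := Metric.eventually_nhds_iff_ball.1 h1
  refine ⟨ρ, hρ, fun a x hx s hs => hb (x, s) ?_ a⟩
  rw [← ball_prod_same]
  exact ⟨hx, hs⟩

/-- The radius depends only on the number of flows, not on the parameter space or the functionals:
functionals of norm at most one turn `‖v‖ < ε` into times of modulus less than `ε`. -/
theorem exists_analytic_family [Finite ι] (h : IsFlowSystem 𝕂 X Φ A p) (N : ℕ) :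
    ∀ U ∈ 𝓝 p, ∃ ε > 0, ∀ (V : Type) [NormedAddCommGroup V] [NormedSpace 𝕂 V]
      (l : List (ι × (V →L[𝕂] 𝕂))), l.length ≤ N → (∀ c ∈ l, ‖c.2‖ ≤ 1) →
      ∀ x ∈ ball p ε, ∀ v ∈ ball (0 : V) ε, flowFamily Φ l x v ∈ U ∧
        AnalyticAt 𝕂 (fun z : E × V => flowFamily Φ l z.1 z.2) (x, v) ∧
        flowFamily Φ (reversal l) (flowFamily Φ l x v) v = x := by
  induction N with
  | zero =>
    intro U hU
    obtain ⟨ε, hε, hεU⟩ := Metric.mem_nhds_iff.1 hU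
    refine ⟨ε, hε, fun V _ _ l hl _ x hx v _ => ?_⟩
    obtain rfl : l = [] := List.length_eq_zero_iff.1 (Nat.le_zero.1 hl)
    exact ⟨hεU hx, analyticAt_fst, rfl⟩
  | succ N ih =>
    intro U hU
    obtain ⟨ε₁, hε₁, h1⟩ := ih U hU
    obtain ⟨ρ, hρ, h2⟩ := h.exists_ball (ball_mem_nhds p hε₁)
    refine ⟨min ε₁ ρ, lt_min hε₁ hρ, fun V _ _ l hl hn x hx v hv => ?_⟩
    have hx1 := ball_subset_ball (min_le_left ε₁ ρ) hx
    have hx2 := ball_subset_ball (min_le_right ε₁ ρ) hx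
    have hv1 := ball_subset_ball (min_le_left ε₁ ρ) hv
    have hv2 := ball_subset_ball (min_le_right ε₁ ρ) hv
    rcases l with _ | ⟨c, l⟩
    · exact h1 V [] (by simp) (by simp) x hx1 v hv1
    · have hcv : c.2 v ∈ ball (0 : 𝕂) ρ := by
        rw [mem_ball_zero_iff] at hv2 ⊢
        calc ‖c.2 v‖ ≤ 1 * ‖v‖ := c.2.le_of_opNorm_le (hn c (by simp)) v
          _ < ρ := by rwa [one_mul]
      obtain ⟨hm, han, _, _, hinv, _, _⟩ := h2 c.1 x hx2 _ hcv
      obtain ⟨g1, g2, g3⟩ := h1 V l (by simpa using hl) (fun c' hc' => hn c' (by simp [hc'])) _ hm v hv1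
      refine ⟨g1, ?_, ?_⟩
      · have h3 : AnalyticAt 𝕂 (fun z : E × V => (Φ c.1 (z.1, c.2 z.2), z.2)) (x, v) := by
          refine AnalyticAt.prod ?_ analyticAt_snd
          refine AnalyticAt.comp (g := Φ c.1) (f := fun z : E × V => (z.1, c.2 z.2)) han ?_
          exact analyticAt_fst.prod ((c.2.analyticAt _).comp analyticAt_snd)
        exact AnalyticAt.comp (g := fun z : E × V => flowFamily Φ l z.1 z.2)
          (f := fun z : E × V => (Φ c.1 (z.1, c.2 z.2), z.2)) g2 h3
      · rw [reversal_cons, flowFamily_append, flowFamily_cons c l x v, g3]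
        simpa using hinv

/-- Links families to orbits. The integer `k` counts the flows already spent reaching `x`, so that
the outgoing and the returning halves can be applied one after the other. -/
theorem exists_chain_family [Finite ι] (h : IsFlowSystem 𝕂 X Φ A p) (N : ℕ) :
    ∃ ε > 0, ∀ (V : Type) [NormedAddCommGroup V] [NormedSpace 𝕂 V]
      (l : List (ι × (V →L[𝕂] 𝕂))), l.length ≤ N → (∀ c ∈ l, ‖c.2‖ ≤ 1) →
      ∀ δ ≤ ε, ∀ x ∈ ball p ε, x ∈ A → ∀ v ∈ ball (0 : V) δ, ∀ k, x ∈ flowChain 𝕂 X A δ p k →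
        flowFamily Φ l x v ∈ A ∧ flowFamily Φ l x v ∈ flowChain 𝕂 X A δ p (k + l.length) := by
  induction N with
  | zero =>
    refine ⟨1, one_pos, fun V _ _ l hl _ δ _ x _ hxA v _ k hk => ?_⟩
    obtain rfl : l = [] := List.length_eq_zero_iff.1 (Nat.le_zero.1 hl)
    exact ⟨hxA, hk⟩
  | succ N ih =>
    obtain ⟨ε₁, hε₁, h1⟩ := ih
    obtain ⟨ρ, hρ, h2⟩ := h.exists_ball (ball_mem_nhds p hε₁)
    refine ⟨min ε₁ ρ, lt_min hε₁ hρ, fun V _ _ l hl hn δ hδ x hx hxA v hv k hk => ?_⟩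
    have hx1 := ball_subset_ball (min_le_left ε₁ ρ) hx
    have hx2 := ball_subset_ball (min_le_right ε₁ ρ) hx
    have hδρ := hδ.trans (min_le_right ε₁ ρ)
    rcases l with _ | ⟨c, l⟩
    · exact ⟨hxA, hk⟩
    · have hcv : c.2 v ∈ ball (0 : 𝕂) δ := by
        rw [mem_ball_zero_iff] at hv ⊢
        calc ‖c.2 v‖ ≤ 1 * ‖v‖ := c.2.le_of_opNorm_le (hn c (by simp)) v
          _ < δ := by rwa [one_mul]
      obtain ⟨hm, _, hz, _, _, hA, _⟩ := h2 c.1 x hx2 _ (ball_subset_ball hδρ hcv)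
      have hstep : FlowStep 𝕂 (X c.1) A δ x (Φ c.1 (x, c.2 v)) := by
        refine ⟨fun s => Φ c.1 (x, s), hz, fun s hs => ?_, _, hcv, rfl⟩
        obtain ⟨_, _, _, hd, _, hA, _⟩ := h2 c.1 x hx2 s (ball_subset_ball hδρ hs)
        exact ⟨hA hxA, hd⟩
      have := h1 V l (by simpa using hl) (fun c' hc' => hn c' (by simp [hc'])) δ
        (hδ.trans (min_le_left _ _)) _ hm (hA hxA) v hv (k + 1) ⟨x, hk, c.1, hstep⟩
      rw [List.length_cons, flowFamily_cons]
      convert this using 3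
      ring

/-- The affine times `T v + w` cover both halves of a return family: `T = id`, `w = 0` on the way
out, and `T = 0` with `w` frozen on the way back. -/
theorem exists_chainMap [Finite ι] (h : IsFlowSystem 𝕂 X Φ A p) {U : Set (E × 𝕂)}
    (hU : U ∈ 𝓝 (p, (0 : 𝕂))) (N : ℕ) :
    ∃ ε > 0, ∀ (V : Type) [NormedAddCommGroup V] [NormedSpace 𝕂 V]
      (l : List (ι × (V →L[𝕂] 𝕂))), l.length ≤ N → (∀ c ∈ l, ‖c.2‖ ≤ 1) →
      ∀ (v₀ : V) (σ : V → E) (T : V →L[𝕂] V) (w : V), IsChainMap Φ U p v₀ σ →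
        σ v₀ ∈ ball p ε → T v₀ + w ∈ ball (0 : V) ε →
        IsChainMap Φ U p v₀ (fun v => flowFamily Φ l (σ v) (T v + w)) := by
  induction N with
  | zero =>
    refine ⟨1, one_pos, fun V _ _ l hl _ v₀ σ T w hσ _ _ => ?_⟩
    obtain rfl : l = [] := List.length_eq_zero_iff.1 (Nat.le_zero.1 hl)
    exact hσ
  | succ N ih =>
    obtain ⟨ε₁, hε₁, h1⟩ := ih
    obtain ⟨ρ, hρ, h2⟩ := h.exists_ball (ball_mem_nhds p hε₁)
    obtain ⟨η, hη, hηU⟩ := Metric.mem_nhds_iff.1 hU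
    rw [← ball_prod_same] at hηU
    refine ⟨min (min ε₁ ρ) η, lt_min (lt_min hε₁ hρ) hη,
      fun V _ _ l hl hn v₀ σ T w hσ hx hv => ?_⟩
    have hle1 : min (min ε₁ ρ) η ≤ ε₁ := (min_le_left _ _).trans (min_le_left _ _)
    have hle2 : min (min ε₁ ρ) η ≤ ρ := (min_le_left _ _).trans (min_le_right _ _)
    have hle3 : min (min ε₁ ρ) η ≤ η := min_le_right _ _
    rcases l with _ | ⟨c, l⟩
    · exact hσ
    · have hcv : c.2 (T v₀ + w) ∈ ball (0 : 𝕂) (min (min ε₁ ρ) η) := by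
        rw [mem_ball_zero_iff] at hv ⊢
        calc ‖c.2 (T v₀ + w)‖ ≤ 1 * ‖T v₀ + w‖ := c.2.le_of_opNorm_le (hn c (by simp)) _
          _ < _ := by rwa [one_mul]
      have hstep := IsChainMap.step σ c.1 (c.2.comp T) (c.2 w) hσ
        (hηU ⟨ball_subset_ball hle3 hx, by
          simpa using ball_subset_ball hle3 hcv⟩)
      have hm := (h2 c.1 _ (ball_subset_ball hle2 hx) _ (ball_subset_ball hle2 hcv)).1
      have := h1 V l (by simpa using hl) (fun c' hc' => hn c' (by simp [hc'])) v₀ _ T w hstep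
        (by simpa using hm) (ball_subset_ball hle1 hv)
      simpa using this

end IsFlowSystem

end FlowSystem

/-! ### Immersed concatenations of maximal dimension -/

section RankBound

variable {𝕂 : Type} [RCLike 𝕂] {E : Type} [NormedAddCommGroup E] [NormedSpace 𝕂 E] {ι : Type}

/-- There are immersed concatenations of `e` flows with arbitrarily small times. -/
def HasImmersion (𝕂 : Type) [RCLike 𝕂] {E : Type} [NormedAddCommGroup E] [NormedSpace 𝕂 E]
    {ι : Type} (Φ : ι → E × 𝕂 → E) (p : E) (e : ℕ) : Prop :=
  ∀ ε > 0, ∃ (V : Type) (_ : NormedAddCommGroup V) (_ : NormedSpace 𝕂 V)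
    (_ : FiniteDimensional 𝕂 V) (l : List (ι × (V →L[𝕂] 𝕂))) (v : V),
    Module.finrank 𝕂 V = e ∧ l.length = e ∧ (∀ c ∈ l, ‖c.2‖ ≤ 1) ∧ ‖v‖ < ε ∧
    Function.Injective (fderiv 𝕂 (flowFamily Φ l p) v)

theorem hasImmersion_zero (Φ : ι → E × 𝕂 → E) (p : E) : HasImmersion 𝕂 Φ p 0 := by
  intro ε hε
  refine ⟨Fin 0 → 𝕂, inferInstance, inferInstance, inferInstance, [], 0, by simp, rfl, by simp,
    by rwa [norm_zero], ?_⟩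
  exact Function.injective_of_subsingleton _

theorem HasImmersion.le_finrank [FiniteDimensional 𝕂 E] {Φ : ι → E × 𝕂 → E} {p : E} {e : ℕ}
    (h : HasImmersion 𝕂 Φ p e) : e ≤ Module.finrank 𝕂 E := by
  obtain ⟨V, _, _, _, l, v, h1, _, _, _, hinj⟩ := h 1 one_pos
  rw [← h1]
  exact LinearMap.finrank_le_finrank_of_injective (f := (fderiv 𝕂 (flowFamily Φ l p) v : V →ₗ[𝕂] E)) hinj

theorem exists_maximal_immersion [FiniteDimensional 𝕂 E] (Φ : ι → E × 𝕂 → E) (p : E) :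
    ∃ e, HasImmersion 𝕂 Φ p e ∧ ¬ HasImmersion 𝕂 Φ p (e + 1) := by
  by_contra! h
  have : ∀ e, HasImmersion 𝕂 Φ p e := by
    intro e
    induction e with
    | zero => exact hasImmersion_zero Φ p
    | succ e ih => exact h e ih
  have := (this (Module.finrank 𝕂 E + 1)).le_finrank
  omega

/-- A field with values in the tangent space of the image of an immersion is tangent to it. -/
theorem isTangentTo_of_immersion {V : Type} [NormedAddCommGroup V] [NormedSpace 𝕂 V]
    {σ : V → E} {v₀ : V} {π : E →L[𝕂] V} {H : V → V} (hσ : AnalyticAt 𝕂 σ v₀)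
    [CompleteSpace E]
    (hH : AnalyticAt 𝕂 H (π (σ v₀))) (hH0 : H (π (σ v₀)) = v₀)
    (hR : AnalyticAt 𝕂 (fun x => σ (H (π x))) (σ v₀))
    (hl : ∀ᶠ v in 𝓝 v₀, H (π (σ v)) = v) {X : E → E}
    (hX : ∀ᶠ v in 𝓝 v₀, X (σ v) ∈ (fderiv 𝕂 σ v).range) :
    IsTangentTo 𝕂 X (fun x => σ (H (π x))) (σ v₀) := by
  have ht : Tendsto (fun x => H (π x)) (𝓝 (σ v₀)) (𝓝 v₀) := by
    have h1 : ContinuousAt (fun x => H (π x)) (σ v₀) :=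
      ContinuousAt.comp (g := H) hH.continuousAt π.continuous.continuousAt
    have := h1.tendsto
    rwa [hH0] at this
  have h1 : ∀ᶠ v in 𝓝 v₀, fderiv 𝕂 (fun x => σ (H (π x))) (σ v) (X (σ v)) = X (σ v) := by
    filter_upwards [hX, hl.eventually_nhds, hσ.eventually_analyticAt,
      hσ.continuousAt.eventually hR.eventually_analyticAt] with v hv hl hσv hRv
    obtain ⟨w, hw⟩ := hv
    have h2 : HasFDerivAt (fun v => σ (H (π (σ v))))
        ((fderiv 𝕂 (fun x => σ (H (π x))) (σ v)).comp (fderiv 𝕂 σ v)) v :=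
      HasFDerivAt.comp (g := fun x => σ (H (π x))) (f := σ) _
        hRv.differentiableAt.hasFDerivAt hσv.differentiableAt.hasFDerivAt
    have h3 := (h2.congr_of_eventuallyEq (hl.mono fun v hv => (by simp only [hv]))).unique
      hσv.differentiableAt.hasFDerivAt
    rw [← hw]
    exact congrArg (fun A => A w) h3
  filter_upwards [ht.eventually h1] with x hx hfix
  simp only [hfix] at hx
  exact hx

/-- The differential at time zero of the extension of a family by one more flow. -/
theorem hasFDerivAt_extend {Φ : E × 𝕂 → E} {X : E → E} {V : Type} [NormedAddCommGroup V]
    [NormedSpace 𝕂 V] {σ : V → E} {v : V} (hσ : DifferentiableAt 𝕂 σ v)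
    (hΦ : DifferentiableAt 𝕂 Φ (σ v, 0)) (hz : ∀ᶠ x in 𝓝 (σ v), Φ (x, 0) = x)
    (hd : HasDerivAt (fun s => Φ (σ v, s)) (X (Φ (σ v, 0))) 0) :
    HasFDerivAt (fun z : V × 𝕂 => Φ (σ z.1, z.2))
      ((fderiv 𝕂 σ v).coprod (ContinuousLinearMap.toSpanSingleton 𝕂 (X (σ v)))) (v, 0) := by
  have h1 : HasFDerivAt (fun z : V × 𝕂 => (σ z.1, z.2))
      (((fderiv 𝕂 σ v).comp (ContinuousLinearMap.fst 𝕂 V 𝕂)).prod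
        (ContinuousLinearMap.snd 𝕂 V 𝕂)) (v, 0) := by
    refine HasFDerivAt.prodMk ?_ hasFDerivAt_snd
    exact HasFDerivAt.comp (g := σ) (f := Prod.fst) _ hσ.hasFDerivAt hasFDerivAt_fst
  have h2 := HasFDerivAt.comp (g := Φ) (f := fun z : V × 𝕂 => (σ z.1, z.2)) (v, (0 : 𝕂))
    hΦ.hasFDerivAt h1
  have h0 : Φ (σ v, 0) = σ v := hz.self_of_nhds
  have ha : ∀ w, fderiv 𝕂 Φ (σ v, 0) (w, 0) = w := by
    have h3 : HasFDerivAt (fun x => Φ (x, 0))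
        ((fderiv 𝕂 Φ (σ v, 0)).comp ((ContinuousLinearMap.id 𝕂 E).prod 0)) (σ v) :=
      HasFDerivAt.comp (g := Φ) (f := fun x : E => (x, (0 : 𝕂))) _ hΦ.hasFDerivAt
        ((hasFDerivAt_id _).prodMk (hasFDerivAt_const _ _))
    have h4 := (h3.congr_of_eventuallyEq (hz.mono fun x hx => hx.symm)).unique (hasFDerivAt_id _)
    intro w
    exact congrArg (fun A => A w) h4
  have hb : fderiv 𝕂 Φ (σ v, 0) (0, 1) = X (σ v) := by
    have h3 : HasDerivAt (fun s : 𝕂 => Φ (σ v, s)) (fderiv 𝕂 Φ (σ v, 0) (0, 1)) 0 :=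
      HasFDerivAt.comp_hasDerivAt (l := Φ) (f := fun s : 𝕂 => (σ v, s)) _ hΦ.hasFDerivAt
        ((hasDerivAt_const _ _).prodMk (hasDerivAt_id _))
    rw [h3.unique hd, h0]
  refine h2.congr_fderiv ?_
  ext w
  · simp [ha]
  · simp [hb]

/-- If a matrix family factors analytically through a space of smaller dimension, it is singular. -/
theorem det_eq_zero_of_finrank_range_le {n : ℕ} (Q : (Fin n → 𝕂) →ₗ[𝕂] E)
    (B : E →ₗ[𝕂] (Fin n → 𝕂)) {S : Submodule 𝕂 E} [FiniteDimensional 𝕂 S]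
    (hQ : ∀ w, Q w ∈ S) (hS : Module.finrank 𝕂 S < n) :
    (Matrix.of fun i j => B (Q (Pi.single j 1)) i).det = 0 := by
  have h1 : ¬ Function.Injective (Q.codRestrict S hQ) := by
    intro hinj
    have := LinearMap.finrank_le_finrank_of_injective hinj
    simp at this
    omega
  rw [injective_iff_map_eq_zero] at h1
  push Not at h1
  obtain ⟨w, hw, hw0⟩ := h1
  have hw' : Q w = 0 := congrArg Subtype.val hw
  refine Matrix.exists_mulVec_eq_zero_iff.1 ⟨w, hw0, ?_⟩
  have h2 : (Matrix.of fun i j => B (Q (Pi.single j 1)) i) = LinearMap.toMatrix' (B ∘ₗ Q) := by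
    ext i j
    simp [LinearMap.toMatrix'_apply]
  rw [h2, LinearMap.toMatrix'_mulVec]
  simp [hw']

/-- Selects an `n × n` minor of `D` that equals one; this is the minor to which analytic
continuation is applied. -/
theorem exists_left_inverse_of_lt_finrank_range {V : Type} [AddCommGroup V] [Module 𝕂 V]
    [FiniteDimensional 𝕂 E] (D : V →ₗ[𝕂] E) {n : ℕ} (h : n ≤ Module.finrank 𝕂 D.range) :
    ∃ (A : (Fin n → 𝕂) →ₗ[𝕂] V) (B : E →ₗ[𝕂] (Fin n → 𝕂)), ∀ w, B (D (A w)) = w := by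
  let b := Module.finBasis 𝕂 D.range
  choose g hg using fun i => (b i).2
  let A : (Fin n → 𝕂) →ₗ[𝕂] V := Fintype.linearCombination 𝕂 (fun i => g (Fin.castLE h i))
  have hA : ∀ w, D (A w) = ∑ i, w i • (b (Fin.castLE h i) : E) := by
    intro w
    simp [A, Fintype.linearCombination_apply, map_sum, hg]
  have hinj : Function.Injective (D ∘ₗ A) := by
    have hli : LinearIndependent 𝕂 (fun i : Fin n => (b (Fin.castLE h i) : E)) := by
      have h1 := b.linearIndependent.map' D.range.subtype (Submodule.ker_subtype _)
      exact h1.comp _ (Fin.castLE_injective h)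
    rw [injective_iff_map_eq_zero]
    intro w hw
    rw [LinearMap.comp_apply, hA] at hw
    exact funext (Fintype.linearIndependent_iff.1 hli w hw)
  obtain ⟨B, hB⟩ := LinearMap.exists_leftInverse_of_injective _ (LinearMap.ker_eq_bot.2 hinj)
  exact ⟨A, B, fun w => congrArg (fun T => T w) hB⟩

namespace IsFlowSystem

variable {X : ι → E → E} {Φ : ι → E × 𝕂 → E} {A : Set E} {p : E} [FiniteDimensional 𝕂 E]

/-- At a small immersed family of maximal dimension, all the fields are tangent to the image. -/
theorem tangent_of_maximal [Finite ι] (h : IsFlowSystem 𝕂 X Φ A p) {e : ℕ} :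
    ∃ ε₀ > 0, ∀ ε ≤ ε₀,
      (¬ ∃ (V : Type) (_ : NormedAddCommGroup V) (_ : NormedSpace 𝕂 V)
        (_ : FiniteDimensional 𝕂 V) (l : List (ι × (V →L[𝕂] 𝕂))) (v : V),
        Module.finrank 𝕂 V = e + 1 ∧ l.length = e + 1 ∧ (∀ c ∈ l, ‖c.2‖ ≤ 1) ∧ ‖v‖ < ε ∧
        Function.Injective (fderiv 𝕂 (flowFamily Φ l p) v)) →
      ∀ (V : Type) [NormedAddCommGroup V] [NormedSpace 𝕂 V]
        [FiniteDimensional 𝕂 V] (l : List (ι × (V →L[𝕂] 𝕂))) (v : V),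
        Module.finrank 𝕂 V = e → l.length = e → (∀ c ∈ l, ‖c.2‖ ≤ 1) → ‖v‖ < ε →
        Function.Injective (fderiv 𝕂 (flowFamily Φ l p) v) →
        ∀ a, X a (flowFamily Φ l p v) ∈ (fderiv 𝕂 (flowFamily Φ l p) v).range := by
  have := FiniteDimensional.complete 𝕂 E
  obtain ⟨ρ, hρ, hb⟩ := h.exists_ball univ_mem
  obtain ⟨ε₀, hε₀, hf⟩ := h.exists_analytic_family e _ (ball_mem_nhds p hρ)
  refine ⟨ε₀, hε₀, fun ε hε hno V _ _ _ l v hV hl hn hv hinj a => ?_⟩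
  by_contra hnot
  apply hno
  obtain ⟨hm, han, _⟩ := hf V l hl.le hn p (mem_ball_self hε₀) v
    (mem_ball_zero_iff.2 (hv.trans_le hε))
  have hσ : AnalyticAt 𝕂 (flowFamily Φ l p) v :=
    AnalyticAt.comp (g := fun z : E × V => flowFamily Φ l z.1 z.2) (f := fun v => (p, v)) han
      (analyticAt_const.prod analyticAt_id)
  obtain ⟨_, hΦ, _, hd, _⟩ := hb a _ hm 0 (mem_ball_self hρ)
  have hz : ∀ᶠ x in 𝓝 (flowFamily Φ l p v), Φ a (x, 0) = x := by
    filter_upwards [isOpen_ball.mem_nhds hm] with x hx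
    exact (hb a x hx 0 (mem_ball_self hρ)).2.2.1
  have hder := hasFDerivAt_extend hσ.differentiableAt hΦ.differentiableAt hz hd
  -- If `X a` were transverse to the image, appending its flow, at time zero, would produce an
  -- immersion of dimension `e + 1` with parameter no larger than `v`.
  set l' : List (ι × ((V × 𝕂) →L[𝕂] 𝕂)) :=
    pullTimes (ContinuousLinearMap.fst 𝕂 V 𝕂) l ++ [(a, ContinuousLinearMap.snd 𝕂 V 𝕂)] with hl'
  have hn' : ∀ c ∈ l', ‖c.2‖ ≤ 1 := by
    intro c hc
    rw [hl', List.mem_append, List.mem_singleton] at hc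
    rcases hc with hc | rfl
    · exact norm_pullTimes (ContinuousLinearMap.norm_fst_le 𝕂 V 𝕂) hn c hc
    · exact ContinuousLinearMap.norm_snd_le 𝕂 V 𝕂
  have hv' : ‖(v, (0 : 𝕂))‖ < ε := by
    rw [Prod.norm_def, norm_zero]
    exact max_lt hv ((norm_nonneg v).trans_lt hv)
  have heq : flowFamily Φ l' p = fun z : V × 𝕂 => Φ a (flowFamily Φ l p z.1, z.2) := by
    ext z
    simp [hl', flowFamily_append, flowFamily_pullTimes]
  have hinj' : Function.Injective (fderiv 𝕂 (flowFamily Φ l' p) (v, 0)) := by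
    rw [heq, hder.fderiv, injective_iff_map_eq_zero]
    rintro ⟨w, s⟩ hws
    have hws' : fderiv 𝕂 (flowFamily Φ l p) v w + s • X a (flowFamily Φ l p v) = 0 := by
      simpa using hws
    have hs : s = 0 := by
      by_contra hs
      apply hnot
      refine ⟨-(s⁻¹ • w), ?_⟩
      have h1 : fderiv 𝕂 (flowFamily Φ l p) v w = -(s • X a (flowFamily Φ l p v)) :=
        eq_neg_of_add_eq_zero_left hws'
      show fderiv 𝕂 (flowFamily Φ l p) v (-(s⁻¹ • w)) = _
      rw [map_neg, map_smul, h1, smul_neg, neg_neg, smul_smul, inv_mul_cancel₀ hs, one_smul]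
    subst hs
    have hw : w = 0 := hinj (by simpa using hws')
    rw [hw]
    rfl
  exact ⟨V × 𝕂, inferInstance, inferInstance, inferInstance, l', (v, 0),
    by simp [hV], by simp [hl', hl], hn', hv', hinj'⟩

end IsFlowSystem

section Invariance

variable [NormedSpace ℝ E] [IsScalarTower ℝ 𝕂 E] {X : ι → E → E} {Φ : ι → E × 𝕂 → E}

/-- Concatenations of flows of fields tangent to the fixed point set of a retraction leave this
set invariant. -/
theorem IsLocalRetraction.flowFamily_invariant [CompleteSpace E] {R : E → E} {q : E}
    (hR : IsLocalRetraction 𝕂 R q)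
    (hX : ∀ a, AnalyticAt 𝕂 (X a) q) (hXR : ∀ a, IsTangentTo 𝕂 (X a) R q)
    (hΦ : ∀ a, AnalyticAt 𝕂 (Φ a) (q, 0)) (hz : ∀ a, ∀ᶠ x in 𝓝 q, Φ a (x, 0) = x)
    (hd : ∀ a, ∀ᶠ z in 𝓝 (q, (0 : 𝕂)), HasDerivAt (fun s => Φ a (z.1, s)) (X a (Φ a z)) z.2)
    {V : Type} [NormedAddCommGroup V] [NormedSpace 𝕂 V] (l : List (ι × (V →L[𝕂] 𝕂))) :
    ∀ᶠ z in 𝓝 (q, (0 : V)), R z.1 = z.1 → R (flowFamily Φ l z.1 z.2) = flowFamily Φ l z.1 z.2 := by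
  have hΦ0 : ∀ a, Tendsto (Φ a) (𝓝 (q, 0)) (𝓝 q) := fun a => by
    have := (hΦ a).continuousAt.tendsto
    rwa [(hz a).self_of_nhds] at this
  have key : ∀ a, ∀ᶠ z in 𝓝 (q, (0 : 𝕂)), R z.1 = z.1 → R (Φ a z) = Φ a z := by
    intro a
    obtain ⟨W, hW, hinv⟩ := hR.invariant (hX a) (hXR a)
    have h1 : ∀ᶠ z in 𝓝 (q, (0 : 𝕂)), Φ a z ∈ W ∧ Φ a (z.1, 0) = z.1 ∧
        HasDerivAt (fun s => Φ a (z.1, s)) (X a (Φ a z)) z.2 := by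
      filter_upwards [hΦ0 a hW, (continuous_fst.tendsto (q, (0 : 𝕂))).eventually (hz a), hd a]
        with z h1 h2 h3 using ⟨h1, h2, h3⟩
    obtain ⟨η, hη, hb⟩ := Metric.eventually_nhds_iff_ball.1 h1
    refine Metric.eventually_nhds_iff_ball.2 ⟨η, hη, ?_⟩
    rintro ⟨x, s⟩ hxs hfix
    rw [← ball_prod_same] at hxs hb
    have hs : ∀ r ∈ Set.Icc (0 : ℝ) 1, r • s ∈ ball (0 : 𝕂) η := by
      intro r hr
      have := hxs.2
      rw [mem_ball_zero_iff] at this ⊢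
      rw [norm_smul, Real.norm_of_nonneg hr.1]
      calc r * ‖s‖ ≤ 1 * ‖s‖ := by gcongr; exact hr.2
        _ < η := by rwa [one_mul]
    have h3 := hinv (fun r => Φ a (x, r • s)) s (fun r hr => ?_) ?_ 1 (by simp)
    · simpa using h3
    · obtain ⟨g1, _, g3⟩ := hb (x, r • s) ⟨hxs.1, hs r hr⟩
      exact ⟨g1, hasDerivAt_ray (γ := fun s => Φ a (x, s)) g3⟩
    · obtain ⟨_, g2, _⟩ := hb (x, s) hxs
      simpa [g2] using hfix
  induction l with
  | nil => exact Eventually.of_forall fun z hz => hz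
  | cons c l ih =>
    have ht : Tendsto (fun z : E × V => (z.1, c.2 z.2)) (𝓝 (q, 0)) (𝓝 (q, 0)) := by
      have : Continuous (fun z : E × V => (z.1, c.2 z.2)) := by fun_prop
      simpa using this.tendsto (q, 0)
    have ht2 : Tendsto (fun z : E × V => (Φ c.1 (z.1, c.2 z.2), z.2)) (𝓝 (q, 0)) (𝓝 (q, 0)) :=
      ((hΦ0 c.1).comp ht).prodMk_nhds (continuous_snd.tendsto _)
    filter_upwards [ht2.eventually ih, ht.eventually (key c.1)] with z h1 h2 h3
    exact h1 (h2 h3)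

end Invariance

end RankBound

/-! ### The rank bound by analytic continuation -/

section Orbit

variable {𝕂 : Type} [RCLike 𝕂] {E : Type} [NormedAddCommGroup E] [NormedSpace 𝕂 E] {ι : Type}

theorem analyticAt_det {n : ℕ} {M : E → Matrix (Fin n) (Fin n) 𝕂} {x : E}
    (h : ∀ i j, AnalyticAt 𝕂 (fun y => M y i j) x) : AnalyticAt 𝕂 (fun y => (M y).det) x := by
  simp only [Matrix.det_apply']
  refine Finset.analyticAt_fun_sum _ fun s _ => ?_
  exact analyticAt_const.mul (Finset.analyticAt_fun_prod _ fun i _ => h _ _)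

theorem injective_fderiv_of_left_inverse {V : Type} [NormedAddCommGroup V] [NormedSpace 𝕂 V]
    {σ : V → E} {g : E → V} {v₀ : V} (hσ : DifferentiableAt 𝕂 σ v₀)
    (hg : DifferentiableAt 𝕂 g (σ v₀)) (h : ∀ᶠ v in 𝓝 v₀, g (σ v) = v) :
    Function.Injective (fderiv 𝕂 σ v₀) := by
  have h1 := hg.hasFDerivAt.comp v₀ hσ.hasFDerivAt
  have h1' : HasFDerivAt id _ v₀ := h1.congr_of_eventuallyEq (h.mono fun v hv => hv.symm)
  have h2 := h1'.unique (hasFDerivAt_id v₀)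
  intro a b hab
  have h3 : ∀ w, fderiv 𝕂 g (σ v₀) (fderiv 𝕂 σ v₀ w) = w := fun w => congrArg (fun A => A w) h2
  rw [← h3 a, ← h3 b, hab]

theorem finrank_range_comp_le {V : Type} [NormedAddCommGroup V] [NormedSpace 𝕂 V]
    [FiniteDimensional 𝕂 V] (S : V →L[𝕂] E) (T : E →L[𝕂] V) :
    Module.finrank 𝕂 (S.comp T).range ≤ Module.finrank 𝕂 V := by
  have h1 : (S.comp T).range ≤ (S : V →ₗ[𝕂] E).range := by
    rintro _ ⟨v, rfl⟩
    exact ⟨T v, rfl⟩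
  exact (Submodule.finrank_mono h1).trans (LinearMap.finrank_range_le _)

theorem isPreconnected_ball_prod {V V' : Type} [NormedAddCommGroup V] [NormedSpace 𝕂 V]
    [NormedAddCommGroup V'] [NormedSpace 𝕂 V'] (r r' : ℝ) :
    IsPreconnected (ball (0 : V) r ×ˢ ball (0 : V') r') := by
  let _ : NormedSpace ℝ V := NormedSpace.restrictScalars ℝ 𝕂 V
  let _ : NormedSpace ℝ V' := NormedSpace.restrictScalars ℝ 𝕂 V'
  exact (convex_ball _ _).isPreconnected.prod (convex_ball _ _).isPreconnected

namespace IsFlowSystem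

variable [NormedSpace ℝ E] [IsScalarTower ℝ 𝕂 E]
  {X : ι → E → E} {Φ : ι → E × 𝕂 → E} {A : Set E} {p : E} [FiniteDimensional 𝕂 E] [Finite ι]

/-- The rank of a concatenation of flows with small times does not exceed the maximal dimension of
the immersed families. -/
theorem finrank_range_fderiv_le (h : IsFlowSystem 𝕂 X Φ A p) {e : ℕ} (he : HasImmersion 𝕂 Φ p e)
    (hmax : ¬ HasImmersion 𝕂 Φ p (e + 1)) (N : ℕ) :
    ∃ ε > 0, ∀ (V : Type) [NormedAddCommGroup V] [NormedSpace 𝕂 V] (l : List (ι × (V →L[𝕂] 𝕂))),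
      l.length ≤ N → (∀ c ∈ l, ‖c.2‖ ≤ 1) → ∀ v ∈ ball (0 : V) ε,
      Module.finrank 𝕂 (fderiv 𝕂 (flowFamily Φ l p) v).range ≤ e := by
  have := FiniteDimensional.complete 𝕂 E
  simp only [HasImmersion, not_forall, exists_prop] at hmax
  obtain ⟨ε₁, hε₁, hno⟩ := hmax
  obtain ⟨ρ, hρ, hb⟩ := h.exists_ball univ_mem
  obtain ⟨ε₃, hε₃, hf₃⟩ := h.exists_analytic_family N _ univ_mem
  obtain ⟨ε₂, hε₂, hf₂⟩ := h.exists_analytic_family e _ (ball_mem_nhds p (lt_min hε₃ hρ))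
  obtain ⟨ε₀, hε₀, htan⟩ := h.tangent_of_maximal (e := e)
  refine ⟨ε₃, hε₃, fun V _ _ b hb_len hb_norm vb hvb => ?_⟩
  by_contra! hgt
  set ε := min (min ε₁ ε₂) ε₀ with hε_def
  have hε : 0 < ε := lt_min (lt_min hε₁ hε₂) hε₀
  have hεε₁ : ε ≤ ε₁ := (min_le_left _ _).trans (min_le_left _ _)
  have hεε₂ : ε ≤ ε₂ := (min_le_left _ _).trans (min_le_right _ _)
  have hεε₀ : ε ≤ ε₀ := min_le_right _ _
  -- The threshold excluding dimension `e + 1` still applies after `ε` is decreased to fit the other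
  -- constraints.
  have hno' : ¬ ∃ (V : Type) (_ : NormedAddCommGroup V) (_ : NormedSpace 𝕂 V)
        (_ : FiniteDimensional 𝕂 V) (l : List (ι × (V →L[𝕂] 𝕂))) (v : V),
        Module.finrank 𝕂 V = e + 1 ∧ l.length = e + 1 ∧ (∀ c ∈ l, ‖c.2‖ ≤ 1) ∧ ‖v‖ < ε ∧
        Function.Injective (fderiv 𝕂 (flowFamily Φ l p) v) := by
    rintro ⟨V, i1, i2, i3, l, v, g1, g2, g3, g4, g5⟩
    exact hno ⟨V, i1, i2, i3, l, v, g1, g2, g3, g4.trans_le hεε₁, g5⟩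
  obtain ⟨Va, _, _, _, a, va, ha_dim, ha_len, ha_norm, hva, ha_inj⟩ := he ε hε
  have := FiniteDimensional.complete 𝕂 Va
  set σ := flowFamily Φ a p with hσ_def
  have hσ_mem : ∀ u ∈ ball (0 : Va) ε₂, σ u ∈ ball p (min ε₃ ρ) := fun u hu =>
    (hf₂ Va a ha_len.le ha_norm p (mem_ball_self hε₂) u hu).1
  have hσ_an : ∀ u ∈ ball (0 : Va) ε₂, AnalyticAt 𝕂 σ u := fun u hu =>
    AnalyticAt.comp (g := fun z : E × Va => flowFamily Φ a z.1 z.2) (f := fun v => (p, v))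
      (hf₂ Va a ha_len.le ha_norm p (mem_ball_self hε₂) u hu).2.1
      (analyticAt_const.prod analyticAt_id)
  have hva₂ : va ∈ ball (0 : Va) ε₂ := mem_ball_zero_iff.2 (hva.trans_le hεε₂)
  obtain ⟨π, H, hH, hH0, hr, hR, hl, hrange⟩ :=
    exists_retraction_of_immersion (hσ_an va hva₂) ha_inj
  set q := σ va with hq
  have hq_mem := hσ_mem va hva₂
  have hqρ : q ∈ ball p ρ := ball_subset_ball (min_le_right _ _) hq_mem
  have hg : ∀ᶠ u in 𝓝 va, AnalyticAt 𝕂 (fun x => H (π x)) (σ u) := by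
    have h1 : AnalyticAt 𝕂 (fun x => H (π x)) q :=
      AnalyticAt.comp (g := H) (f := fun x => π x) hH (π.analyticAt _)
    exact (hσ_an va hva₂).continuousAt.eventually h1.eventually_analyticAt
  have hXσ : ∀ c, ∀ᶠ u in 𝓝 va, X c (σ u) ∈ (fderiv 𝕂 σ u).range := by
    intro c
    have hball : ∀ᶠ u in 𝓝 va, u ∈ ball (0 : Va) ε :=
      isOpen_ball.mem_nhds (mem_ball_zero_iff.2 hva)
    filter_upwards [hball, hl.eventually_nhds, hg] with u hu hlu hgu
    refine htan ε hεε₀ hno' Va a u ha_dim ha_len ha_norm (mem_ball_zero_iff.1 hu) ?_ c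
    exact injective_fderiv_of_left_inverse (g := fun x => H (π x))
      (hσ_an u (ball_subset_ball hεε₂ hu)).differentiableAt hgu.differentiableAt hlu
  set R : E → E := fun x => σ (H (π x)) with hR_def
  have hXR : ∀ c, IsTangentTo 𝕂 (X c) R q := fun c =>
    isTangentTo_of_immersion (hσ_an va hva₂) hH hH0 hR.analytic hl (hXσ c)
  have hΦz : ∀ c, ∀ᶠ x in 𝓝 q, Φ c (x, 0) = x := fun c => by
    filter_upwards [isOpen_ball.mem_nhds hqρ] with x hx
    exact (hb c x hx 0 (mem_ball_self hρ)).2.2.1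
  have hinv := hR.flowFamily_invariant (X := X) (Φ := Φ)
    (fun c => (hb c q hqρ 0 (mem_ball_self hρ)).2.2.2.2.2.2) hXR
    (fun c => (hb c q hqρ 0 (mem_ball_self hρ)).2.1) hΦz
    (fun c => by
      have : ball p ρ ×ˢ ball (0 : 𝕂) ρ ∈ 𝓝 (q, (0 : 𝕂)) :=
        prod_mem_nhds (isOpen_ball.mem_nhds hqρ) (ball_mem_nhds _ hρ)
      filter_upwards [this] with z hz
      exact (hb c z.1 hz.1 z.2 hz.2).2.2.2.1) b
  -- Analytic on a connected product containing both `(va, 0)`, near which the values lie in the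
  -- image of `σ`, and `(0, vb)`, where `F (0, ·)` is the given family starting at `p`.
  let F : Va × V → E := fun z => flowFamily Φ b (σ z.1) z.2
  have hF_an : ∀ z ∈ ball (0 : Va) ε₂ ×ˢ ball (0 : V) ε₃, AnalyticAt 𝕂 F z := by
    rintro ⟨u, v⟩ ⟨hu, hv⟩
    refine AnalyticAt.comp (g := fun z : E × V => flowFamily Φ b z.1 z.2)
      (f := fun z : Va × V => (σ z.1, z.2))
      (hf₃ V b hb_len hb_norm _ (ball_subset_ball (min_le_left _ _) (hσ_mem u hu)) v hv).2.1 ?_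
    exact (AnalyticAt.comp (g := σ) (f := Prod.fst) (hσ_an u hu) analyticAt_fst).prod analyticAt_snd
  have hFq : F (va, 0) = q := flowFamily_zero b fun c => (hΦz c).self_of_nhds
  have hva0 : (va, (0 : V)) ∈ ball (0 : Va) ε₂ ×ˢ ball (0 : V) ε₃ := ⟨hva₂, mem_ball_self hε₃⟩
  have hFR : ∀ᶠ z in 𝓝 (va, (0 : V)), R (F z) = F z := by
    have ht : Tendsto (fun z : Va × V => (σ z.1, z.2)) (𝓝 (va, 0)) (𝓝 (q, 0)) :=
      ((hσ_an va hva₂).continuousAt.tendsto.comp (continuous_fst.tendsto _)).prodMk_nhds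
        (continuous_snd.tendsto _)
    filter_upwards [ht.eventually hinv, (continuous_fst.tendsto (va, (0 : V))).eventually hl]
      with z h1 h2
    refine h1 ?_
    show σ (H (π (σ z.1))) = σ z.1
    rw [h2]
  have hrank : ∀ᶠ x in 𝓝 q, DifferentiableAt 𝕂 R x ∧
      Module.finrank 𝕂 (fderiv 𝕂 R x).range ≤ e := by
    have h1 : AnalyticAt 𝕂 (fun x => H (π x)) q :=
      AnalyticAt.comp (g := H) (f := fun x => π x) hH (π.analyticAt _)
    have ht : Tendsto (fun x => H (π x)) (𝓝 q) (𝓝 va) := by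
      have := h1.continuousAt.tendsto
      rwa [hH0] at this
    filter_upwards [h1.eventually_analyticAt, ht.eventually (hσ_an va hva₂).eventually_analyticAt]
      with x hx1 hx2
    have h3 : HasFDerivAt R ((fderiv 𝕂 σ (H (π x))).comp (fderiv 𝕂 (fun x => H (π x)) x)) x :=
      HasFDerivAt.comp (g := σ) (f := fun x => H (π x)) x hx2.differentiableAt.hasFDerivAt
        hx1.differentiableAt.hasFDerivAt
    refine ⟨h3.differentiableAt, ?_⟩
    rw [h3.fderiv, ← ha_dim]
    exact finrank_range_comp_le _ _
  -- Assuming rank greater than `e` at `vb`, the minor `G` is one at `(0, vb)`. Near `(va, 0)` it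
  -- vanishes, because `R ∘ F = F` forces the rank of `dF` to be at most `e`.
  obtain ⟨T, B, hTB⟩ := exists_left_inverse_of_lt_finrank_range
    (fderiv 𝕂 (flowFamily Φ b p) vb : V →ₗ[𝕂] E) (n := e + 1) hgt
  let Q : Va × V → (Fin (e + 1) → 𝕂) →ₗ[𝕂] E := fun z =>
    (fderiv 𝕂 F z : Va × V →ₗ[𝕂] E) ∘ₗ LinearMap.inr 𝕂 Va V ∘ₗ T
  let G : Va × V → 𝕂 := fun z => (Matrix.of fun i j => B (Q z (Pi.single j 1)) i).det
  have hG_an : AnalyticOnNhd 𝕂 G (ball (0 : Va) ε₂ ×ˢ ball (0 : V) ε₃) := by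
    intro z hz
    refine analyticAt_det fun i j => ?_
    let B' : E →L[𝕂] 𝕂 := LinearMap.toContinuousLinearMap (LinearMap.proj i ∘ₗ B)
    exact (B'.analyticAt _).comp ((hF_an z hz).fderiv.clm_apply' analyticAt_const)
  have hG0 : G =ᶠ[𝓝 (va, 0)] 0 := by
    have hFc : Tendsto F (𝓝 (va, 0)) (𝓝 q) := by
      have := (hF_an _ hva0).continuousAt.tendsto
      rwa [hFq] at this
    filter_upwards [hFR.eventually_nhds, hFc.eventually hrank,
      (hF_an _ hva0).eventually_analyticAt] with z h1 h2 h3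
    refine det_eq_zero_of_finrank_range_le (Q z) B (S := (fderiv 𝕂 R (F z)).range) (fun w => ?_)
      (Nat.lt_succ_of_le h2.2)
    have h4 := HasFDerivAt.comp (g := R) (f := F) z h2.1.hasFDerivAt h3.differentiableAt.hasFDerivAt
    have h5 := (h4.congr_of_eventuallyEq (h1.mono fun z hz => hz.symm)).unique
      h3.differentiableAt.hasFDerivAt
    exact ⟨_, congrArg (fun A => A (0, T w)) h5⟩
  have hG := hG_an.eqOn_zero_of_preconnected_of_eventuallyEq_zero
    (isPreconnected_ball_prod (𝕂 := 𝕂) ε₂ ε₃) hva0 hG0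
    (show ((0 : Va), vb) ∈ _ from ⟨mem_ball_self hε₂, hvb⟩)
  have hσ0 : σ 0 = p := flowFamily_zero a fun c => h.apply_base c
  have hQ0 : ∀ w, Q (0, vb) w = fderiv 𝕂 (flowFamily Φ b p) vb (T w) := by
    intro w
    have h1 : HasFDerivAt (fun v => F (0, v))
        ((fderiv 𝕂 F (0, vb)).comp (ContinuousLinearMap.inr 𝕂 Va V)) vb :=
      HasFDerivAt.comp (g := F) (f := fun v => ((0 : Va), v)) vb
        (hF_an _ ⟨mem_ball_self hε₂, hvb⟩).differentiableAt.hasFDerivAt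
        ((hasFDerivAt_const _ _).prodMk (hasFDerivAt_id _))
    have h2 : (fun v => F (0, v)) = flowFamily Φ b p := by
      ext v
      simp only [F, hσ0]
    rw [h2] at h1
    rw [h1.fderiv]
    rfl
  have hG1 : G (0, vb) = 1 := by
    have : (Matrix.of fun i j => B (Q (0, vb) (Pi.single j 1)) i) = (1 : Matrix (Fin (e + 1)) _ 𝕂) := by
      ext i j
      rw [Matrix.of_apply, hQ0]
      have := congrFun (hTB (Pi.single j 1)) i
      simp only [ContinuousLinearMap.coe_coe] at this
      rw [this, Matrix.one_apply, Pi.single_apply]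
    simp only [G, this, Matrix.det_one]
  rw [hG1] at hG
  exact one_ne_zero hG

end IsFlowSystem

end Orbit

/-! ### The local orbit theorem -/

section Orbit

variable {𝕂 : Type} [RCLike 𝕂] {E : Type} [NormedAddCommGroup E] [NormedSpace 𝕂 E] {ι : Type}

namespace IsFlowSystem

variable {X : ι → E → E} {Φ : ι → E × 𝕂 → E} {A : Set E} {p : E} [FiniteDimensional 𝕂 E]
  [Finite ι]

/-- Immersed families of concatenated flows passing through the base point: follow a family, and
return along the reversed flows with fixed times. -/
theorem exists_return_immersion (h : IsFlowSystem 𝕂 X Φ A p) {e : ℕ}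
    (he : HasImmersion 𝕂 Φ p e) {U : Set (E × 𝕂)} (hU : U ∈ 𝓝 (p, (0 : 𝕂))) {ε : ℝ} (hε : 0 < ε) :
    ∃ (V : Type) (_ : NormedAddCommGroup V) (_ : NormedSpace 𝕂 V)
      (_ : FiniteDimensional 𝕂 V) (l : List (ι × (V →L[𝕂] 𝕂))) (v : V),
      Module.finrank 𝕂 V = e ∧ l.length = e ∧ (∀ c ∈ l, ‖c.2‖ ≤ 1) ∧ ‖v‖ < ε ∧
      AnalyticAt 𝕂 (fun u => flowFamily Φ (reversal l) (flowFamily Φ l p u) v) v ∧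
      Function.Injective
        (fderiv 𝕂 (fun u => flowFamily Φ (reversal l) (flowFamily Φ l p u) v) v) ∧
      flowFamily Φ (reversal l) (flowFamily Φ l p v) v = p ∧
      IsChainMap Φ U p v (fun u => flowFamily Φ (reversal l) (flowFamily Φ l p u) v) := by
  have := FiniteDimensional.complete 𝕂 E
  obtain ⟨ε₁, hε₁, hf₁⟩ := h.exists_analytic_family e _ univ_mem
  obtain ⟨ε₂, hε₂, hch⟩ := h.exists_chainMap hU e
  obtain ⟨ε₃, hε₃, hf₃⟩ := h.exists_analytic_family e _ (ball_mem_nhds p (lt_min hε₁ hε₂))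
  obtain ⟨V, i1, i2, i3, l, v, hV, hl, hn, hv, hinj⟩ :=
    he (min ε (min ε₁ (min ε₂ ε₃))) (by positivity)
  have hvε : ‖v‖ < ε := hv.trans_le (min_le_left _ _)
  have hvε₁ : v ∈ ball (0 : V) ε₁ := mem_ball_zero_iff.2
    (hv.trans_le ((min_le_right _ _).trans (min_le_left _ _)))
  have hvε₂ : v ∈ ball (0 : V) ε₂ := mem_ball_zero_iff.2
    (hv.trans_le ((min_le_right _ _).trans ((min_le_right _ _).trans (min_le_left _ _))))
  have hvε₃ : v ∈ ball (0 : V) ε₃ := mem_ball_zero_iff.2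
    (hv.trans_le ((min_le_right _ _).trans ((min_le_right _ _).trans (min_le_right _ _))))
  obtain ⟨hm, han, hret⟩ := hf₃ V l hl.le hn p (mem_ball_self hε₃) v hvε₃
  have hm₁ := ball_subset_ball (min_le_left _ _) hm
  have hm₂ := ball_subset_ball (min_le_right _ _) hm
  have hσ : AnalyticAt 𝕂 (flowFamily Φ l p) v :=
    AnalyticAt.comp (g := fun z : E × V => flowFamily Φ l z.1 z.2) (f := fun v => (p, v)) han
      (analyticAt_const.prod analyticAt_id)
  have hψ : AnalyticAt 𝕂 (fun x => flowFamily Φ (reversal l) x v) (flowFamily Φ l p v) :=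
    AnalyticAt.comp (g := fun z : E × V => flowFamily Φ (reversal l) z.1 z.2)
      (f := fun x => (x, v))
      (hf₁ V (reversal l) (by simp [hl]) (norm_reversal hn) _ hm₁ v hvε₁).2.1
      (analyticAt_id.prod analyticAt_const)
  have hφ : AnalyticAt 𝕂 (fun x => flowFamily Φ l x v) p :=
    AnalyticAt.comp (g := fun z : E × V => flowFamily Φ l z.1 z.2) (f := fun x => (x, v))
      (hf₁ V l hl.le hn p (mem_ball_self hε₁) v hvε₁).2.1
      (analyticAt_id.prod analyticAt_const)
  have hψinj : Function.Injective (fderiv 𝕂 (fun x => flowFamily Φ (reversal l) x v)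
      (flowFamily Φ l p v)) := by
    -- The return map with frozen times is undone by following the original flows, so it preserves
    -- immersions.
    refine injective_fderiv_of_left_inverse (g := fun x => flowFamily Φ l x v)
      hψ.differentiableAt (by rw [hret]; exact hφ.differentiableAt) ?_
    filter_upwards [isOpen_ball.mem_nhds hm₁] with x hx
    have := (hf₁ V (reversal l) (by simp [hl]) (norm_reversal hn) x hx v hvε₁).2.2
    rwa [reversal_reversal] at this
  refine ⟨V, i1, i2, i3, l, v, hV, hl, hn, hvε,
    AnalyticAt.comp (g := fun x => flowFamily Φ (reversal l) x v) hψ hσ, ?_, hret, ?_⟩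
  · have h1 := HasFDerivAt.comp (g := fun x => flowFamily Φ (reversal l) x v)
      (f := flowFamily Φ l p) v hψ.differentiableAt.hasFDerivAt hσ.differentiableAt.hasFDerivAt
    have h2 : HasFDerivAt (fun u => flowFamily Φ (reversal l) (flowFamily Φ l p u) v) _ v := h1
    rw [h2.fderiv]
    exact hψinj.comp hinj
  · have h1 := hch V l hl.le hn v (fun _ => p) (ContinuousLinearMap.id 𝕂 V) 0 IsChainMap.const
      (mem_ball_self hε₂) (by simpa using hvε₂)
    have h2 := hch V (reversal l) (by simp [hl]) (norm_reversal hn) v _ 0 v h1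
      (by simpa using hm₂) (by simpa using hvε₂)
    simpa using h2

variable [NormedSpace ℝ E] [IsScalarTower ℝ 𝕂 E]

/-- **Local orbit theorem.** The local orbits of an analytic flow system are the germs of an
analytic submanifold, to which all the fields are tangent. -/
theorem exists_orbit_retraction (h : IsFlowSystem 𝕂 X Φ A p) (hp : p ∈ A) {U : Set (E × 𝕂)}
    (hU : U ∈ 𝓝 (p, (0 : 𝕂))) :
    ∃ (V : Type) (_ : NormedAddCommGroup V) (_ : NormedSpace 𝕂 V)
      (_ : FiniteDimensional 𝕂 V) (σ : V → E) (v₀ : V) (π : E →L[𝕂] V) (H : V → V),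
      IsLocalRetraction 𝕂 (fun x => σ (H (π x))) p ∧
      (∀ a, IsTangentTo 𝕂 (X a) (fun x => σ (H (π x))) p) ∧
      Module.finrank 𝕂 (fderiv 𝕂 (fun x => σ (H (π x))) p).range = Module.finrank 𝕂 V ∧
      IsChainMap Φ U p v₀ σ ∧ AnalyticAt 𝕂 σ v₀ ∧
      AnalyticAt 𝕂 H (π p) ∧ H (π p) = v₀ ∧ (∀ᶠ y in 𝓝 (π p), π (σ (H y)) = y) ∧
      ∀ K ≥ 2 * Module.finrank 𝕂 V, ∃ δ₀ > 0, ∀ δ, 0 < δ → δ < δ₀ →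
        ∀ᶠ x in 𝓝 p, x ∈ localOrbit 𝕂 X A K δ p ↔ σ (H (π x)) = x := by
  have := FiniteDimensional.complete 𝕂 E
  obtain ⟨e, he, hmax⟩ := exists_maximal_immersion (𝕂 := 𝕂) Φ p
  -- `e` flows out, `e` flows back, and one more flow to test tangency of a field.
  obtain ⟨ε₁, hε₁, hrk⟩ := h.finrank_range_fderiv_le he hmax (2 * e + 1)
  obtain ⟨ρ, hρ, hb⟩ := h.exists_ball univ_mem
  obtain ⟨ε₂, hε₂, hf₂⟩ := h.exists_analytic_family (2 * e + 1) _ univ_mem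
  obtain ⟨V, i1, i2, i3, l, v, hV, hl, hn, hv, hσ, hinj, hσp, hchain⟩ :=
    h.exists_return_immersion he hU (lt_min hε₁ hε₂)
  have := FiniteDimensional.complete 𝕂 V
  have hvε₁ : v ∈ ball (0 : V) ε₁ := mem_ball_zero_iff.2 (hv.trans_le (min_le_left _ _))
  have hvε₂ : v ∈ ball (0 : V) ε₂ := mem_ball_zero_iff.2 (hv.trans_le (min_le_right _ _))
  set σ : V → E := fun u => flowFamily Φ (reversal l) (flowFamily Φ l p u) v with hσ_def
  obtain ⟨π, H, hH, hH0, hr, hR, hlft, hrange⟩ := exists_retraction_of_immersion hσ hinj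
  have hσp' : σ v = p := hσp
  have hX : ∀ a, ∀ᶠ u in 𝓝 v, X a (σ u) ∈ (fderiv 𝕂 σ u).range := by
    intro a
    have hg : ∀ᶠ u in 𝓝 v, AnalyticAt 𝕂 (fun x => H (π x)) (σ u) := by
      have h1 : AnalyticAt 𝕂 (fun x => H (π x)) (σ v) :=
        AnalyticAt.comp (g := H) (f := fun x => π x) hH (π.analyticAt _)
      exact hσ.continuousAt.eventually h1.eventually_analyticAt
    have hσρ : ∀ᶠ u in 𝓝 v, σ u ∈ ball p ρ :=
      hσ.continuousAt.eventually (isOpen_ball.mem_nhds (by rw [hσp']; exact mem_ball_self hρ))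
    filter_upwards [hg, hσρ, hσ.eventually_analyticAt, hlft.eventually_nhds,
      isOpen_ball.mem_nhds hvε₁, isOpen_ball.mem_nhds hvε₂] with u hgu hσu hσan hlu hu₁ hu₂
    have hinju : Function.Injective (fderiv 𝕂 σ u) :=
      injective_fderiv_of_left_inverse (g := fun x => H (π x)) hσan.differentiableAt
        hgu.differentiableAt hlu
    obtain ⟨_, hΦ, _, hd, _⟩ := hb a _ hσu 0 (mem_ball_self hρ)
    have hz : ∀ᶠ x in 𝓝 (σ u), Φ a (x, 0) = x := by
      filter_upwards [isOpen_ball.mem_nhds hσu] with x hx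
      exact (hb a x hx 0 (mem_ball_self hρ)).2.2.1
    have hder := hasFDerivAt_extend hσan.differentiableAt hΦ.differentiableAt hz hd
    let T₁ : (V × V) × 𝕂 →L[𝕂] V :=
      (ContinuousLinearMap.fst 𝕂 V V).comp (ContinuousLinearMap.fst 𝕂 (V × V) 𝕂)
    let T₂ : (V × V) × 𝕂 →L[𝕂] V :=
      (ContinuousLinearMap.snd 𝕂 V V).comp (ContinuousLinearMap.fst 𝕂 (V × V) 𝕂)
    have hT₁ : ‖T₁‖ ≤ 1 := by
      refine ContinuousLinearMap.opNorm_le_bound _ zero_le_one fun z => ?_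
      rw [one_mul]
      exact (norm_fst_le z.1).trans (norm_fst_le z)
    have hT₂ : ‖T₂‖ ≤ 1 := by
      refine ContinuousLinearMap.opNorm_le_bound _ zero_le_one fun z => ?_
      rw [one_mul]
      exact (norm_snd_le z.1).trans (norm_fst_le z)
    -- The return times get independent parameters, which makes the family an instance of the rank
    -- bound; fixing them at `v` recovers `σ` followed by the flow of `X a`.
    set l' : List (ι × ((V × V) × 𝕂 →L[𝕂] 𝕂)) :=
      (pullTimes T₁ l ++ pullTimes T₂ (reversal l)) ++
        [(a, ContinuousLinearMap.snd 𝕂 (V × V) 𝕂)] with hl'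
    have hlen : l'.length ≤ 2 * e + 1 := by
      simp [hl', hl]; omega
    have hn' : ∀ c ∈ l', ‖c.2‖ ≤ 1 := by
      intro c hc
      rw [hl', List.mem_append, List.mem_append, List.mem_singleton] at hc
      rcases hc with (hc | hc) | rfl
      · exact norm_pullTimes hT₁ hn c hc
      · exact norm_pullTimes hT₂ (norm_reversal hn) c hc
      · exact ContinuousLinearMap.norm_snd_le 𝕂 (V × V) 𝕂
    have hmem : ∀ r : ℝ, 0 < r → u ∈ ball (0 : V) r → v ∈ ball (0 : V) r →
        ((u, v), (0 : 𝕂)) ∈ ball (0 : (V × V) × 𝕂) r := by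
      intro r hr hu hv
      rw [mem_ball_zero_iff] at hu hv ⊢
      simp only [Prod.norm_def, norm_zero]
      exact max_lt (max_lt hu hv) hr
    have hrk' := hrk _ l' hlen hn' _ (hmem ε₁ hε₁ hu₁ hvε₁)
    have han' : AnalyticAt 𝕂 (flowFamily Φ l' p) ((u, v), (0 : 𝕂)) :=
      AnalyticAt.comp (g := fun z : E × ((V × V) × 𝕂) => flowFamily Φ l' z.1 z.2)
        (f := fun v => (p, v))
        (hf₂ _ l' hlen hn' p (mem_ball_self hε₂) _ (hmem ε₂ hε₂ hu₂ hvε₂)).2.1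
        (analyticAt_const.prod analyticAt_id)
    have heq : (fun z : V × 𝕂 => flowFamily Φ l' p ((z.1, v), z.2)) =
        fun z : V × 𝕂 => Φ a (σ z.1, z.2) := by
      ext z
      simp [hl', flowFamily_append, flowFamily_pullTimes, T₁, T₂, hσ_def]
    have hder' : HasFDerivAt (fun z : V × 𝕂 => flowFamily Φ l' p ((z.1, v), z.2))
        ((fderiv 𝕂 (flowFamily Φ l' p) ((u, v), 0)).comp
          (((ContinuousLinearMap.fst 𝕂 V 𝕂).prod 0).prod (ContinuousLinearMap.snd 𝕂 V 𝕂)))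
        (u, 0) :=
      HasFDerivAt.comp (g := flowFamily Φ l' p) (f := fun z : V × 𝕂 => ((z.1, v), z.2)) _
        han'.differentiableAt.hasFDerivAt
        ((hasFDerivAt_fst.prodMk (hasFDerivAt_const _ _)).prodMk hasFDerivAt_snd)
    rw [heq] at hder'
    have huniq := hder.unique hder'
    have hsub : (fderiv 𝕂 σ u).range ≤ (fderiv 𝕂 (flowFamily Φ l' p) ((u, v), 0)).range := by
      rintro _ ⟨w, rfl⟩
      have := congrArg (fun A => A (w, (0 : 𝕂))) huniq
      simp only [ContinuousLinearMap.coprod_apply, map_zero, add_zero] at this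
      exact ⟨_, this.symm⟩
    have hXmem : X a (σ u) ∈ (fderiv 𝕂 (flowFamily Φ l' p) ((u, v), 0)).range := by
      have := congrArg (fun A => A ((0 : V), (1 : 𝕂))) huniq
      simp only [ContinuousLinearMap.coprod_apply, map_zero, zero_add,
        ContinuousLinearMap.toSpanSingleton_apply, one_smul] at this
      exact ⟨_, this.symm⟩
    have hfin : Module.finrank 𝕂 (fderiv 𝕂 σ u).range = e := by
      rw [← hV]
      exact LinearMap.finrank_range_of_inj hinju
    -- The larger range has dimension at most `e`, and `dσ` already fills that dimension, so the two
    -- ranges coincide and contain `X a`.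
    rw [Submodule.eq_of_le_of_finrank_le hsub (by rw [hfin]; exact hrk')]
    exact hXmem
  have hXR := fun a => isTangentTo_of_immersion hσ hH hH0 hR.analytic hlft (hX a)
  have hfr : Module.finrank 𝕂 (fderiv 𝕂 (fun x => σ (H (π x))) p).range = Module.finrank 𝕂 V := by
    rw [← hσp', hrange]
    exact LinearMap.finrank_range_of_inj hinj
  rw [hσp'] at hH hH0 hr hR hXR
  refine ⟨V, i1, i2, i3, σ, v, π, H, hR, hXR, hfr, hchain, hσ, hH, hH0, hr, fun K hK => ?_⟩
  rw [hV] at hK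
  obtain ⟨δ₁, hδ₁, hsub⟩ := hR.localOrbit_subset h.field hXR univ_mem K
  obtain ⟨ε₃, hε₃, hch⟩ := h.exists_chain_family e
  obtain ⟨ε₄, hε₄, hf₄⟩ := h.exists_analytic_family e _ (ball_mem_nhds p hε₃)
  refine ⟨min δ₁ ε₃, lt_min hδ₁ hε₃, fun δ hδ hδ' => ?_⟩
  have hδδ₁ : δ ≤ δ₁ := hδ'.le.trans (min_le_left _ _)
  have hδε₃ : δ ≤ ε₃ := hδ'.le.trans (min_le_right _ _)
  -- A second return immersion, chosen after `δ`, has all its times below `δ`, so its image consists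
  -- of points of the orbit. The first retraction stays independent of `δ` and `K`.
  obtain ⟨V', j1, j2, j3, l', v', hV', hl', hn', hv', hσ', hinj', hσp'', -⟩ :=
    h.exists_return_immersion he hU (lt_min hδ hε₄)
  set σ' : V' → E := fun u => flowFamily Φ (reversal l') (flowFamily Φ l' p u) v' with hσ'_def
  have hσ'p : σ' v' = p := hσp''
  obtain ⟨π', H', hH', hH0', hr', hR', hlft', hrange'⟩ := exists_retraction_of_immersion hσ' hinj'
  have hfr' : Module.finrank 𝕂 (fderiv 𝕂 (fun x => σ' (H' (π' x))) p).range =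
      Module.finrank 𝕂 V' := by
    rw [← hσ'p, hrange']
    exact LinearMap.finrank_range_of_inj hinj'
  rw [hσ'p] at hH' hH0' hr' hR'
  have hvδ : v' ∈ ball (0 : V') δ := mem_ball_zero_iff.2 (hv'.trans_le (min_le_left _ _))
  have hvε₄ : v' ∈ ball (0 : V') ε₄ := mem_ball_zero_iff.2 (hv'.trans_le (min_le_right _ _))
  have horb : ∀ᶠ u in 𝓝 v', σ' u ∈ localOrbit 𝕂 X A K δ p := by
    filter_upwards [isOpen_ball.mem_nhds hvδ, isOpen_ball.mem_nhds hvε₄] with u hu hu₄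
    obtain ⟨g1, g2⟩ := hch V' l' hl'.le hn' δ hδε₃ p (mem_ball_self hε₃) hp u hu 0 rfl
    have g3 := (hf₄ V' l' hl'.le hn' p (mem_ball_self hε₄) u hu₄).1
    obtain ⟨-, g4⟩ := hch V' (reversal l') (by simp [hl']) (norm_reversal hn') δ hδε₃ _ g3 g1 v' hvδ
      _ g2
    simp only [localOrbit, Set.mem_iUnion]
    refine ⟨_, ?_, g4⟩
    simp only [length_reversal, hl']
    omega
  have hR'orb : ∀ᶠ x in 𝓝 p, σ' (H' (π' x)) ∈ localOrbit 𝕂 X A K δ p := by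
    have h1 : ContinuousAt (fun x => H' (π' x)) p :=
      ContinuousAt.comp (g := H') hH'.continuousAt π'.continuous.continuousAt
    have h2 := h1.tendsto
    rw [hH0'] at h2
    exact h2.eventually horb
  have hcomp := hR.eq_of_finrank_eq hR' (hR'orb.mono fun x hx => (hsub δ hδδ₁ A _ hx).2)
    (by rw [hfr, hfr', hV, hV'])
  filter_upwards [hcomp, hR'orb] with x hx1 hx2
  constructor
  · exact fun hx => (hsub δ hδδ₁ A x hx).2
  · intro hx
    have := hx1.1 hx
    rwa [this] at hx2

end IsFlowSystem

end Orbit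

/-! ### Analytic dependence of real flows on point and time -/

section AnalyticFlow

/-- The contraction of the interval `[0, 1]` by the factor `r`. -/
def dilate {E : Type} [NormedAddCommGroup E] (r : Set.Icc (0 : ℝ) 1) (h : C(Set.Icc (0 : ℝ) 1, E)) : C(Set.Icc (0 : ℝ) 1, E) :=
  ⟨fun t => h (r * t), h.continuous.comp (by fun_prop)⟩

theorem dilate_apply {E : Type} [NormedAddCommGroup E] (r t : Set.Icc (0 : ℝ) 1) (h : C(Set.Icc (0 : ℝ) 1, E)) :
    dilate r h t = h (r * t) := rfl

theorem norm_dilate_le {E : Type} [NormedAddCommGroup E] (r : Set.Icc (0 : ℝ) 1) (h : C(Set.Icc (0 : ℝ) 1, E)) :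
    ‖dilate r h‖ ≤ ‖h‖ := by
  rw [ContinuousMap.norm_le _ (by positivity)]
  exact fun t => h.norm_coe_le_norm _

variable {E : Type} [NormedAddCommGroup E] [NormedSpace ℝ E]

/-- A multilinear map acts pointwise on continuous functions. -/
noncomputable def pointwiseMultilinear {n : ℕ} (P : ContinuousMultilinearMap ℝ (fun _ : Fin n => E) E) :
    ContinuousMultilinearMap ℝ (fun _ : Fin n => C(Set.Icc (0 : ℝ) 1, E)) C(Set.Icc (0 : ℝ) 1, E) :=
  MultilinearMap.mkContinuous
    { toFun := fun γ => ⟨fun t => P fun i => γ i t,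
        P.cont.comp (continuous_pi fun i => (γ i).continuous)⟩
      map_update_add' := fun γ i x y => by
        ext t
        have h : ∀ z : C(Set.Icc (0 : ℝ) 1, E), (fun j => Function.update γ i z j t) =
            Function.update (fun j => γ j t) i (z t) := fun z => by
          ext j
          by_cases hj : j = i
          · subst hj; simp
          · simp [hj]
        simp [h]
      map_update_smul' := fun γ i c x => by
        ext t
        have h : ∀ z : C(Set.Icc (0 : ℝ) 1, E), (fun j => Function.update γ i z j t) =
            Function.update (fun j => γ j t) i (z t) := fun z => by
          ext j
          by_cases hj : j = i
          · subst hj; simp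
          · simp [hj]
        simp [h] } ‖P‖ fun γ => by
    rw [ContinuousMap.norm_le _ (by positivity)]
    intro t
    refine (P.le_opNorm _).trans ?_
    gcongr with i
    exact (γ i).norm_coe_le_norm t

/-- The superposition operator of an analytic map is analytic. -/
theorem exists_superposition [CompleteSpace E] {X : E → E} {p : E} (hX : AnalyticAt ℝ X p) :
    ∃ (S : C(Set.Icc (0 : ℝ) 1, E) → C(Set.Icc (0 : ℝ) 1, E)) (r : ℝ), 0 < r ∧ AnalyticAt ℝ S 0 ∧
      ∀ h, ‖h‖ < r → ∀ t, S h t = X (p + h t) := by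
  obtain ⟨P, r, hP⟩ := hX
  -- The power series of `X` acts pointwise on continuous paths; its terms do not grow in norm, so
  -- it converges at least as far.
  let Q : FormalMultilinearSeries ℝ C(Set.Icc (0 : ℝ) 1, E) C(Set.Icc (0 : ℝ) 1, E) :=
    fun n => pointwiseMultilinear (P n)
  have hQ : ∀ n, ‖Q n‖ ≤ ‖P n‖ := fun n =>
    MultilinearMap.mkContinuous_norm_le _ (norm_nonneg _) _
  have hrad : P.radius ≤ Q.radius := by
    refine ENNReal.le_of_forall_nnreal_lt fun s hs => ?_
    obtain ⟨C, _, hC⟩ := P.norm_mul_pow_le_of_lt_radius hs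
    exact Q.le_radius_of_bound C fun n =>
      (mul_le_mul_of_nonneg_right (hQ n) (by positivity)).trans (hC n)
  have hpos : 0 < Q.radius := (hP.r_pos.trans_le hP.r_le).trans_le hrad
  obtain ⟨s, hs0, hs⟩ := ENNReal.lt_iff_exists_nnreal_btwn.1 hP.r_pos
  refine ⟨Q.sum, s, by exact_mod_cast hs0, (Q.hasFPowerSeriesOnBall hpos).analyticAt, ?_⟩
  intro h hh t
  have hh' : h ∈ Metric.eball (0 : C(Set.Icc (0 : ℝ) 1, E)) Q.radius := by
    rw [mem_eball_zero_iff]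
    refine lt_of_lt_of_le ?_ (hs.le.trans (hP.r_le.trans hrad))
    rw [enorm_eq_nnnorm]
    exact_mod_cast hh
  have h1 : HasSum (fun n => Q n fun _ => h) (Q.sum h) := Q.hasSum hh'
  have h2 := h1.mapL (ContinuousMap.evalCLM ℝ t)
  have hht : h t ∈ Metric.eball (0 : E) r := by
    rw [mem_eball_zero_iff]
    refine lt_trans ?_ hs
    rw [enorm_eq_nnnorm]
    have : ‖h t‖ < s := (h.norm_coe_le_norm t).trans_lt hh
    exact_mod_cast this
  exact h2.unique (hP.hasSum hht)

/-- The primitive vanishing at `0`, as a bounded operator. -/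
noncomputable def primitive : C(Set.Icc (0 : ℝ) 1, E) →L[ℝ] C(Set.Icc (0 : ℝ) 1, E) :=
  LinearMap.mkContinuous
    { toFun := fun g => ⟨fun t => ∫ s in (0 : ℝ)..t, Set.IccExtend zero_le_one g s, by
        have h : Continuous (Set.IccExtend (zero_le_one' ℝ) g) := g.continuous.Icc_extend'
        exact (intervalIntegral.continuous_primitive (fun a b => h.intervalIntegrable a b) 0).comp
          continuous_subtype_val⟩
      map_add' := fun g g' => by
        ext t
        have h : ∀ g : C(Set.Icc (0 : ℝ) 1, E), IntervalIntegrable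
            (Set.IccExtend (zero_le_one' ℝ) g) MeasureTheory.volume 0 t :=
          fun g => (g.continuous.Icc_extend').intervalIntegrable _ _
        exact intervalIntegral.integral_add (h g) (h g')
      map_smul' := fun c g => by
        ext t
        exact intervalIntegral.integral_smul c (Set.IccExtend (zero_le_one' ℝ) g) } 1 fun g => by
    rw [ContinuousMap.norm_le _ (by positivity)]
    intro t
    have h := intervalIntegral.norm_integral_le_of_norm_le_const (a := (0 : ℝ)) (b := t)
      (f := Set.IccExtend (zero_le_one' ℝ) g) (C := ‖g‖) (fun s _ => g.norm_coe_le_norm _)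
    refine h.trans ?_
    rw [sub_zero, abs_of_nonneg t.2.1, one_mul]
    exact mul_le_of_le_one_right (norm_nonneg _) t.2.2

theorem primitive_apply (g : C(Set.Icc (0 : ℝ) 1, E)) (t : Set.Icc (0 : ℝ) 1) :
    primitive g t = ∫ s in (0 : ℝ)..t, Set.IccExtend (zero_le_one' ℝ) g s := rfl

/-- Rescaling of time in the integral equation: it shows that a dilated solution for time `s` solves
the equation for time `r s`. -/
theorem primitive_dilate (r t : Set.Icc (0 : ℝ) 1) (g : C(Set.Icc (0 : ℝ) 1, E)) :
    (r : ℝ) • primitive (dilate r g) t = primitive g (r * t) := by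
  rw [primitive_apply, primitive_apply]
  have h1 : ∫ s in (0 : ℝ)..t, Set.IccExtend (zero_le_one' ℝ) (dilate r g) s =
      ∫ s in (0 : ℝ)..t, Set.IccExtend (zero_le_one' ℝ) g (r * s) := by
    refine intervalIntegral.integral_congr fun s hs => ?_
    rw [Set.uIcc_of_le t.2.1] at hs
    have hs' : s ∈ Set.Icc (0 : ℝ) 1 := ⟨hs.1, hs.2.trans t.2.2⟩
    have hrs : (r : ℝ) * s ∈ Set.Icc (0 : ℝ) 1 := (r * ⟨s, hs'⟩ : Set.Icc (0 : ℝ) 1).2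
    rw [Set.IccExtend_of_mem _ _ hs', Set.IccExtend_of_mem _ _ hrs, dilate_apply]
    rfl
  rw [h1, intervalIntegral.smul_integral_comp_mul_left]
  simp

/-- **Analytic local flows.** -/
theorem exists_integral_flow [CompleteSpace E] {X : E → E} {p : E} (hX : AnalyticAt ℝ X p) :
    ∃ Φ : E × ℝ → E, AnalyticAt ℝ Φ (p, 0) ∧ Φ (p, 0) = p ∧ ∃ ρ > 0, ∀ x ∈ ball p ρ,
      ∀ s ∈ ball (0 : ℝ) ρ, Φ (x, s) = x + ∫ t in (0 : ℝ)..s, X (Φ (x, t)) := by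
  obtain ⟨S, r, hr, hS, hSX⟩ := exists_superposition hX
  let cst : E →L[ℝ] C(Set.Icc (0 : ℝ) 1, E) := ContinuousLinearMap.const ℝ (Set.Icc (0 : ℝ) 1)
  have hcst : ∀ x t, cst x t = x := fun x t => rfl
  -- With time rescaled to `[0, 1]`, a trajectory `p + γ` from `x` solves `γ = (x - p) + s ∫ X (p +
  -- γ)`. The inverse function theorem on the Banach space of paths solves this for `γ`: at `s = 0`
  -- the differential is the identity in `γ` up to a triangular term.
  let F : (E × ℝ) × C(Set.Icc (0 : ℝ) 1, E) → (E × ℝ) × C(Set.Icc (0 : ℝ) 1, E) := fun w =>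
    (w.1, w.2 - cst (w.1.1 - p) - w.1.2 • primitive (S w.2))
  let w₀ : (E × ℝ) × C(Set.Icc (0 : ℝ) 1, E) := ((p, 0), 0)
  have hFw₀ : F w₀ = w₀ := by simp [F, w₀]
  let B : E × ℝ →L[ℝ] C(Set.Icc (0 : ℝ) 1, E) := cst.comp (ContinuousLinearMap.fst ℝ E ℝ) +
    (ContinuousLinearMap.snd ℝ E ℝ).smulRight (primitive (S 0))
  let F' : ((E × ℝ) × C(Set.Icc (0 : ℝ) 1, E)) ≃L[ℝ] ((E × ℝ) × C(Set.Icc (0 : ℝ) 1, E)) :=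
    ContinuousLinearEquiv.equivOfInverse
      ((ContinuousLinearMap.fst ℝ (E × ℝ) C(Set.Icc (0 : ℝ) 1, E)).prod
        (ContinuousLinearMap.snd ℝ (E × ℝ) C(Set.Icc (0 : ℝ) 1, E) - B.comp (ContinuousLinearMap.fst ℝ (E × ℝ) C(Set.Icc (0 : ℝ) 1, E))))
      ((ContinuousLinearMap.fst ℝ (E × ℝ) C(Set.Icc (0 : ℝ) 1, E)).prod
        (ContinuousLinearMap.snd ℝ (E × ℝ) C(Set.Icc (0 : ℝ) 1, E) + B.comp (ContinuousLinearMap.fst ℝ (E × ℝ) C(Set.Icc (0 : ℝ) 1, E))))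
      (fun w => by simp) (fun w => by simp)
  have hSw : AnalyticAt ℝ (fun w : (E × ℝ) × C(Set.Icc (0 : ℝ) 1, E) => primitive (S w.2)) w₀ :=
    ((primitive (E := E)).analyticAt _).comp
      (AnalyticAt.comp (g := S) (f := Prod.snd) (x := w₀) hS analyticAt_snd)
  have hFan : AnalyticAt ℝ F w₀ := by
    refine analyticAt_fst.prod ((analyticAt_snd.sub ?_).sub ?_)
    · exact (cst.analyticAt _).comp ((analyticAt_fst.comp analyticAt_fst).sub analyticAt_const)
    · exact (analyticAt_snd.comp analyticAt_fst).smul hSw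
  have hFder : HasFDerivAt F (F' : ((E × ℝ) × C(Set.Icc (0 : ℝ) 1, E)) →L[ℝ] ((E × ℝ) × C(Set.Icc (0 : ℝ) 1, E))) w₀ := by
    have h1 : HasFDerivAt (fun w : (E × ℝ) × C(Set.Icc (0 : ℝ) 1, E) => w.1.1) _ w₀ := (hasFDerivAt_fst (𝕜 := ℝ) (p := w₀)).fst
    have h2 : HasFDerivAt (fun w : (E × ℝ) × C(Set.Icc (0 : ℝ) 1, E) => w.1.2) _ w₀ := (hasFDerivAt_fst (𝕜 := ℝ) (p := w₀)).snd
    have h3 := (hasFDerivAt_snd (𝕜 := ℝ) (p := w₀)).sub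
      (cst.hasFDerivAt.comp w₀ (h1.sub_const p))
    have h4 := h3.sub (h2.smul hSw.differentiableAt.hasFDerivAt)
    refine ((hasFDerivAt_fst (𝕜 := ℝ) (p := w₀)).prodMk h4).congr_fderiv ?_
    ext w <;> simp [F', B, w₀]
  have hFs : HasStrictFDerivAt F (F' : ((E × ℝ) × C(Set.Icc (0 : ℝ) 1, E)) →L[ℝ] ((E × ℝ) × C(Set.Icc (0 : ℝ) 1, E))) w₀ := by
    have := hFan.hasStrictFDerivAt
    rwa [hFder.fderiv] at this
  let G := hFs.localInverse
  have hGan : AnalyticAt ℝ G w₀ := by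
    have h1 : ContDiffAt ℝ ⊤ F w₀ := hFan.contDiffAt
    have h2 := (h1.to_localInverse hFder (by simp)).analyticAt
    rwa [hFw₀] at h2
  have hGr : ∀ᶠ w in 𝓝 w₀, F (G w) = w := by
    have := hFs.eventually_right_inverse
    rwa [hFw₀] at this
  have hGl : ∀ᶠ w in 𝓝 w₀, G (F w) = w := hFs.eventually_left_inverse
  have hG0 : G w₀ = w₀ := by
    have := hGl.self_of_nhds
    rwa [hFw₀] at this
  let γ : E × ℝ → C(Set.Icc (0 : ℝ) 1, E) := fun z => (G (z, 0)).2
  have hγan : AnalyticAt ℝ γ (p, 0) :=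
    analyticAt_snd.comp (AnalyticAt.comp (g := G) (f := fun z : E × ℝ => (z, (0 : C(Set.Icc (0 : ℝ) 1, E))))
      (x := ((p, 0) : E × ℝ)) hGan (analyticAt_id.prod analyticAt_const))
  have hγ0 : γ (p, 0) = 0 := congrArg Prod.snd hG0
  have hγeq : ∀ᶠ z in 𝓝 ((p, 0) : E × ℝ), γ z = cst (z.1 - p) + z.2 • primitive (S (γ z)) := by
    have ht : Tendsto (fun z : E × ℝ => (z, (0 : C(Set.Icc (0 : ℝ) 1, E)))) (𝓝 (p, 0)) (𝓝 w₀) :=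
      (Continuous.prodMk_left (0 : C(Set.Icc (0 : ℝ) 1, E))).tendsto _
    filter_upwards [ht.eventually hGr] with z hz
    have h1 : (G (z, 0)).1 = z := congrArg Prod.fst hz
    have h2 := congrArg Prod.snd hz
    simp only [F, h1] at h2
    rw [sub_sub, sub_eq_zero] at h2
    exact h2
  -- Local uniqueness of solutions of the integral equation; it identifies the dilated path with the
  -- solution for the shorter time.
  have huniq : ∀ᶠ w in 𝓝 w₀, w.2 = cst (w.1.1 - p) + w.1.2 • primitive (S w.2) → γ w.1 = w.2 := by
    filter_upwards [hGl] with w hw hw2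
    have h1 : F w = (w.1, 0) := by
      refine Prod.ext rfl ?_
      show w.2 - cst (w.1.1 - p) - w.1.2 • primitive (S w.2) = 0
      rw [sub_sub, sub_eq_zero]
      exact hw2
    rw [h1] at hw
    exact congrArg Prod.snd hw
  obtain ⟨η, hη, hη'⟩ := Metric.eventually_nhds_iff_ball.1 huniq
  have hsmall : ∀ᶠ z in 𝓝 ((p, 0) : E × ℝ), ‖γ z‖ < min η r := by
    have := hγan.continuousAt.norm.tendsto
    rw [hγ0, norm_zero] at this
    exact this.eventually_lt_const (lt_min hη hr)
  obtain ⟨ρ, hρ, hρ'⟩ := Metric.eventually_nhds_iff_ball.1 (hγeq.and hsmall)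
  rw [← ball_prod_same] at hρ'
  let Φ : E × ℝ → E := fun z => p + γ z ⟨1, by simp⟩
  refine ⟨Φ, ?_, by simp [Φ, hγ0], min ρ η, lt_min hρ hη, ?_⟩
  · exact analyticAt_const.add (((ContinuousMap.evalCLM ℝ (⟨1, by simp⟩ : Set.Icc (0 : ℝ) 1)
      : C(Set.Icc (0 : ℝ) 1, E) →L[ℝ] E).analyticAt _).comp hγan)
  intro x hx s hs
  obtain ⟨heq, hlt⟩ := hρ' (x, s) ⟨ball_subset_ball (min_le_left _ _) hx,
    ball_subset_ball (min_le_left _ _) hs⟩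
  -- `Φ` was defined through the endpoint of the rescaled path; here the intermediate points are
  -- recognized as values of `Φ` at intermediate times.
  have hscale : ∀ t : Set.Icc (0 : ℝ) 1, Φ (x, t * s) = p + γ (x, s) t := by
    intro t
    have hw : ((x, (t : ℝ) * s), dilate t (γ (x, s))) ∈ ball w₀ η := by
      rw [mem_ball, Prod.dist_eq, Prod.dist_eq]
      refine max_lt (max_lt (hx.trans_le (min_le_right _ _)) ?_) ?_
      · rw [dist_zero_right, norm_mul, Real.norm_of_nonneg t.2.1]
        rw [mem_ball_zero_iff] at hs
        calc (t : ℝ) * ‖s‖ ≤ 1 * ‖s‖ := by gcongr; exact t.2.2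
          _ < η := by rw [one_mul]; exact hs.trans_le (min_le_right _ _)
      · rw [dist_zero_right]
        exact (norm_dilate_le _ _).trans_lt (hlt.trans_le (min_le_left _ _))
    have h1 : S (dilate t (γ (x, s))) = dilate t (S (γ (x, s))) := by
      ext τ
      rw [hSX _ ((norm_dilate_le _ _).trans_lt (hlt.trans_le (min_le_right _ _))), dilate_apply,
        dilate_apply, hSX _ (hlt.trans_le (min_le_right _ _))]
    have h2 := hη' _ hw (by
      ext τ
      have h3 := congrArg (fun g : C(Set.Icc (0 : ℝ) 1, E) => g (t * τ)) heq
      simp only [ContinuousMap.add_apply, ContinuousMap.smul_apply, hcst] at h3 ⊢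
      rw [dilate_apply, h3, h1, mul_comm (t : ℝ) s, mul_smul, primitive_dilate])
    have h3 := congrArg (fun g : C(Set.Icc (0 : ℝ) 1, E) => g ⟨1, by simp⟩) h2
    simp only [Φ, h3, dilate_apply]
    have h4 : t * (⟨1, by simp⟩ : Set.Icc (0 : ℝ) 1) = t := mul_one t
    rw [h4]
  have h1 := congrArg (fun g : C(Set.Icc (0 : ℝ) 1, E) => g ⟨1, by simp⟩) heq
  simp only [ContinuousMap.add_apply, ContinuousMap.smul_apply, hcst, primitive_apply] at h1
  have h2 : ∫ t in (0 : ℝ)..1, Set.IccExtend (zero_le_one' ℝ) (S (γ (x, s))) t =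
      ∫ t in (0 : ℝ)..1, X (Φ (x, t * s)) := by
    refine intervalIntegral.integral_congr fun t ht => ?_
    rw [Set.uIcc_of_le zero_le_one] at ht
    rw [Set.IccExtend_of_mem _ _ ht, hSX _ (hlt.trans_le (min_le_right _ _)),
      hscale ⟨t, ht⟩]
  have h3 : Φ (x, s) = p + γ (x, s) ⟨1, by simp⟩ := rfl
  rw [h3, h1, h2]
  have h4 := intervalIntegral.smul_integral_comp_mul_right (a := 0) (b := 1)
    (fun t => X (Φ (x, t))) s
  rw [h4, zero_mul, one_mul]
  abel

/-- Two integral curves of an analytic field, staying near a point, coincide if they start at the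
same point. -/
theorem exists_unique_nhds {X : E → E} {p : E} (hX : AnalyticAt ℝ X p) :
    ∃ W ∈ 𝓝 p, ∀ (c d : ℝ → E) (k : ℝ),
      (∀ r ∈ Set.Icc (0 : ℝ) 1, c r ∈ W ∧ HasDerivAt c (k • X (c r)) r) →
      (∀ r ∈ Set.Icc (0 : ℝ) 1, d r ∈ W ∧ HasDerivAt d (k • X (d r)) r) → c 0 = d 0 → c 1 = d 1 := by
  obtain ⟨K, W, hW, hK⟩ := hX.hasStrictFDerivAt.exists_lipschitzOnWith
  refine ⟨W, hW, fun c d k hc hd h0 => ?_⟩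
  have hder : ∀ r ∈ Set.Icc (0 : ℝ) 1,
      HasDerivAt (fun r => c r - d r) (k • X (c r) - k • X (d r)) r :=
    fun r hr => (hc r hr).2.sub (hd r hr).2
  have := eq_zero_of_abs_deriv_le_mul_abs_self_of_eq_zero_right (a := 0) (b := 1)
    (f := fun r => c r - d r) (f' := fun r => k • X (c r) - k • X (d r)) (K := ‖k‖ * K)
    (fun r hr => (hder r hr).continuousAt.continuousWithinAt)
    (fun r hr => (hder r (Set.Ico_subset_Icc_self hr)).hasDerivWithinAt) (by simp [h0])
    (fun r hr => by
      have hr' := Set.Ico_subset_Icc_self hr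
      rw [← smul_sub, norm_smul, mul_assoc]
      gcongr
      have := hK.dist_le_mul _ (hc r hr').1 _ (hd r hr').1
      rwa [dist_eq_norm, dist_eq_norm] at this) 1 (by simp)
  exact sub_eq_zero.1 this

/-- The integral equation is differentiated in time. For reversibility, the trajectory run backwards
and the trajectory issued from the endpoint with negative time solve the same equation with the same
initial point. -/
theorem exists_analytic_flow [CompleteSpace E] {X : E → E} {p : E} (hX : AnalyticAt ℝ X p) :
    ∃ Φ : E × ℝ → E, AnalyticAt ℝ Φ (p, 0) ∧ (∀ᶠ x in 𝓝 p, Φ (x, 0) = x) ∧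
      (∀ᶠ z in 𝓝 (p, (0 : ℝ)), HasDerivAt (fun s => Φ (z.1, s)) (X (Φ z)) z.2) ∧
      ∀ᶠ z in 𝓝 (p, (0 : ℝ)), Φ (Φ z, -z.2) = z.1 := by
  obtain ⟨Φ, hΦ, hΦp, ρ, hρ, hint⟩ := exists_integral_flow hX
  have hΦt : Tendsto Φ (𝓝 (p, 0)) (𝓝 p) := by
    have := hΦ.continuousAt.tendsto
    rwa [hΦp] at this
  have hz : ∀ᶠ x in 𝓝 p, Φ (x, 0) = x := by
    filter_upwards [ball_mem_nhds p hρ] with x hx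
    simpa using hint x hx 0 (mem_ball_self hρ)
  have hd : ∀ᶠ z in 𝓝 (p, (0 : ℝ)), HasDerivAt (fun s => Φ (z.1, s)) (X (Φ z)) z.2 := by
    have h1 : ∀ᶠ z in 𝓝 (p, (0 : ℝ)), ContinuousAt (fun z => X (Φ z)) z := by
      filter_upwards [hΦ.eventually_analyticAt, hΦt.eventually hX.eventually_analyticAt]
        with z h1 h2
      exact ContinuousAt.comp (g := X) h2.continuousAt h1.continuousAt
    obtain ⟨η, hη, hη'⟩ := Metric.eventually_nhds_iff_ball.1 h1
    rw [← ball_prod_same] at hη'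
    refine Metric.eventually_nhds_iff_ball.2 ⟨min η ρ, lt_min hη hρ, ?_⟩
    rintro ⟨x, s⟩ hxs
    rw [← ball_prod_same] at hxs
    have hx := ball_subset_ball (min_le_left _ _) hxs.1
    have hs := ball_subset_ball (min_le_left _ _) hxs.2
    have hcont : ContinuousOn (fun t => X (Φ (x, t))) (ball 0 η) := fun t ht =>
      (ContinuousAt.comp (g := fun z => X (Φ z)) (f := fun t => (x, t)) (hη' (x, t) ⟨hx, ht⟩)
        (by fun_prop)).continuousWithinAt
    have hsub : Set.uIcc (0 : ℝ) s ⊆ ball 0 η :=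
      (convex_ball (0 : ℝ) η).ordConnected.uIcc_subset (mem_ball_self hη) hs
    have h2 := intervalIntegral.integral_hasDerivAt_right
      (hcont.mono hsub).intervalIntegrable
      (hcont.stronglyMeasurableAtFilter isOpen_ball s hs)
      (hcont.continuousAt (isOpen_ball.mem_nhds hs))
    refine (h2.const_add x).congr_of_eventuallyEq ?_
    filter_upwards [isOpen_ball.mem_nhds (ball_subset_ball (min_le_right _ _) hxs.2)] with t ht
    exact hint x (ball_subset_ball (min_le_right _ _) hxs.1) t ht
  refine ⟨Φ, hΦ, hz, hd, ?_⟩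
  obtain ⟨W, hW, huniq⟩ := exists_unique_nhds hX
  have h1 : ∀ᶠ z in 𝓝 (p, (0 : ℝ)), Φ z ∈ W ∧ HasDerivAt (fun s => Φ (z.1, s)) (X (Φ z)) z.2 ∧
      Φ (z.1, 0) = z.1 := by
    filter_upwards [hΦt hW, hd, (continuous_fst.tendsto (p, (0 : ℝ))).eventually hz]
      with z h1 h2 h3 using ⟨h1, h2, h3⟩
  obtain ⟨η, hη, hη'⟩ := Metric.eventually_nhds_iff_ball.1 h1
  rw [← ball_prod_same] at hη'
  have h2 : ∀ᶠ z in 𝓝 (p, (0 : ℝ)), z ∈ ball p η ×ˢ ball (0 : ℝ) η ∧ Φ z ∈ ball p η := by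
    filter_upwards [prod_mem_nhds (ball_mem_nhds p hη) (ball_mem_nhds (0 : ℝ) hη),
      hΦt (ball_mem_nhds p hη)] with z h1 h2 using ⟨h1, h2⟩
  filter_upwards [h2] with z hz'
  obtain ⟨⟨hx, hs⟩, hΦz⟩ := hz'
  have hmem : ∀ r ∈ Set.Icc (0 : ℝ) 1, r * z.2 ∈ ball (0 : ℝ) η := by
    intro r hr
    rw [mem_ball_zero_iff] at hs ⊢
    rw [norm_mul, Real.norm_of_nonneg hr.1]
    calc r * ‖z.2‖ ≤ 1 * ‖z.2‖ := by gcongr; exact hr.2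
      _ < η := by rwa [one_mul]
  have h3 := huniq (fun r => Φ (z.1, (1 - r) * z.2)) (fun r => Φ (Φ z, r * (-z.2))) (-z.2)
    (fun r hr => by
      obtain ⟨g1, g2, -⟩ := hη' (z.1, (1 - r) * z.2)
        ⟨hx, hmem (1 - r) ⟨by linarith [hr.2], by linarith [hr.1]⟩⟩
      refine ⟨g1, ?_⟩
      have h4 : HasDerivAt (fun r : ℝ => (1 - r) * z.2) (-z.2) r := by
        simpa using ((hasDerivAt_id r).const_sub 1).mul_const z.2
      exact HasDerivAt.scomp (g₁ := fun s => Φ (z.1, s)) r g2 h4)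
    (fun r hr => by
      obtain ⟨g1, g2, -⟩ := hη' (Φ z, r * (-z.2))
        ⟨hΦz, by have := hmem r hr; rw [mem_ball_zero_iff] at this ⊢; simpa using this⟩
      refine ⟨g1, ?_⟩
      have h4 : HasDerivAt (fun r : ℝ => r * (-z.2)) (-z.2) r := by
        simpa using (hasDerivAt_id r).mul_const (-z.2)
      exact HasDerivAt.scomp (g₁ := fun s => Φ (Φ z, s)) r g2 h4)
    (by
      have := (hη' (Φ z, 0) ⟨hΦz, mem_ball_self hη⟩).2.2
      simp [this])
  have h4 := (hη' (z.1, 0) ⟨hx, mem_ball_self hη⟩).2.2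
  simp only [sub_self, zero_mul, one_mul] at h3
  rw [h4] at h3
  exact h3.symm

end AnalyticFlow

/-! ### The identity principle on totally real submanifolds -/

section TotallyReal

/-- If `F ∘ β = 0`, the complex linear `dF` kills the range of `dβ`, hence its complex span, so `dF`
also vanishes along `β`. Iterate; the target `G` is quantified inside because it changes from `F` to
`dF`. -/
theorem iteratedFDeriv_eq_zero_of_totallyReal {V E : Type} [NormedAddCommGroup V]
    [NormedSpace ℝ V] [NormedAddCommGroup E] [NormedSpace ℂ E] {β : V → E} {v₀ : V}
    (hβ : ∀ᶠ v in 𝓝 v₀, ∃ β' : V →L[ℝ] E, HasFDerivAt β β' v ∧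
      Submodule.span ℂ (Set.range β') = ⊤) (n : ℕ) :
    ∀ {G : Type} [NormedAddCommGroup G] [NormedSpace ℂ G] [CompleteSpace G] {F : E → G},
      AnalyticAt ℂ F (β v₀) → (∀ᶠ v in 𝓝 v₀, F (β v) = 0) →
      iteratedFDeriv ℂ n F (β v₀) = 0 := by
  induction n with
  | zero =>
    intro G _ _ _ F _ h0
    ext m
    simpa using h0.self_of_nhds
  | succ n ih =>
    intro G _ _ _ F hF h0
    have hβc : ContinuousAt β v₀ := by
      obtain ⟨_, h, _⟩ := hβ.self_of_nhds
      exact h.continuousAt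
    have h1 : ∀ᶠ v in 𝓝 v₀, fderiv ℂ F (β v) = 0 := by
      filter_upwards [h0.eventually_nhds, hβ, hβc.eventually hF.eventually_analyticAt]
        with v hv ⟨β', hd, hs⟩ hFv
      have h2 := (hFv.differentiableAt.hasFDerivAt.restrictScalars ℝ).comp v hd
      have h3 : HasFDerivAt (fun _ : V => (0 : G)) _ v :=
        h2.congr_of_eventuallyEq (hv.mono fun w hw => hw.symm)
      have h4 := h3.unique (hasFDerivAt_const (𝕜 := ℝ) (0 : G) v)
      have h5 : (⊤ : Submodule ℂ E) ≤ (fderiv ℂ F (β v)).ker := by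
        rw [← hs, Submodule.span_le]
        rintro _ ⟨w, rfl⟩
        exact congrArg (fun A => A w) h4
      ext w
      exact h5 (Submodule.mem_top (x := w))
    have h2 := ih hF.fderiv h1
    ext m
    rw [iteratedFDeriv_succ_apply_right, h2]
    simp

/-- A holomorphic map vanishing on a maximally totally real submanifold vanishes. -/
theorem eventually_eq_zero_of_totallyReal {V E G : Type} [NormedAddCommGroup V]
    [NormedSpace ℝ V] [NormedAddCommGroup E] [NormedSpace ℂ E] {β : V → E} {v₀ : V}
    [NormedAddCommGroup G] [NormedSpace ℂ G] [CompleteSpace G] {F : E → G}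
    (hβ : ∀ᶠ v in 𝓝 v₀, ∃ β' : V →L[ℝ] E, HasFDerivAt β β' v ∧
      Submodule.span ℂ (Set.range β') = ⊤)
    (hF : AnalyticAt ℂ F (β v₀)) (h0 : ∀ᶠ v in 𝓝 v₀, F (β v) = 0) :
    ∀ᶠ x in 𝓝 (β v₀), F x = 0 := by
  obtain ⟨P, r, hP⟩ := hF
  filter_upwards [Metric.eball_mem_nhds (β v₀) hP.r_pos] with x hx
  have h1 := hP.hasSum_iteratedFDeriv (y := x - β v₀) (by
    rw [Metric.mem_eball, edist_eq_enorm_sub] at hx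
    rwa [mem_eball_zero_iff])
  have h2 : ∀ n, iteratedFDeriv ℂ n F (β v₀) = 0 := fun n =>
    iteratedFDeriv_eq_zero_of_totallyReal hβ n ⟨P, r, hP⟩ h0
  simp only [h2] at h1
  simp only [_root_.zero_apply, smul_zero, add_sub_cancel] at h1
  exact h1.unique hasSum_zero

variable {m d : ℕ}

/-- The map `t ↦ (t, t̄)`, as a real linear map. -/
noncomputable def pcL (m d : ℕ) : CSpace m d →L[ℝ] CSpace m d × CSpace m d :=
  ContinuousLinearMap.prod (ContinuousLinearMap.id ℝ (CSpace m d))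
    (starL' ℝ : CSpace m d ≃L[ℝ] CSpace m d).toContinuousLinearMap

theorem pcL_apply (t : CSpace m d) : pcL m d t = pc t := rfl

/-- The antidiagonal is a real form of `ℂⁿ × ℂⁿ`; the two components are the real and imaginary
parts for `sigma`. -/
theorem exists_pc_add_pc (q : CSpace m d × CSpace m d) :
    ∃ t t' : CSpace m d, q = pc t + Complex.I • pc t' := by
  obtain ⟨t, τ⟩ := q
  refine ⟨(1 / 2 : ℂ) • (t + star τ), (1 / (2 * Complex.I) : ℂ) • (t - star τ), ?_⟩
  simp only [pc, Prod.smul_mk, Prod.mk_add_mk, star_smul, star_add, star_sub, star_star]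
  refine Prod.ext ?_ ?_
  · simp only [smul_smul]
    have : Complex.I * (1 / (2 * Complex.I)) = 1 / 2 := by
      field_simp
    rw [this, ← smul_add]
    have h2 : t + star τ + (t - star τ) = (2 : ℂ) • t := by rw [two_smul]; abel
    rw [h2, smul_smul]
    simp
  · simp only [smul_smul]
    have h3 : star (1 / 2 : ℂ) = 1 / 2 := by simp
    have : Complex.I * star (1 / (2 * Complex.I)) = -(1 / 2) := by
      simp only [one_div, star_inv₀, star_mul', RCLike.star_def, Complex.conj_I, map_ofNat]
      field_simp
    rw [this, h3, neg_smul, ← sub_eq_add_neg, ← smul_sub]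
    have h2 : star t + τ - (star t - τ) = (2 : ℂ) • τ := by rw [two_smul]; abel
    rw [h2, smul_smul]
    simp

theorem span_range_pcL : Submodule.span ℂ (Set.range (pcL m d)) = ⊤ := by
  rw [eq_top_iff]
  rintro q -
  obtain ⟨t, t', rfl⟩ := exists_pc_add_pc q
  exact Submodule.add_mem _ (Submodule.subset_span ⟨t, rfl⟩)
    (Submodule.smul_mem _ _ (Submodule.subset_span ⟨t', rfl⟩))

theorem eventually_eq_zero_of_antidiagonal {G : Type} [NormedAddCommGroup G] [NormedSpace ℂ G]
    [CompleteSpace G] {p : CSpace m d} {F : CSpace m d × CSpace m d → G}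
    (hF : AnalyticAt ℂ F (pc p)) (h0 : ∀ᶠ t in 𝓝 p, F (pc t) = 0) : ∀ᶠ x in 𝓝 (pc p), F x = 0 :=
  eventually_eq_zero_of_totallyReal (β := pcL m d)
    (Eventually.of_forall fun _ => ⟨pcL m d, (pcL m d).hasFDerivAt, span_range_pcL⟩) hF h0

end TotallyReal

/-! ### Holomorphic extension of real analytic germs -/

section Complexification

/-- Extension of a real analytic germ to a holomorphic germ. -/
theorem exists_holomorphic_extension {E W F : Type} [NormedAddCommGroup E] [NormedSpace ℝ E]
    [NormedAddCommGroup W] [NormedSpace ℂ W] [NormedAddCommGroup F] [NormedSpace ℂ F]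
    [CompleteSpace F] {N : ℕ} (b : Module.Basis (Fin N) ℝ E) (ν : E →L[ℝ] W)
    (ℓ : Fin N → W →L[ℂ] ℂ) (hℓ : ∀ i x, ℓ i (ν x) = (b.repr x i : ℂ)) {f : E → F} {p : E}
    (hf : AnalyticAt ℝ f p) :
    ∃ g : W → F, AnalyticAt ℂ g (ν p) ∧ ∀ᶠ x in 𝓝 p, g (ν x) = f x := by
  obtain ⟨P, r, hP⟩ := hf
  -- Expand each term in real coordinates and replace the coordinates by the functionals `ℓ i`,
  -- which extend them holomorphically. The sum over `N ^ k` multi-indices costs only a factor `(N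
  -- C) ^ k`, so the radius stays positive.
  let Q : FormalMultilinearSeries ℂ W F := fun k => ∑ α : Fin k → Fin N,
    ((ContinuousMultilinearMap.mkPiAlgebra ℂ (Fin k) ℂ).compContinuousLinearMap
      (fun i => ℓ (α i))).smulRight (P k fun i => b (α i))
  have hQ : ∀ k w, Q k w = ∑ α : Fin k → Fin N, (∏ i, ℓ (α i) (w i)) • (P k fun i => b (α i)) := by
    intro k w
    simp [Q]
  obtain ⟨C, hC0, hC⟩ : ∃ C : ℝ, 0 ≤ C ∧ ∀ i, ‖ℓ i‖ * ‖b i‖ ≤ C :=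
    ⟨∑ i, ‖ℓ i‖ * ‖b i‖, by positivity, fun i =>
      Finset.single_le_sum (f := fun i => ‖ℓ i‖ * ‖b i‖) (fun _ _ => by positivity)
        (Finset.mem_univ i)⟩
  have hQn : ∀ k, ‖Q k‖ ≤ (N * C) ^ k * ‖P k‖ := by
    intro k
    refine ContinuousMultilinearMap.opNorm_le_bound (by positivity) fun w => ?_
    rw [hQ]
    refine (norm_sum_le _ _).trans ?_
    have h1 : ∀ α : Fin k → Fin N, ‖(∏ i, ℓ (α i) (w i)) • (P k fun i => b (α i))‖ ≤
        C ^ k * ‖P k‖ * ∏ i, ‖w i‖ := by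
      intro α
      rw [norm_smul, norm_prod]
      calc (∏ i, ‖ℓ (α i) (w i)‖) * ‖P k fun i => b (α i)‖
          ≤ (∏ i, ‖ℓ (α i)‖ * ‖w i‖) * (‖P k‖ * ∏ i, ‖b (α i)‖) := by
            gcongr with i
            · exact (ℓ (α i)).le_opNorm _
            · exact (P k).le_opNorm _
        _ = (∏ i, ‖ℓ (α i)‖ * ‖b (α i)‖) * ‖P k‖ * ∏ i, ‖w i‖ := by
            simp only [Finset.prod_mul_distrib]; ring
        _ ≤ (∏ _i : Fin k, C) * ‖P k‖ * ∏ i, ‖w i‖ := by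
            gcongr with i
            exact hC _
        _ = _ := by simp
    refine (Finset.sum_le_sum fun α _ => h1 α).trans ?_
    simp only [Finset.sum_const, Finset.card_univ, Fintype.card_pi, Fintype.card_fin,
      Finset.prod_const, nsmul_eq_mul]
    push_cast
    rw [mul_pow]
    apply le_of_eq
    ring
  have hrad : 0 < Q.radius := by
    have hPr : 0 < P.radius := hP.r_pos.trans_le hP.r_le
    obtain ⟨s, hs0, hs⟩ := ENNReal.lt_iff_exists_nnreal_btwn.1 hPr
    obtain ⟨D, _, hD⟩ := P.norm_mul_pow_le_of_lt_radius hs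
    have hs0' : 0 < s := by exact_mod_cast hs0
    let M : NNReal := ⟨N * C + 1, by positivity⟩
    have hM : (0 : ℝ) < M := by show (0 : ℝ) < N * C + 1; positivity
    have hM' : N * C ≤ (M : ℝ) := by show N * C ≤ N * C + 1; linarith
    have h1 : ((s / M : NNReal) : ENNReal) ≤ Q.radius := by
      refine Q.le_radius_of_bound D fun k => ?_
      calc ‖Q k‖ * ((s / M : NNReal) : ℝ) ^ k ≤ ((M : ℝ) ^ k * ‖P k‖) * ((s / M : NNReal) : ℝ) ^ k := by
            gcongr
            exact (hQn k).trans (by gcongr)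
        _ = ‖P k‖ * (s : ℝ) ^ k := by
            rw [NNReal.coe_div, div_pow]
            field_simp
        _ ≤ D := hD k
    refine lt_of_lt_of_le ?_ h1
    have : 0 < s / M := div_pos hs0' (by exact_mod_cast hM)
    exact_mod_cast this
  refine ⟨fun w => Q.sum (w - ν p), ?_, ?_⟩
  · refine AnalyticAt.comp (g := Q.sum) (f := fun w => w - ν p) ?_ (analyticAt_id.sub analyticAt_const)
    rw [sub_self]
    exact (Q.hasFPowerSeriesOnBall hrad).analyticAt
  · have h1 : ∀ᶠ x in 𝓝 p, x - p ∈ Metric.eball (0 : E) r := by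
      have : ContinuousAt (fun x => x - p) p := by fun_prop
      refine this.eventually ?_
      simp only [sub_self]
      exact Metric.eball_mem_nhds _ hP.r_pos
    have h2 : ∀ᶠ x in 𝓝 p, ν x - ν p ∈ Metric.eball (0 : W) Q.radius := by
      have : ContinuousAt (fun x => ν x - ν p) p := by fun_prop
      refine this.eventually ?_
      simp only [sub_self]
      exact Metric.eball_mem_nhds _ hrad
    filter_upwards [h1, h2] with x hx1 hx2
    have h3 := Q.hasSum hx2
    have h4 := hP.hasSum hx1
    rw [add_sub_cancel] at h4
    refine h3.unique ?_
    convert h4 using 2 with k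
    rw [hQ]
    have h5 : x - p = ∑ i, b.repr (x - p) i • b i := (b.sum_repr _).symm
    conv_rhs => rw [h5]
    have h6 := (P k).toMultilinearMap.map_sum (fun (_ : Fin k) i => b.repr (x - p) i • b i)
    simp only [ContinuousMultilinearMap.coe_coe] at h6
    rw [h6]
    refine Finset.sum_congr rfl fun α _ => ?_
    have h7 := (P k).map_smul_univ (fun i => b.repr (x - p) (α i)) (fun i => b (α i))
    rw [h7, ← map_sub]
    simp only [hℓ]
    rw [← Complex.ofReal_prod, Complex.coe_smul]

variable {m d : ℕ}

/-- Write the real form as the real part of a complex linear `Λ`; the extension is `(Λ t + conj (Λ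
τ̄)) / 2`. -/
theorem exists_extension_functional (l : CSpace m d →ₗ[ℝ] ℝ) :
    ∃ ℓ : CSpace m d × CSpace m d →L[ℂ] ℂ, ∀ t, ℓ (pc t) = l t := by
  let Λ : CSpace m d →ₗ[ℂ] ℂ := Module.Dual.extendRCLike l
  have hΛ : ∀ t, (Λ t).re = l t := fun t => by
    have h := Module.Dual.re_extendRCLike_apply (𝕜 := ℂ) l t
    rwa [RCLike.re_eq_complex_re] at h
  let ℓ : CSpace m d × CSpace m d →ₗ[ℂ] ℂ :=
    { toFun := fun q => (1 / 2 : ℂ) * (Λ q.1 + star (Λ (star q.2)))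
      map_add' := fun q q' => by simp only [Prod.fst_add, Prod.snd_add, map_add, star_add]; ring
      map_smul' := fun c q => by
        simp only [Prod.smul_fst, Prod.smul_snd, map_smul, star_smul, star_mul', smul_eq_mul,
          star_star, RingHom.id_apply]
        ring }
  refine ⟨LinearMap.toContinuousLinearMap ℓ, fun t => ?_⟩
  show (1 / 2 : ℂ) * (Λ t + star (Λ (star (star t)))) = _
  rw [star_star, ← hΛ t]
  have := Complex.add_conj (Λ t)
  simp only [RCLike.star_def]
  rw [this]
  push_cast
  ring

/-- Complexification of a real analytic germ. -/
theorem exists_complexification {F : Type} [NormedAddCommGroup F] [NormedSpace ℂ F]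
    [CompleteSpace F] {f : CSpace m d → F} {p : CSpace m d} (hf : AnalyticAt ℝ f p) :
    ∃ g : CSpace m d × CSpace m d → F, AnalyticAt ℂ g (pc p) ∧ ∀ᶠ t in 𝓝 p, g (pc t) = f t := by
  let b := Module.finBasis ℝ (CSpace m d)
  choose ℓ hℓ using fun i => exists_extension_functional (b.coord i)
  exact exists_holomorphic_extension b (pcL m d) ℓ hℓ hf

end Complexification

/-! ### Conjugation of holomorphic maps -/

section Conjugation

/-- Composition of an analytic map with antilinear maps on both sides. -/
theorem analyticAt_antilinear_comp {E E' F F' : Type} [NormedAddCommGroup E] [NormedSpace ℂ E]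
    [NormedAddCommGroup E'] [NormedSpace ℂ E'] [NormedAddCommGroup F] [NormedSpace ℂ F]
    [NormedAddCommGroup F'] [NormedSpace ℂ F'] {I : E →L[ℝ] E'} {J : F →L[ℝ] F'}
    (hI : ∀ (c : ℂ) x, I (c • x) = star c • I x) (hJ : ∀ (c : ℂ) x, J (c • x) = star c • J x)
    {f : E' → F} {x : E} (hf : AnalyticAt ℂ f (I x)) :
    AnalyticAt ℂ (fun y => J (f (I y))) x := by
  obtain ⟨P, r, hP⟩ := hf
  let Q : FormalMultilinearSeries ℂ E F' := fun n =>
    { toFun := fun v => J (P n (fun i => I (v i)))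
      map_update_add' := fun v i x y => by
        have h : ∀ z, (fun j => I (Function.update v i z j)) =
            Function.update (fun j => I (v j)) i (I z) := fun z => by
          ext j
          by_cases hj : j = i
          · subst hj; simp
          · simp [hj]
        rw [h, h, h, map_add, (P n).map_update_add, map_add]
      map_update_smul' := fun v i c x => by
        have h : ∀ z, (fun j => I (Function.update v i z j)) =
            Function.update (fun j => I (v j)) i (I z) := fun z => by
          ext j
          by_cases hj : j = i
          · subst hj; simp
          · simp [hj]
        rw [h, h, hI, (P n).map_update_smul, hJ, star_star]
      cont := by fun_prop }
  -- Convergence is inherited from the real power series of `J ∘ f ∘ I`: two antilinear compositions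
  -- cancel, so its terms are complex multilinear, and their norm does not depend on the scalars.
  have h1 := (J.comp_hasFPowerSeriesOnBall hP.restrictScalars).compContinuousLinearMap (u := I)
  refine ⟨Q, _, h1.r_le.trans (FormalMultilinearSeries.radius_le_of_le fun n => ?_), h1.r_pos,
    fun {y} hy => h1.hasSum hy⟩
  refine ContinuousMultilinearMap.opNorm_le_bound (norm_nonneg _) fun v => ?_
  exact ContinuousMultilinearMap.le_opNorm
    (((J.compFormalMultilinearSeries (P.restrictScalars ℝ)).compContinuousLinearMap I) n) v

variable {m d : ℕ}

/-- The involution `σ`, as a real linear map. -/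
noncomputable def sigmaL (m d : ℕ) : CSpace m d × CSpace m d →L[ℝ] CSpace m d × CSpace m d :=
  ((starL' ℝ : CSpace m d ≃L[ℝ] CSpace m d).toContinuousLinearMap.comp
    (ContinuousLinearMap.snd ℝ _ _)).prod
    ((starL' ℝ : CSpace m d ≃L[ℝ] CSpace m d).toContinuousLinearMap.comp
    (ContinuousLinearMap.fst ℝ _ _))

theorem sigmaL_apply (q : CSpace m d × CSpace m d) : sigmaL m d q = sigma q := rfl

theorem sigma_sigma (q : CSpace m d × CSpace m d) : sigma (sigma q) = q := by
  simp [sigma]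

theorem sigma_pc (t : CSpace m d) : sigma (pc t) = pc t := by
  simp [sigma, pc]

theorem sigma_smul (c : ℂ) (q : CSpace m d × CSpace m d) : sigma (c • q) = star c • sigma q :=
  Prod.ext (star_smul c q.2) (star_smul c q.1)

theorem sigma_add (q q' : CSpace m d × CSpace m d) : sigma (q + q') = sigma q + sigma q' :=
  (sigmaL m d).map_add q q'

theorem sigma_sub (q q' : CSpace m d × CSpace m d) : sigma (q - q') = sigma q - sigma q' :=
  (sigmaL m d).map_sub q q'

theorem exists_pc_of_sigma_eq {q : CSpace m d × CSpace m d} (h : sigma q = q) : pc q.1 = q :=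
  Prod.ext rfl (show star q.1 = q.2 from congrArg Prod.snd h)

theorem analyticAt_sigma_conj {f : CSpace m d × CSpace m d → CSpace m d × CSpace m d}
    {q : CSpace m d × CSpace m d} (hf : AnalyticAt ℂ f (sigma q)) :
    AnalyticAt ℂ (fun x => sigma (f (sigma x))) q :=
  analyticAt_antilinear_comp (I := sigmaL m d) (J := sigmaL m d) sigma_smul sigma_smul hf

theorem analyticAt_conjCoeff {Θ : (Fin m → ℂ) × CSpace m d → Fin d → ℂ}
    {x : (Fin m → ℂ) × CSpace m d} (h : AnalyticAt ℂ Θ (star x)) :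
    AnalyticAt ℂ (conjCoeff Θ) x :=
  analyticAt_antilinear_comp
    (I := (starL' ℝ : ((Fin m → ℂ) × CSpace m d) ≃L[ℝ] ((Fin m → ℂ) × CSpace m d)).toContinuousLinearMap)
    (J := (starL' ℝ : (Fin d → ℂ) ≃L[ℝ] (Fin d → ℂ)).toContinuousLinearMap)
    (fun c x => star_smul c x) (fun c x => star_smul c x) h

theorem fderiv_conjCoeff {Θ : (Fin m → ℂ) × CSpace m d → Fin d → ℂ}
    {x : (Fin m → ℂ) × CSpace m d} (h : AnalyticAt ℂ Θ x) (v : (Fin m → ℂ) × CSpace m d) :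
    fderiv ℂ (conjCoeff Θ) (star x) v = star (fderiv ℂ Θ x (star v)) := by
  have h1 := h.differentiableAt.hasFDerivAt.star_star
  have h2 : fderiv ℂ (conjCoeff Θ) (star x) = _ := h1.fderiv
  rw [h2]
  rfl

end Conjugation

/-! ### The graph, its complex equations and the reflection identities -/

section Graph

variable {m d : ℕ}

/-- The coordinates `(x, y, u)` of a point of `ℂⁿ`. -/
noncomputable def realCoord (m d : ℕ) : CSpace m d →L[ℝ] RSpace m d :=
  LinearMap.toContinuousLinearMap
    { toFun := fun t => (fun k => (t.1 k).re, fun k => (t.1 k).im, fun j => (t.2 j).re)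
      map_add' := fun _ _ => rfl
      map_smul' := fun c t => by
        refine Prod.ext ?_ (Prod.ext ?_ ?_) <;> ext <;> simp }

theorem realCoord_apply (t : CSpace m d) :
    realCoord m d t = (fun k => (t.1 k).re, fun k => (t.1 k).im, fun j => (t.2 j).re) := rfl

/-- The linear map `(x, y, u) ↦ (x + i y, u)`. -/
noncomputable def complexCoord (m d : ℕ) : RSpace m d →L[ℝ] CSpace m d :=
  LinearMap.toContinuousLinearMap
    { toFun := fun q => (fun k => (q.1 k : ℂ) + Complex.I * (q.2.1 k : ℂ), fun j => (q.2.2 j : ℂ))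
      map_add' := fun q q' => by
        refine Prod.ext ?_ ?_ <;> ext <;> simp <;> ring
      map_smul' := fun c q => by
        refine Prod.ext ?_ ?_ <;> ext <;> simp <;> ring }

/-- The linear map `v ↦ (0, i v)`. -/
noncomputable def imagCoord (m d : ℕ) : (Fin d → ℝ) →L[ℝ] CSpace m d :=
  LinearMap.toContinuousLinearMap
    { toFun := fun v => (0, fun j => Complex.I * (v j : ℂ))
      map_add' := fun q q' => by
        refine Prod.ext ?_ ?_ <;> ext <;> simp <;> ring
      map_smul' := fun c q => by
        refine Prod.ext ?_ ?_ <;> ext <;> simp <;> ring }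

theorem graphMap_eq (φ : RSpace m d → Fin d → ℝ) (q : RSpace m d) :
    graphMap φ q = complexCoord m d q + imagCoord m d (φ q) := by
  refine Prod.ext ?_ ?_
  · exact (add_zero _).symm
  · rfl

theorem hasFDerivAt_graphMap {φ : RSpace m d → Fin d → ℝ} {q : RSpace m d}
    (h : DifferentiableAt ℝ φ q) :
    HasFDerivAt (graphMap φ) (complexCoord m d + (imagCoord m d).comp (fderiv ℝ φ q)) q := by
  have : graphMap φ = fun q => complexCoord m d q + imagCoord m d (φ q) := funext (graphMap_eq φ)
  rw [this]
  exact (complexCoord m d).hasFDerivAt.add ((imagCoord m d).hasFDerivAt.comp q h.hasFDerivAt)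

theorem analyticAt_graphMap {φ : RSpace m d → Fin d → ℝ} {q : RSpace m d}
    (h : AnalyticAt ℝ φ q) : AnalyticAt ℝ (graphMap φ) q := by
  have : graphMap φ = fun q => complexCoord m d q + imagCoord m d (φ q) := funext (graphMap_eq φ)
  rw [this]
  exact ((complexCoord m d).analyticAt q).add (((imagCoord m d).analyticAt _).comp h)

/-- The map `(z, w) ↦ (z̄, z, w)`. -/
noncomputable def barL (m d : ℕ) : CSpace m d →L[ℝ] (Fin m → ℂ) × CSpace m d :=
  ((starL' ℝ : (Fin m → ℂ) ≃L[ℝ] (Fin m → ℂ)).toContinuousLinearMap.comp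
    (ContinuousLinearMap.fst ℝ _ _)).prod (ContinuousLinearMap.id ℝ (CSpace m d))

theorem barL_apply (t : CSpace m d) : barL m d t = (star t.1, t) := rfl

namespace LocalGenericSubmanifold

variable {M : LocalGenericSubmanifold m d} {Θ : (Fin m → ℂ) × CSpace m d → Fin d → ℂ}

theorem graphMap_mem_carrier {q : RSpace m d} (h : graphMap M.φ q ∈ ball 0 M.radius) :
    graphMap M.φ q ∈ M.carrier := by
  refine ⟨h, fun j => ?_⟩
  simp [graphMap]

theorem graphMap_realCoord {t : CSpace m d} (h : t ∈ M.carrier) :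
    graphMap M.φ (realCoord m d t) = t := by
  refine Prod.ext ?_ ?_ <;> ext j
  · simp [graphMap, realCoord_apply, mul_comm Complex.I]
  · have := h.2 j
    simp only [graphMap, realCoord_apply]
    rw [← this, mul_comm, Complex.re_add_im]

theorem graphMap_zero : graphMap M.φ 0 = 0 := by
  refine Prod.ext ?_ ?_ <;> ext j <;> simp [graphMap, M.zero]

theorem zero_mem_carrier : (0 : CSpace m d) ∈ M.carrier := by
  have := graphMap_mem_carrier (M := M) (q := 0) (by rw [graphMap_zero]; exact mem_ball_self M.radius_pos)
  rwa [graphMap_zero] at this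

theorem analyticAt_zero : AnalyticAt ℝ M.φ 0 :=
  M.analytic 0 (mem_ball_self (by linarith [M.radius_pos]))

theorem eventually_graphMap_mem : ∀ᶠ q in 𝓝 (0 : RSpace m d), graphMap M.φ q ∈ M.carrier := by
  have h := (analyticAt_graphMap (analyticAt_zero (M := M))).continuousAt.tendsto
  rw [graphMap_zero] at h
  exact (h.eventually (ball_mem_nhds 0 M.radius_pos)).mono fun q hq => graphMap_mem_carrier hq

namespace IsComplexDefining

theorem analyticAt_zero (h : M.IsComplexDefining Θ) : AnalyticAt ℂ Θ 0 :=
  h.1 0 (mem_ball_self (by linarith [M.radius_pos]))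

theorem apply_graphMap (h : M.IsComplexDefining Θ) {q : RSpace m d}
    (hq : graphMap M.φ q ∈ M.carrier) :
    Θ (barL m d (graphMap M.φ q)) = star (graphMap M.φ q).2 :=
  ((h.2 _ hq.1).1 hq).symm

theorem apply_zero (h : M.IsComplexDefining Θ) : Θ 0 = 0 := by
  have := (h.2 0 (zero_mem_carrier (M := M)).1).1 zero_mem_carrier
  rw [Prod.fst_zero, Prod.snd_zero, star_zero, star_zero] at this
  exact this.symm

/-- The parametrization of the submanifold `{(z̄, z, w) : (z, w) ∈ M}` is generic. -/
theorem span_eq_top (h : M.IsComplexDefining Θ) : ∀ᶠ q in 𝓝 (0 : RSpace m d),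
    ∃ β' : RSpace m d →L[ℝ] (Fin m → ℂ) × CSpace m d, HasFDerivAt (fun q => barL m d (graphMap M.φ q)) β' q ∧
      Submodule.span ℂ (Set.range β') = ⊤ := by
  have h0 : Tendsto (fun q => barL m d (graphMap M.φ q)) (𝓝 0) (𝓝 0) := by
    have h1 := (barL m d).continuous.continuousAt.tendsto.comp
      (analyticAt_graphMap (LocalGenericSubmanifold.analyticAt_zero (M := M))).continuousAt.tendsto
    rw [graphMap_zero, map_zero] at h1
    exact h1
  filter_upwards [(LocalGenericSubmanifold.analyticAt_zero (M := M)).eventually_analyticAt,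
    h0.eventually h.analyticAt_zero.eventually_analyticAt,
    (eventually_graphMap_mem (M := M)).eventually_nhds] with q hφ hΘ hM
  have hg := hasFDerivAt_graphMap hφ.differentiableAt
  have hβ := (barL m d).hasFDerivAt.comp q hg
  refine ⟨_, hβ, ?_⟩
  set φ' := fderiv ℝ M.φ q
  set L := complexCoord m d + (imagCoord m d).comp φ'
  -- the differential of the identity `Θ(z̄, z, w) = w̄` on `M`
  set Θ' := fderiv ℂ Θ (barL m d (graphMap M.φ q))
  -- Applied to the `u`-directions, this relates `∂Θ/∂w` to the matrix `I + i φ_u` and makes that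
  -- matrix invertible.
  have hid : ∀ v, Θ' (barL m d (L v)) = star (L v).2 := by
    have h1 : HasFDerivAt (fun q => Θ (barL m d (graphMap M.φ q)))
        ((Θ'.restrictScalars ℝ).comp ((barL m d).comp L)) q :=
      (hΘ.differentiableAt.hasFDerivAt.restrictScalars ℝ).comp q hβ
    have h2 : HasFDerivAt (fun q => star (graphMap M.φ q).2)
        ((starL' ℝ : (Fin d → ℂ) ≃L[ℝ] (Fin d → ℂ)).toContinuousLinearMap.comp
          ((ContinuousLinearMap.snd ℝ _ _).comp L)) q :=
      ((starL' ℝ : (Fin d → ℂ) ≃L[ℝ] (Fin d → ℂ)).toContinuousLinearMap.hasFDerivAt).comp q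
        ((ContinuousLinearMap.snd ℝ (Fin m → ℂ) (Fin d → ℂ)).hasFDerivAt.comp q hg)
    have h3 := (h2.congr_of_eventuallyEq (hM.mono fun x hx => h.apply_graphMap hx)).unique h1
    exact fun v => (congrArg (fun A => A v) h3).symm
  set W := Submodule.span ℂ (Set.range ((barL m d).comp L))
  have hW : ∀ v, barL m d (L v) ∈ W := fun v => Submodule.subset_span ⟨v, rfl⟩
  let e : Fin d → RSpace m d := fun j => (0, 0, Pi.single j 1)
  have he1 : ∀ j, (L (e j)).1 = 0 := fun j => by
    ext k
    simp [L, complexCoord, imagCoord, e]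
  have he2 : ∀ j, (L (e j)).2 + star (L (e j)).2 = (2 : ℂ) • Pi.single j 1 := fun j => by
    ext k
    simp only [L, complexCoord, imagCoord, e]
    by_cases hk : k = j
    · subst hk
      simp
      ring
    · simp [hk]
  let T : (Fin d → ℂ) →ₗ[ℂ] (Fin d → ℂ) :=
    (Pi.basisFun ℂ (Fin d)).constr ℂ fun j => (L (e j)).2
  have hT : ∀ j, T (Pi.single j 1) = (L (e j)).2 := fun j => by
    have := (Pi.basisFun ℂ (Fin d)).constr_basis ℂ (fun j => (L (e j)).2) j
    rwa [Pi.basisFun_apply] at this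
  -- The columns of `T` are `e_j + i φ_{u_j}`, and `∂Θ/∂w` sends each to its conjugate. Adding the
  -- column gives `2 e_j`, so `B = (∂Θ/∂w + id) / 2` inverts `T`; hence all `(0, 0, w)` lie in the
  -- span.
  let B : (Fin d → ℂ) →ₗ[ℂ] (Fin d → ℂ) :=
    (1 / 2 : ℂ) • ((Θ' : _ →ₗ[ℂ] _).comp
      ((LinearMap.inr ℂ (Fin m → ℂ) (CSpace m d)).comp (LinearMap.inr ℂ (Fin m → ℂ) (Fin d → ℂ)))
        + LinearMap.id)
  have hBT : B.comp T = LinearMap.id := by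
    refine (Pi.basisFun ℂ (Fin d)).ext fun j => ?_
    rw [Pi.basisFun_apply, LinearMap.comp_apply, hT]
    have h1 : Θ' (0, (0, (L (e j)).2)) = star (L (e j)).2 := by
      rw [← hid, barL_apply]
      congr 1
      refine Prod.ext ?_ (Prod.ext ?_ rfl)
      · simp [he1]
      · exact (he1 j).symm
    show (1 / 2 : ℂ) • (Θ' (0, (0, (L (e j)).2)) + (L (e j)).2) = _
    rw [h1, add_comm, he2, smul_smul]
    simp
  have hTs : Function.Surjective T := by
    rw [← LinearMap.injective_iff_surjective]
    exact Function.LeftInverse.injective (g := B) fun x => congrArg (fun A => A x) hBT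
  have hw : ∀ w : Fin d → ℂ, ((0, (0, w)) : (Fin m → ℂ) × CSpace m d) ∈ W := by
    intro w
    obtain ⟨c, rfl⟩ := hTs w
    have h1 : ((0, (0, T c)) : (Fin m → ℂ) × CSpace m d) = ∑ j, c j • barL m d (L (e j)) := by
      have h2 : T c = ∑ j, c j • (L (e j)).2 := by
        conv_lhs => rw [← (Pi.basisFun ℂ (Fin d)).sum_repr c]
        rw [map_sum]
        refine Finset.sum_congr rfl fun j _ => ?_
        rw [map_smul, Pi.basisFun_apply, hT, Pi.basisFun_repr]
      have h3 : ∀ j, c j • barL m d (L (e j)) =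
          ((0, (0, c j • (L (e j)).2)) : (Fin m → ℂ) × CSpace m d) := fun j => by
        rw [barL_apply]
        refine Prod.ext ?_ (Prod.ext ?_ rfl)
        · simp [he1]
        · simp [he1]
      rw [h2]
      simp only [h3]
      refine Prod.ext ?_ (Prod.ext ?_ ?_) <;>
        simp [Prod.fst_sum, Prod.snd_sum]
    rw [h1]
    exact W.sum_mem fun j _ => W.smul_mem _ (hW _)
  rw [eq_top_iff]
  rintro ⟨ζ, z, w⟩ -
  -- Solve `A + i D = z`, `A - i D = ζ` for the complexified `x` and `y`; `v₁` and `v₂` are the real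
  -- and imaginary parts of the solution. The leftover `w`-component was just shown to be in the
  -- span.
  let A : Fin m → ℂ := fun k => (ζ k + z k) / 2
  let D : Fin m → ℂ := fun k => (z k - ζ k) / (2 * Complex.I)
  let v₁ : RSpace m d := (fun k => (A k).re, fun k => (D k).re, 0)
  let v₂ : RSpace m d := (fun k => (A k).im, fun k => (D k).im, 0)
  have hL1 : ∀ v : RSpace m d, (L v).1 = fun k => (v.1 k : ℂ) + Complex.I * (v.2.1 k : ℂ) :=
    fun v => by
      ext k
      simp [L, complexCoord, imagCoord]
  have hA : ∀ k, A k + Complex.I * D k = z k := fun k => by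
    simp only [A, D]; field_simp; ring
  have hD : ∀ k, A k - Complex.I * D k = ζ k := fun k => by
    simp only [A, D]; field_simp; ring
  have hsum : ((ζ, z, w) : (Fin m → ℂ) × CSpace m d) =
      barL m d (L v₁) + Complex.I • barL m d (L v₂) +
        (0, 0, w - (L v₁).2 - Complex.I • (L v₂).2) := by
    refine Prod.ext ?_ (Prod.ext ?_ ?_)
    · ext k
      show ζ k = _
      rw [← hD k]
      nth_rewrite 1 [← Complex.re_add_im (A k), ← Complex.re_add_im (D k)]
      simp only [barL_apply, Prod.fst_add, Prod.smul_fst, Pi.add_apply, Pi.smul_apply, hL1,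
        Pi.star_apply, star_add, star_mul', RCLike.star_def, Complex.conj_I, Complex.conj_ofReal,
        smul_eq_mul, v₁, v₂, Pi.zero_apply]
      simp only [add_zero]
      ring
    · ext k
      show z k = _
      rw [← hA k]
      nth_rewrite 1 [← Complex.re_add_im (A k), ← Complex.re_add_im (D k)]
      simp only [barL_apply, Prod.fst_add, Prod.snd_add, Prod.smul_fst, Prod.smul_snd, Pi.add_apply,
        Pi.smul_apply, hL1, smul_eq_mul, v₁, v₂, Pi.zero_apply]
      ring
    · simp only [barL_apply, Prod.snd_add, Prod.smul_snd]
      abel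
  rw [hsum]
  exact W.add_mem (W.add_mem (hW _) (W.smul_mem _ (hW _))) (hw _)

theorem eventually_eq_zero_of_graph (h : M.IsComplexDefining Θ) {G : Type} [NormedAddCommGroup G]
    [NormedSpace ℂ G] [CompleteSpace G] {F : (Fin m → ℂ) × CSpace m d → G} (hF : AnalyticAt ℂ F 0)
    (h0 : ∀ᶠ q in 𝓝 (0 : RSpace m d), F (barL m d (graphMap M.φ q)) = 0) :
    ∀ᶠ x in 𝓝 0, F x = 0 := by
  have h1 : barL m d (graphMap M.φ 0) = 0 := by rw [graphMap_zero, map_zero]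
  have := eventually_eq_zero_of_totallyReal (β := fun q => barL m d (graphMap M.φ q)) (v₀ := 0)
    (F := F) h.span_eq_top (by rwa [h1]) h0
  rwa [h1] at this

/-- `Θ̄(z, ζ, Θ(ζ, z, w)) = w`. -/
theorem conj_apply (h : M.IsComplexDefining Θ) :
    ∀ᶠ x in 𝓝 (0 : (Fin m → ℂ) × CSpace m d), conjCoeff Θ (x.2.1, (x.1, Θ x)) = x.2.2 := by
  have hΘ := h.analyticAt_zero
  have hc : AnalyticAt ℂ (conjCoeff Θ) 0 := analyticAt_conjCoeff (by rwa [star_zero])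
  have hF : AnalyticAt ℂ (fun x : (Fin m → ℂ) × CSpace m d =>
      conjCoeff Θ (x.2.1, (x.1, Θ x)) - x.2.2) 0 := by
    have h1 : AnalyticAt ℂ (fun x : (Fin m → ℂ) × CSpace m d => (x.2.1, (x.1, Θ x))) 0 :=
      (analyticAt_fst.comp analyticAt_snd).prod (analyticAt_fst.prod hΘ)
    refine AnalyticAt.sub ?_ (analyticAt_snd.comp analyticAt_snd)
    refine AnalyticAt.fun_comp (g := conjCoeff Θ) ?_ h1
    rw [h.apply_zero]
    exact hc
  refine (h.eventually_eq_zero_of_graph hF ?_).mono fun x hx => sub_eq_zero.1 hx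
  filter_upwards [eventually_graphMap_mem (M := M)] with q hq
  rw [sub_eq_zero, h.apply_graphMap hq]
  have h2 := h.apply_graphMap hq
  simp only [barL_apply, conjCoeff] at h2 ⊢
  have h3 : star ((graphMap M.φ q).1, star (graphMap M.φ q).1, star (graphMap M.φ q).2) =
      (star (graphMap M.φ q).1, graphMap M.φ q) :=
    Prod.ext rfl (Prod.ext (star_star _) (star_star _))
  rw [h3, h2, star_star]

/-- `Θ(ζ, z, Θ̄(z, ζ, ξ)) = ξ`. -/
theorem apply_conj (h : M.IsComplexDefining Θ) :
    ∀ᶠ x in 𝓝 (0 : (Fin m → ℂ) × CSpace m d), Θ (x.2.1, (x.1, conjCoeff Θ x)) = x.2.2 := by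
  have h1 : Tendsto (star : (Fin m → ℂ) × CSpace m d → _) (𝓝 0) (𝓝 0) := by
    have := (continuous_star (R := (Fin m → ℂ) × CSpace m d)).tendsto 0
    rwa [star_zero] at this
  filter_upwards [h1.eventually h.conj_apply] with x hx
  have h2 := congrArg star hx
  simp only [conjCoeff] at h2 ⊢
  rw [star_star] at h2
  have h3 : star ((star x).2.1, (star x).1, Θ (star x)) = (x.2.1, (x.1, star (Θ (star x)))) :=
    Prod.ext (star_star _) (Prod.ext (star_star _) rfl)
  rw [h3] at h2
  exact h2.trans (star_star _)

end IsComplexDefining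

end LocalGenericSubmanifold

end Graph

/-- Differentiate `R (Φ (x, s)) = Φ (x, s)` at `s = 0`; the flow preserves `A`, which is locally the
fixed point set of `R`. -/
theorem IsFlowSystem.isTangentTo {𝕂 : Type} [RCLike 𝕂] {E : Type} [NormedAddCommGroup E]
    [NormedSpace 𝕂 E] [CompleteSpace E] {ι : Type} {X : ι → E → E} {Φ : ι → E × 𝕂 → E} {A : Set E} {p : E}
    (h : IsFlowSystem 𝕂 X Φ A p) {R : E → E} (hR : AnalyticAt 𝕂 R p)
    (hA : ∀ᶠ x in 𝓝 p, x ∈ A ↔ R x = x) (a : ι) : IsTangentTo 𝕂 (X a) R p := by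
  have h1 : Tendsto (fun x : E => (x, (0 : 𝕂))) (𝓝 p) (𝓝 (p, 0)) :=
    (continuous_id.prodMk continuous_const).tendsto p
  have h2 : Tendsto (Φ a) (𝓝 (p, 0)) (𝓝 p) := by
    have := (h.analytic a).continuousAt.tendsto
    rwa [h.apply_base] at this
  have h3 : ∀ᶠ z in 𝓝 (p, (0 : 𝕂)), z.1 ∈ A → R (Φ a z) = Φ a z := by
    filter_upwards [h.mem a, h2.eventually hA] with z hz hz' hA
    exact hz'.1 (hz hA)
  filter_upwards [h1.eventually h3.eventually_nhds, h1.eventually (h.deriv a), h.zero a, hA,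
    hR.eventually_analyticAt] with x h3 h4 h5 h6 h7 h8
  have hx : x ∈ A := h6.2 h8
  simp only [h5] at h4
  have h9 : Tendsto (fun s : 𝕂 => (x, s)) (𝓝 0) (𝓝 (x, 0)) :=
    (continuous_const.prodMk continuous_id).tendsto 0
  have h10 : HasDerivAt (fun s => R (Φ a (x, s))) (fderiv 𝕂 R x (X a x)) 0 := by
    have h11 : HasFDerivAt R (fderiv 𝕂 R x) (Φ a (x, 0)) := by
      rw [h5]; exact h7.differentiableAt.hasFDerivAt
    exact h11.comp_hasDerivAt (0 : 𝕂) h4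
  exact h10.unique (h4.congr_of_eventuallyEq
    ((h9.eventually h3).mono fun s hs => hs hx))

/-! ### Explicit holomorphic flows and the complexified CR fields -/

section Flows

variable {m d : ℕ} {M : LocalGenericSubmanifold m d} {Θ : (Fin m → ℂ) × CSpace m d → Fin d → ℂ}

theorem analyticAt_coeffL (k : Fin m) {q : CSpace m d × CSpace m d}
    (h : AnalyticAt ℂ (conjCoeff Θ) (q.1.1, q.2)) :
    AnalyticAt ℂ (fun q : CSpace m d × CSpace m d => coeffL Θ k q.1 q.2) q := by
  refine analyticAt_const.prod (AnalyticAt.clm_apply' ?_ analyticAt_const)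
  exact AnalyticAt.fun_comp (g := fderiv ℂ (conjCoeff Θ))
    (f := fun q : CSpace m d × CSpace m d => (q.1.1, q.2)) h.fderiv
    ((analyticAt_fst.comp analyticAt_fst).prod analyticAt_snd)

theorem analyticAt_coeffLbar (k : Fin m) {q : CSpace m d × CSpace m d}
    (h : AnalyticAt ℂ Θ (q.2.1, q.1)) :
    AnalyticAt ℂ (fun q : CSpace m d × CSpace m d => coeffLbar Θ k q.1 q.2) q := by
  refine analyticAt_const.prod (AnalyticAt.clm_apply' ?_ analyticAt_const)
  exact AnalyticAt.fun_comp (g := fderiv ℂ Θ)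
    (f := fun q : CSpace m d × CSpace m d => (q.2.1, q.1)) h.fderiv
    ((analyticAt_fst.comp analyticAt_snd).prod analyticAt_fst)

theorem analyticAt_complexField (a : Fin m ⊕ Fin m) {q : CSpace m d × CSpace m d}
    (h : AnalyticAt ℂ Θ (q.2.1, q.1)) (h' : AnalyticAt ℂ (conjCoeff Θ) (q.1.1, q.2)) :
    AnalyticAt ℂ (complexField Θ a) q := by
  cases a with
  | inl k => exact (analyticAt_coeffL k h').prod analyticAt_const
  | inr k => exact analyticAt_const.prod (analyticAt_coeffLbar k h)

/-- The flows of the fields `𝓛_k` and `𝓛̲_k`. -/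
def complexFlow (Θ : (Fin m → ℂ) × CSpace m d → Fin d → ℂ) :
    Fin m ⊕ Fin m → (CSpace m d × CSpace m d) × ℂ → CSpace m d × CSpace m d
  | Sum.inl k => fun x => ((x.1.1.1 + x.2 • Pi.single k 1, x.1.1.2 +
      (conjCoeff Θ (x.1.1.1 + x.2 • Pi.single k 1, x.1.2) - conjCoeff Θ (x.1.1.1, x.1.2))), x.1.2)
  | Sum.inr k => fun x => (x.1.1, (x.1.2.1 + x.2 • Pi.single k 1, x.1.2.2 +
      (Θ (x.1.2.1 + x.2 • Pi.single k 1, x.1.1) - Θ (x.1.2.1, x.1.1))))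

theorem analyticAt_complexFlow (a : Fin m ⊕ Fin m) {q : CSpace m d × CSpace m d}
    (h : AnalyticAt ℂ Θ (q.2.1, q.1)) (h' : AnalyticAt ℂ (conjCoeff Θ) (q.1.1, q.2)) :
    AnalyticAt ℂ (complexFlow Θ a) (q, 0) := by
  have h1 : AnalyticAt ℂ (fun x : (CSpace m d × CSpace m d) × ℂ => x.1.1.1) (q, 0) :=
    analyticAt_fst.comp (analyticAt_fst.comp analyticAt_fst)
  have h2 : AnalyticAt ℂ (fun x : (CSpace m d × CSpace m d) × ℂ => x.1.2.1) (q, 0) :=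
    analyticAt_fst.comp (analyticAt_snd.comp analyticAt_fst)
  have h3 : AnalyticAt ℂ (fun x : (CSpace m d × CSpace m d) × ℂ => x.1.1) (q, 0) :=
    analyticAt_fst.comp analyticAt_fst
  have h4 : AnalyticAt ℂ (fun x : (CSpace m d × CSpace m d) × ℂ => x.1.2) (q, 0) :=
    analyticAt_snd.comp analyticAt_fst
  have h5 : AnalyticAt ℂ (fun x : (CSpace m d × CSpace m d) × ℂ => x.1.1.2) (q, 0) :=
    analyticAt_snd.comp (analyticAt_fst.comp analyticAt_fst)
  have h6 : AnalyticAt ℂ (fun x : (CSpace m d × CSpace m d) × ℂ => x.1.2.2) (q, 0) :=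
    analyticAt_snd.comp (analyticAt_snd.comp analyticAt_fst)
  have hs : ∀ k : Fin m, AnalyticAt ℂ (fun x : (CSpace m d × CSpace m d) × ℂ =>
      x.2 • (Pi.single k 1 : Fin m → ℂ)) (q, 0) := fun k => analyticAt_snd.smul analyticAt_const
  cases a with
  | inl k =>
    refine ((h1.add (hs k)).prod (h5.add (AnalyticAt.sub ?_ ?_))).prod h4
    · exact AnalyticAt.fun_comp (g := conjCoeff Θ) (by simpa using h') ((h1.add (hs k)).prod h4)
    · exact AnalyticAt.fun_comp (g := conjCoeff Θ) (by simpa using h') (h1.prod h4)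
  | inr k =>
    refine h3.prod ((h2.add (hs k)).prod (h6.add (AnalyticAt.sub ?_ ?_)))
    · exact AnalyticAt.fun_comp (g := Θ) (by simpa using h) ((h2.add (hs k)).prod h3)
    · exact AnalyticAt.fun_comp (g := Θ) (by simpa using h) (h2.prod h3)

theorem complexFlow_zero (a : Fin m ⊕ Fin m) (q : CSpace m d × CSpace m d) :
    complexFlow Θ a (q, 0) = q := by
  cases a <;> simp [complexFlow]

/-- The flow translates one coordinate and freezes the conjugate group of variables, so the
increments of `Θ` (or `Θ̄`) cancel exactly, without any smallness. -/
theorem complexFlow_inv (a : Fin m ⊕ Fin m) (x : (CSpace m d × CSpace m d) × ℂ) :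
    complexFlow Θ a (complexFlow Θ a x, -x.2) = x.1 := by
  obtain ⟨⟨⟨z, w⟩, ζ, ξ⟩, s⟩ := x
  cases a <;> simp [complexFlow, add_assoc]

theorem hasDerivAt_complexFlow (a : Fin m ⊕ Fin m) {x : (CSpace m d × CSpace m d) × ℂ}
    (h : AnalyticAt ℂ Θ ((complexFlow Θ a x).2.1, (complexFlow Θ a x).1))
    (h' : AnalyticAt ℂ (conjCoeff Θ) ((complexFlow Θ a x).1.1, (complexFlow Θ a x).2)) :
    HasDerivAt (fun s => complexFlow Θ a (x.1, s)) (complexField Θ a (complexFlow Θ a x)) x.2 := by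
  have hs : ∀ (k : Fin m) (z : Fin m → ℂ),
      HasDerivAt (fun s : ℂ => z + s • (Pi.single k 1 : Fin m → ℂ)) (Pi.single k 1) x.2 :=
    fun k z => by simpa using ((hasDerivAt_id x.2).smul_const (Pi.single k (1 : ℂ))).const_add z
  cases a with
  | inl k =>
    have h1 := h'.differentiableAt.hasFDerivAt.comp_hasDerivAt x.2
      ((hs k x.1.1.1).prodMk (hasDerivAt_const x.2 x.1.2))
    exact ((hs k x.1.1.1).prodMk ((h1.sub_const (conjCoeff Θ (x.1.1.1, x.1.2))).const_add
      x.1.1.2)).prodMk (hasDerivAt_const x.2 x.1.2)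
  | inr k =>
    have h1 := h.differentiableAt.hasFDerivAt.comp_hasDerivAt x.2
      ((hs k x.1.2.1).prodMk (hasDerivAt_const x.2 x.1.1))
    exact (hasDerivAt_const x.2 x.1.1).prodMk ((hs k x.1.2.1).prodMk
      ((h1.sub_const (Θ (x.1.2.1, x.1.1))).const_add x.1.2.2))

/-- The fields of `crField` as fields on `ℂⁿ × ℂⁿ`: half the sum, and the difference divided by
`2i`, of the fields `𝓛_k` and `𝓛̲_k`. -/
noncomputable def realField (Θ : (Fin m → ℂ) × CSpace m d → Fin d → ℂ) :
    Fin m ⊕ Fin m → CSpace m d × CSpace m d → CSpace m d × CSpace m d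
  | Sum.inl k => fun q =>
      (1 / 2 : ℂ) • (complexField Θ (Sum.inl k) q + complexField Θ (Sum.inr k) q)
  | Sum.inr k => fun q =>
      (1 / (2 * Complex.I) : ℂ) • (complexField Θ (Sum.inl k) q - complexField Θ (Sum.inr k) q)

theorem complexField_inl (k : Fin m) (q : CSpace m d × CSpace m d) :
    complexField Θ (Sum.inl k) q =
      realField Θ (Sum.inl k) q + Complex.I • realField Θ (Sum.inr k) q := by
  have h : Complex.I * (1 / (2 * Complex.I)) = 1 / 2 := by field_simp
  simp only [realField, smul_smul, h]
  rw [← smul_add, add_add_sub_cancel, ← two_smul ℂ, smul_smul]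
  simp

theorem complexField_inr (k : Fin m) (q : CSpace m d × CSpace m d) :
    complexField Θ (Sum.inr k) q =
      realField Θ (Sum.inl k) q - Complex.I • realField Θ (Sum.inr k) q := by
  have h : Complex.I * (1 / (2 * Complex.I)) = 1 / 2 := by field_simp
  simp only [realField, smul_smul, h]
  rw [← smul_sub, add_sub_sub_cancel, ← two_smul ℂ, smul_smul]
  simp

theorem analyticAt_realField (a : Fin m ⊕ Fin m) {q : CSpace m d × CSpace m d}
    (h : AnalyticAt ℂ Θ (q.2.1, q.1)) (h' : AnalyticAt ℂ (conjCoeff Θ) (q.1.1, q.2)) :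
    AnalyticAt ℂ (realField Θ a) q := by
  cases a with
  | inl k =>
    exact (analyticAt_const (v := (1 / 2 : ℂ))).smul
      ((analyticAt_complexField _ h h').add (analyticAt_complexField _ h h'))
  | inr k =>
    exact (analyticAt_const (v := (1 / (2 * Complex.I) : ℂ))).smul
      ((analyticAt_complexField _ h h').sub (analyticAt_complexField _ h h'))

theorem isTangentTo_realField {R : CSpace m d × CSpace m d → CSpace m d × CSpace m d}
    {q : CSpace m d × CSpace m d} (h : ∀ a, IsTangentTo ℂ (complexField Θ a) R q)
    (a : Fin m ⊕ Fin m) : IsTangentTo ℂ (realField Θ a) R q := by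
  cases a with
  | inl k =>
    filter_upwards [h (Sum.inl k), h (Sum.inr k)] with x h1 h2 hx
    simp only [realField, map_smul, map_add, h1 hx, h2 hx]
  | inr k =>
    filter_upwards [h (Sum.inl k), h (Sum.inr k)] with x h1 h2 hx
    simp only [realField, map_smul, map_sub, h1 hx, h2 hx]

/-- On the antidiagonal the second family of fields is the conjugate of the first; this is what
makes `realField` the image of `crField` under `pc`. -/
theorem coeffLbar_pc (k : Fin m) {t : CSpace m d} (h : AnalyticAt ℂ Θ (star t.1, t)) :
    coeffLbar Θ k t (star t) = star (coeffL Θ k t (star t)) := by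
  have h1 := fderiv_conjCoeff h ((Pi.single k 1 : Fin m → ℂ), (0 : CSpace m d))
  have h2 : star ((star t.1, t) : (Fin m → ℂ) × CSpace m d) = (t.1, star t) :=
    Prod.ext (star_star _) rfl
  have h3 : star ((Pi.single k 1 : Fin m → ℂ), (0 : CSpace m d)) =
      ((Pi.single k 1 : Fin m → ℂ), (0 : CSpace m d)) := by
    refine Prod.ext ?_ (star_zero _)
    ext j
    by_cases hj : j = k
    · subst hj; simp
    · simp [hj]
  rw [h2, h3] at h1
  refine Prod.ext ?_ ?_
  · exact (congrArg Prod.fst h3).symm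
  · show fderiv ℂ Θ (star t.1, t) (Pi.single k 1, 0) =
      star (fderiv ℂ (conjCoeff Θ) (t.1, star t) (Pi.single k 1, 0))
    rw [h1, star_star]

theorem pc_crField (a : Fin m ⊕ Fin m) {t : CSpace m d} (h : AnalyticAt ℂ Θ (star t.1, t)) :
    pc (crField Θ a t) = realField Θ a (pc t) := by
  cases a with
  | inl k =>
    refine Prod.ext ?_ ?_
    · simp [pc, crField, realField, complexField]
    · have h1 : star (1 / 2 : ℂ) = 1 / 2 := by simp
      simp only [pc, crField, realField, complexField, star_smul, Prod.smul_snd, Prod.snd_add,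
        zero_add, coeffLbar_pc k h, h1]
  | inr k =>
    refine Prod.ext ?_ ?_
    · simp [pc, crField, realField, complexField]
    · have h1 : star (1 / (2 * Complex.I) : ℂ) = -(1 / (2 * Complex.I)) := by
        simp only [one_div, star_inv₀, star_mul', RCLike.star_def, Complex.conj_I, map_ofNat]
        rw [mul_neg, inv_neg]
      simp only [pc, crField, realField, complexField, star_smul, Prod.smul_snd, Prod.snd_sub,
        zero_sub, coeffLbar_pc k h, h1, neg_smul, smul_neg]

theorem analyticAt_crField (a : Fin m ⊕ Fin m) {p : CSpace m d}
    (h' : AnalyticAt ℂ (conjCoeff Θ) (p.1, star p)) : AnalyticAt ℝ (crField Θ a) p := by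
  have h1 : ∀ k, AnalyticAt ℝ (fun t => coeffL Θ k t (star t)) p := fun k =>
    AnalyticAt.fun_comp (g := fun q : CSpace m d × CSpace m d => coeffL Θ k q.1 q.2)
      (f := pcL m d) (x := p) (analyticAt_coeffL (q := pc p) k h').restrictScalars
      ((pcL m d).analyticAt p)
  cases a with
  | inl k => exact (analyticAt_const (v := (1 / 2 : ℂ))).smul (h1 k)
  | inr k => exact (analyticAt_const (v := (1 / (2 * Complex.I) : ℂ))).smul (h1 k)

/-- The retraction `(t, τ) ↦ (t, ζ, Θ(ζ, t))` onto the complexification. -/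
def graphRetraction (Θ : (Fin m → ℂ) × CSpace m d → Fin d → ℂ)
    (q : CSpace m d × CSpace m d) : CSpace m d × CSpace m d :=
  (q.1, (q.2.1, Θ (q.2.1, q.1)))

theorem mem_complexification_iff {q : CSpace m d × CSpace m d} (h1 : q.1 ∈ ball 0 M.radius)
    (h2 : q.2 ∈ ball 0 M.radius) : q ∈ complexification M Θ ↔ graphRetraction Θ q = q := by
  constructor
  · rintro ⟨-, -, h⟩
    exact Prod.ext rfl (Prod.ext rfl h.symm)
  · intro h
    exact ⟨h1, h2, (congrArg (fun x => x.2.2) h).symm⟩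

theorem eventually_mem_complexification_iff {q : CSpace m d × CSpace m d}
    (hq : q ∈ complexification M Θ) :
    ∀ᶠ x in 𝓝 q, x ∈ complexification M Θ ↔ graphRetraction Θ x = x := by
  filter_upwards [(continuous_fst.tendsto q).eventually (isOpen_ball.mem_nhds hq.1),
    (continuous_snd.tendsto q).eventually (isOpen_ball.mem_nhds hq.2.1)] with x h1 h2
  exact mem_complexification_iff h1 h2

theorem analyticAt_graphRetraction {q : CSpace m d × CSpace m d}
    (h : AnalyticAt ℂ Θ (q.2.1, q.1)) : AnalyticAt ℂ (graphRetraction Θ) q := by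
  have h2 : AnalyticAt ℂ (fun x : CSpace m d × CSpace m d => x.2.1) q :=
    analyticAt_fst.comp analyticAt_snd
  exact analyticAt_fst.prod (h2.prod (AnalyticAt.fun_comp (g := Θ) h (h2.prod analyticAt_fst)))

theorem isLocalRetraction_graphRetraction {q : CSpace m d × CSpace m d}
    (hq : q ∈ complexification M Θ) (h : AnalyticAt ℂ Θ (q.2.1, q.1)) :
    IsLocalRetraction ℂ (graphRetraction Θ) q :=
  ⟨analyticAt_graphRetraction h, (mem_complexification_iff hq.1 hq.2.1).1 hq,
    Eventually.of_forall fun _ => rfl⟩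

end Flows

/-! ### The CR system and its complexification as flow systems -/

section Systems

variable {m d : ℕ} {M : LocalGenericSubmanifold m d} {Θ : (Fin m → ℂ) × CSpace m d → Fin d → ℂ}

/-- The points of `ℂⁿ × ℂⁿ` at which the defining functions are analytic and satisfy the
identities `Θ̄(z, ζ, Θ(ζ, z, w)) = w` and `Θ(ζ, z, Θ̄(z, ζ, ξ)) = ξ`. -/
structure IsRegular (Θ : (Fin m → ℂ) × CSpace m d → Fin d → ℂ) (q : CSpace m d × CSpace m d) :
    Prop where
  analytic : AnalyticAt ℂ Θ (q.2.1, q.1)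
  analytic_conj : AnalyticAt ℂ (conjCoeff Θ) (q.1.1, q.2)
  conj_apply : conjCoeff Θ (q.1.1, (q.2.1, Θ (q.2.1, q.1))) = q.1.2
  apply_conj : Θ (q.2.1, (q.1.1, conjCoeff Θ (q.1.1, q.2))) = q.2.2

theorem LocalGenericSubmanifold.IsComplexDefining.eventually_isRegular
    (h : M.IsComplexDefining Θ) : ∀ᶠ q in 𝓝 (0 : CSpace m d × CSpace m d), IsRegular Θ q := by
  have h1 : Tendsto (fun q : CSpace m d × CSpace m d => (q.2.1, q.1)) (𝓝 0) (𝓝 0) :=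
    ((continuous_fst.comp continuous_snd).prodMk continuous_fst).tendsto _
  have h2 : Tendsto (fun q : CSpace m d × CSpace m d => (q.1.1, q.2)) (𝓝 0) (𝓝 0) :=
    ((continuous_fst.comp continuous_fst).prodMk continuous_snd).tendsto _
  have h3 : AnalyticAt ℂ (conjCoeff Θ) 0 :=
    analyticAt_conjCoeff (by rw [star_zero]; exact h.analyticAt_zero)
  filter_upwards [h1.eventually h.analyticAt_zero.eventually_analyticAt,
    h2.eventually h3.eventually_analyticAt, h1.eventually h.conj_apply,
    h2.eventually h.apply_conj] with q ha hb hc hd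
  exact ⟨ha, hb, hc, hd⟩

/-- Only invariance of the complexification needs an argument. Flows of `𝓛̲_k` preserve `ξ = Θ(ζ, z,
w)` by construction; flows of `𝓛_k` preserve `w = Θ̄(z, ζ, ξ)`, which is the same set by the
reflection identities. -/
theorem isFlowSystem_complexFlow {q : CSpace m d × CSpace m d} (hq : q ∈ complexification M Θ)
    (h : ∀ᶠ x in 𝓝 q, IsRegular Θ x) :
    IsFlowSystem ℂ (complexField Θ) (complexFlow Θ) (complexification M Θ) q := by
  have h0 := h.self_of_nhds
  have hΦ : ∀ a, Tendsto (complexFlow Θ a) (𝓝 (q, 0)) (𝓝 q) := fun a => by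
    have := (analyticAt_complexFlow a h0.analytic h0.analytic_conj).continuousAt.tendsto
    rwa [complexFlow_zero] at this
  have hfst : Tendsto (Prod.fst : (CSpace m d × CSpace m d) × ℂ → _) (𝓝 (q, 0)) (𝓝 q) :=
    continuous_fst.tendsto _
  refine ⟨fun a => analyticAt_complexField a h0.analytic h0.analytic_conj,
    fun a => analyticAt_complexFlow a h0.analytic h0.analytic_conj,
    fun a => Eventually.of_forall (complexFlow_zero a),
    fun a => ((hΦ a).eventually h).mono fun x hx =>
      hasDerivAt_complexFlow a hx.analytic hx.analytic_conj,
    fun a => Eventually.of_forall (complexFlow_inv a), fun a => ?_⟩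
  filter_upwards [hfst.eventually h, (hΦ a).eventually h,
    (hΦ a).eventually (eventually_mem_complexification_iff hq)] with x h1 h2 h3 hx
  rw [h3]
  suffices h4 : Θ ((complexFlow Θ a x).2.1, (complexFlow Θ a x).1) = (complexFlow Θ a x).2.2 from
    Prod.ext rfl (Prod.ext rfl h4)
  cases a with
  | inl k =>
    have h5 : x.1.1.2 = conjCoeff Θ (x.1.1.1, x.1.2) := by
      rw [← h1.conj_apply]
      congr 2
      exact Prod.ext rfl hx.2.2.symm
    have h6 : (complexFlow Θ (Sum.inl k) x).1.2 = conjCoeff Θ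
        ((complexFlow Θ (Sum.inl k) x).1.1, (complexFlow Θ (Sum.inl k) x).2) := by
      simp only [complexFlow]
      rw [h5, add_sub_cancel]
    conv_rhs => rw [← h2.apply_conj, ← h6]
  | inr k =>
    have h5 : x.1.2.2 = Θ (x.1.2.1, x.1.1) := hx.2.2
    simp only [complexFlow]
    rw [h5, add_sub_cancel]

theorem pc_mem_complexification (hΘ : M.IsComplexDefining Θ) {p : CSpace m d} :
    pc p ∈ complexification M Θ ↔ p ∈ M.carrier := by
  have h1 : star p ∈ ball (0 : CSpace m d) M.radius ↔ p ∈ ball (0 : CSpace m d) M.radius := by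
    simp only [mem_ball_zero_iff]
    rw [show ‖star p‖ = ‖p‖ from norm_star p]
  constructor
  · rintro ⟨h, -, h'⟩
    exact (hΘ.2 p h).2 h'
  · intro h
    exact ⟨h.1, h1.2 h.1, (hΘ.2 p h.1).1 h⟩

theorem continuous_pc : Continuous (pc : CSpace m d → _) := (pcL m d).continuous

/-- Invariance of `M` is read off in the complexification: under `pc` a CR trajectory becomes an
integral curve of `realField`, a combination of fields tangent to the graph `ξ = Θ`. -/
theorem exists_crFlow (hΘ : M.IsComplexDefining Θ) {p : CSpace m d} (hp : p ∈ M.carrier)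
    (h : ∀ᶠ x in 𝓝 (pc p), IsRegular Θ x) :
    ∃ Φ, IsFlowSystem ℝ (crField Θ) Φ M.carrier p := by
  have h0 := h.self_of_nhds
  have hX : ∀ a, AnalyticAt ℝ (crField Θ a) p := fun a => analyticAt_crField a h0.analytic_conj
  choose Φ hΦ hΦ0 hΦd hΦi using fun a => exists_analytic_flow (hX a)
  refine ⟨Φ, hX, hΦ, hΦ0, hΦd, hΦi, fun a => ?_⟩
  have hq := (pc_mem_complexification hΘ).2 hp
  have hR := isLocalRetraction_graphRetraction hq h0.analytic
  have hT := isTangentTo_realField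
    (fun a => (isFlowSystem_complexFlow hq h).isTangentTo hR.analytic
      (eventually_mem_complexification_iff hq) a) a
  obtain ⟨W, hW, hinv⟩ := hR.invariant
    (analyticAt_realField a h0.analytic h0.analytic_conj) hT
  have hpc : Tendsto pc (𝓝 p) (𝓝 (pc p)) := continuous_pc.tendsto p
  have hP : ∀ᶠ t in 𝓝 p, pc t ∈ W ∧ AnalyticAt ℂ Θ (star t.1, t) ∧
      (pc t ∈ complexification M Θ ↔ graphRetraction Θ (pc t) = pc t) := by
    filter_upwards [hpc.eventually hW, hpc.eventually h,
      hpc.eventually (eventually_mem_complexification_iff hq)] with t h1 h2 h3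
    exact ⟨h1, h2.analytic, h3⟩
  have hΦt : Tendsto (Φ a) (𝓝 (p, 0)) (𝓝 p) := by
    have := (hΦ a).continuousAt.tendsto
    rwa [(hΦ0 a).self_of_nhds] at this
  have hfst : Tendsto (Prod.fst : CSpace m d × ℝ → _) (𝓝 (p, 0)) (𝓝 p) := continuous_fst.tendsto _
  obtain ⟨ε, hε, hball⟩ := Metric.eventually_nhds_iff_ball.1 ((hΦd a).and (hΦt.eventually hP))
  filter_upwards [ball_mem_nhds _ hε, hfst.eventually (hΦ0 a), hfst.eventually hP] with z hz hz0 hzP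
    hzA
  have hmem : ∀ r ∈ Set.Icc (0 : ℝ) 1, (z.1, r * z.2) ∈ ball (p, (0 : ℝ)) ε := by
    intro r hr
    rw [mem_ball, Prod.dist_eq, max_lt_iff] at hz ⊢
    refine ⟨hz.1, lt_of_le_of_lt ?_ hz.2⟩
    simp only [Real.dist_eq, sub_zero, abs_mul, abs_of_nonneg hr.1]
    exact mul_le_of_le_one_left (abs_nonneg _) hr.2
  have hc := hinv (fun r => pc (Φ a (z.1, r * z.2))) (z.2 : ℂ) (fun r hr => by
    obtain ⟨h1, h2, h3, -⟩ := hball _ (hmem r hr)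
    refine ⟨h2, ?_⟩
    have h4 : HasDerivAt (fun r : ℝ => r * z.2) z.2 r := by
      simpa using (hasDerivAt_id r).mul_const z.2
    have h5 := (pcL m d).hasFDerivAt.comp_hasDerivAt r (HasDerivAt.scomp r h1 h4)
    have h6 : pcL m d (z.2 • crField Θ a (Φ a (z.1, r * z.2))) =
        (z.2 : ℂ) • realField Θ a (pc (Φ a (z.1, r * z.2))) := by
      rw [map_smul, pcL_apply, pc_crField a h3, Complex.coe_smul]
    rw [h6] at h5
    exact h5) (by
      simp only [zero_mul, hz0]
      exact hzP.2.2.1 ((pc_mem_complexification hΘ).2 hzA)) 1 ⟨zero_le_one, le_rfl⟩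
  simp only [one_mul] at hc
  obtain ⟨-, -, -, h7⟩ := hball z hz
  exact (pc_mem_complexification hΘ).1 (h7.2 hc)

end Systems

/-! ### Dimension bounds and transport of orbits -/

section Rank

variable {𝕂 : Type} [RCLike 𝕂] {E : Type} [NormedAddCommGroup E] [NormedSpace 𝕂 E] {ι : Type}

theorem localOrbit_subset_self {X : ι → E → E} {S : Set E} {K : ℕ} {δ : ℝ} {p : E} (hp : p ∈ S) :
    localOrbit 𝕂 X S K δ p ⊆ S := by
  intro y hy
  simp only [localOrbit, Set.mem_iUnion] at hy
  obtain ⟨k, -, hy⟩ := hy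
  cases k with
  | zero => exact (show y = p from hy) ▸ hp
  | succ k =>
    obtain ⟨x, -, a, γ, -, hγ, s, hs, rfl⟩ := hy
    exact (hγ s hs).1

theorem localOrbit_mono_image {E' : Type} [NormedAddCommGroup E'] [NormedSpace 𝕂 E']
    {X : ι → E → E} {X' : ι → E' → E'} {S : Set E} {S' : Set E'} {f : E → E'} {K : ℕ} {δ : ℝ}
    {p : E} (h : ∀ a x y, FlowStep 𝕂 (X a) S δ x y → FlowStep 𝕂 (X' a) S' δ (f x) (f y)) :
    ∀ y ∈ localOrbit 𝕂 X S K δ p, f y ∈ localOrbit 𝕂 X' S' K δ (f p) := by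
  have h1 : ∀ k, ∀ y ∈ flowChain 𝕂 X S δ p k, f y ∈ flowChain 𝕂 X' S' δ (f p) k := by
    intro k
    induction k with
    | zero => exact fun y hy => congrArg f hy
    | succ k ih =>
      rintro y ⟨x, hx, a, hxy⟩
      exact ⟨f x, ih x hx, a, h a x y hxy⟩
  intro y hy
  simp only [localOrbit, Set.mem_iUnion] at hy ⊢
  obtain ⟨k, hk, hy⟩ := hy
  exact ⟨k, hk, h1 k y hy⟩

namespace IsLocalRetraction

variable {R R' : E → E} {q : E}

/-- The larger fixed point set is parametrized by `V`, since `R` factors through `T`; tangent spaces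
are nested. -/
theorem finrank_range_le [FiniteDimensional 𝕂 E] (h : IsLocalRetraction 𝕂 R q)
    (h' : IsLocalRetraction 𝕂 R' q) (hRR : ∀ᶠ x in 𝓝 q, R' x = x → R x = x) {V : Type}
    [NormedAddCommGroup V] [NormedSpace 𝕂 V] [FiniteDimensional 𝕂 V] {T : E →L[𝕂] V} {g : V → E}
    (hg : DifferentiableAt 𝕂 g (T q)) (hgT : R = fun x => g (T x)) :
    Module.finrank 𝕂 (fderiv 𝕂 R' q).range ≤ Module.finrank 𝕂 V := by
  have h1 : ∀ᶠ x in 𝓝 q, R (R' x) = R' x := by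
    filter_upwards [h'.tendsto.eventually hRR, h'.idem] with x hx hx' using hx hx'
  have h2 : fderiv 𝕂 R q = (fderiv 𝕂 g (T q)).comp T := by
    rw [hgT]
    exact (hg.hasFDerivAt.comp q T.hasFDerivAt).fderiv
  have h3 := Submodule.finrank_mono (h.range_fderiv_le h' h1)
  rw [h2] at h3
  exact h3.trans (finrank_range_comp_le _ _)

theorem restrictScalars {E : Type} [NormedAddCommGroup E] [NormedSpace ℂ E] {R : E → E} {q : E}
    (h : IsLocalRetraction ℂ R q) : IsLocalRetraction ℝ R q :=
  ⟨h.analytic.restrictScalars, h.fixed, h.idem⟩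

end IsLocalRetraction

theorem IsTangentTo.restrictScalars {E : Type} [NormedAddCommGroup E] [NormedSpace ℂ E]
    [CompleteSpace E] {X R : E → E} {q : E} (h : IsTangentTo ℂ X R q) (hR : AnalyticAt ℂ R q) :
    IsTangentTo ℝ X R q := by
  filter_upwards [h, hR.eventually_analyticAt] with x hx hR' hRx
  rw [hR'.differentiableAt.fderiv_restrictScalars ℝ]
  exact hx hRx

end Rank

/-! ### CR orbit and complexified orbit -/

section Comparison

variable {m d : ℕ} {M : LocalGenericSubmanifold m d} {Θ : (Fin m → ℂ) × CSpace m d → Fin d → ℂ}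

theorem pc_injective : Function.Injective (pc : CSpace m d → _) :=
  fun _ _ h => congrArg Prod.fst h

theorem realCoord_graphMap (φ : RSpace m d → Fin d → ℝ) (q : RSpace m d) :
    realCoord m d (graphMap φ q) = q := by
  rw [realCoord_apply]
  refine Prod.ext ?_ (Prod.ext ?_ ?_) <;> ext <;> simp [graphMap]

theorem LocalGenericSubmanifold.IsComplexDefining.analyticAt_bar (hΘ : M.IsComplexDefining Θ)
    {t : CSpace m d} (ht : t ∈ M.carrier) : AnalyticAt ℂ Θ (star t.1, t) := by
  refine hΘ.1 _ ?_
  have h1 := mem_ball_zero_iff.1 ht.1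
  rw [mem_ball_zero_iff, Prod.norm_mk]
  have h2 : ‖star t.1‖ ≤ ‖t‖ := by
    rw [show ‖star t.1‖ = ‖t.1‖ from norm_star t.1]
    exact norm_fst_le t
  rw [max_eq_right h2]
  linarith [M.radius_pos]

/-- The ambient set is `univ` because the confining set is supplied later by a retraction to which
the fields are tangent. -/
theorem flowStep_pc (hΘ : M.IsComplexDefining Θ) {δ : ℝ} (a : Fin m ⊕ Fin m) (x y : CSpace m d)
    (h : FlowStep ℝ (crField Θ a) M.carrier δ x y) :
    FlowStep ℝ (realField Θ a) Set.univ δ (pc x) (pc y) := by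
  obtain ⟨γ, rfl, hγ, s, hs, rfl⟩ := h
  refine ⟨fun s => pc (γ s), rfl, fun s hs => ⟨trivial, ?_⟩, s, hs, rfl⟩
  rw [← pc_crField a (hΘ.analyticAt_bar (hγ s hs).1)]
  exact (pcL m d).hasFDerivAt.comp_hasDerivAt s (hγ s hs).2

theorem finrank_range_le_of_mem_complexification {q : CSpace m d × CSpace m d}
    (hq : q ∈ complexification M Θ) (h : AnalyticAt ℂ Θ (q.2.1, q.1))
    {R : CSpace m d × CSpace m d → CSpace m d × CSpace m d} (hR : IsLocalRetraction ℂ R q)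
    (hRM : ∀ᶠ x in 𝓝 q, R x = x → x ∈ complexification M Θ) :
    Module.finrank ℂ (fderiv ℂ R q).range ≤ 2 * m + d := by
  let T : CSpace m d × CSpace m d →L[ℂ] (Fin m → ℂ) × CSpace m d :=
    ((ContinuousLinearMap.fst ℂ _ _).comp (ContinuousLinearMap.snd ℂ _ _)).prod
      (ContinuousLinearMap.fst ℂ _ _)
  have h1 := (isLocalRetraction_graphRetraction hq h).finrank_range_le hR
    (by
      filter_upwards [hRM, eventually_mem_complexification_iff hq] with x h1 h2 h3
      exact h2.1 (h1 h3))
    (T := T) (g := fun y => (y.2, (y.1, Θ y)))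
    (differentiableAt_snd.prodMk (differentiableAt_fst.prodMk h.differentiableAt)) rfl
  refine h1.trans (le_of_eq ?_)
  simp [Module.finrank_prod]
  ring

theorem finrank_range_le_of_mem_carrier {p : CSpace m d} (hp : p ∈ M.carrier)
    (h : AnalyticAt ℝ M.φ (realCoord m d p)) {R : CSpace m d → CSpace m d}
    (hR : IsLocalRetraction ℝ R p) (hRM : ∀ᶠ x in 𝓝 p, R x = x → x ∈ M.carrier) :
    Module.finrank ℝ (fderiv ℝ R p).range ≤ 2 * m + d := by
  have h0 : IsLocalRetraction ℝ (fun t => graphMap M.φ (realCoord m d t)) p := by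
    refine ⟨(analyticAt_graphMap h).fun_comp ((realCoord m d).analyticAt p),
      LocalGenericSubmanifold.graphMap_realCoord hp, Eventually.of_forall fun t => ?_⟩
    rw [realCoord_graphMap]
  have h1 := h0.finrank_range_le hR
    (hRM.mono fun x h1 h2 => LocalGenericSubmanifold.graphMap_realCoord (h1 h2))
    (T := realCoord m d) (g := graphMap M.φ) (analyticAt_graphMap h).differentiableAt rfl
  refine h1.trans (le_of_eq ?_)
  simp [Module.finrank_prod]
  ring

/-- Complexification of the germ of a real analytic retraction to which the CR fields are
tangent. -/
theorem exists_complexified_retraction {p : CSpace m d} (hreg : ∀ᶠ x in 𝓝 (pc p), IsRegular Θ x)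
    {R : CSpace m d → CSpace m d} (hR : IsLocalRetraction ℝ R p)
    (hRX : ∀ a, IsTangentTo ℝ (crField Θ a) R p) :
    ∃ Q : CSpace m d × CSpace m d → CSpace m d × CSpace m d, IsLocalRetraction ℂ Q (pc p) ∧
      (∀ᶠ t in 𝓝 p, Q (pc t) = pc (R t)) ∧ ∀ a, IsTangentTo ℂ (complexField Θ a) Q (pc p) := by
  -- The two components of `Q` extend `R` and its conjugate, so that `Q (t, t̄) = (R t, conj (R t))`
  -- stays on the antidiagonal.
  obtain ⟨g₁, hg₁, hg₁R⟩ := exists_complexification hR.analytic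
  obtain ⟨g₂, hg₂, hg₂R⟩ := exists_complexification (f := fun t => star (R t)) (p := p)
    (((starL' ℝ : CSpace m d ≃L[ℝ] CSpace m d).toContinuousLinearMap.analyticAt _).comp hR.analytic)
  let Q : CSpace m d × CSpace m d → CSpace m d × CSpace m d := fun q => (g₁ q, g₂ q)
  have hQ : AnalyticAt ℂ Q (pc p) := hg₁.prod hg₂
  have hpc : Tendsto pc (𝓝 p) (𝓝 (pc p)) := continuous_pc.tendsto p
  have hQR : ∀ᶠ t in 𝓝 p, Q (pc t) = pc (R t) := by
    filter_upwards [hg₁R, hg₂R] with t h1 h2 using Prod.ext h1 h2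
  have hQp : Q (pc p) = pc p := by rw [hQR.self_of_nhds, hR.fixed]
  have hidem : ∀ᶠ x in 𝓝 (pc p), Q (Q x) = Q x := by
    refine (eventually_eq_zero_of_antidiagonal (F := fun x => Q (Q x) - Q x) (p := p)
      ((AnalyticAt.fun_comp (g := Q) (by rwa [hQp]) hQ).sub hQ) ?_).mono fun x hx => sub_eq_zero.1 hx
    filter_upwards [hQR, hR.tendsto.eventually hQR, hR.idem] with t h1 h2 h3
    rw [h1, h2, h3, sub_self]
  have hQt : Tendsto Q (𝓝 (pc p)) (𝓝 (pc p)) := by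
    have := hQ.continuousAt.tendsto
    rwa [hQp] at this
  refine ⟨Q, ⟨hQ, hQp, hidem⟩, hQR, ?_⟩
  have hX : ∀ a, AnalyticAt ℂ (realField Θ a) (pc p) := fun a =>
    analyticAt_realField a hreg.self_of_nhds.analytic hreg.self_of_nhds.analytic_conj
  have hT : ∀ a, IsTangentTo ℂ (realField Θ a) Q (pc p) := by
    intro a
    have h1 : AnalyticAt ℂ (fun x => fderiv ℂ Q x (realField Θ a x) - realField Θ a x) (pc p) :=
      (hQ.fderiv.clm_apply' (hX a)).sub (hX a)
    have h2 : ∀ᶠ t in 𝓝 p, R t = t →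
        fderiv ℂ Q (pc t) (realField Θ a (pc t)) = realField Θ a (pc t) := by
      filter_upwards [hRX a, hQR.eventually_nhds, hpc.eventually hQ.eventually_analyticAt,
        hpc.eventually hreg, hR.analytic.eventually_analyticAt] with t h3 h4 h5 h6 h7 h8
      have h9 := ((h5.differentiableAt.hasFDerivAt.restrictScalars ℝ).comp t
        (pcL m d).hasFDerivAt).unique
        (((pcL m d).hasFDerivAt.comp t h7.differentiableAt.hasFDerivAt).congr_of_eventuallyEq h4)
      have h10 := congrArg (fun A => A (crField Θ a t)) h9
      simp only [ContinuousLinearMap.comp_apply, ContinuousLinearMap.coe_restrictScalars', h3 h8,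
        pcL_apply, pc_crField a h6.analytic] at h10
      exact h10
    -- Tangency holds only at fixed points, which do not form an open set. Evaluating at `Q x` gives
    -- an identity valid on the whole antidiagonal, to which the identity principle applies.
    have h3 : ∀ᶠ x in 𝓝 (pc p),
        fderiv ℂ Q (Q x) (realField Θ a (Q x)) - realField Θ a (Q x) = 0 := by
      refine eventually_eq_zero_of_antidiagonal
        (F := fun x => fderiv ℂ Q (Q x) (realField Θ a (Q x)) - realField Θ a (Q x))
        (AnalyticAt.fun_comp
          (g := fun x => fderiv ℂ Q x (realField Θ a x) - realField Θ a x) (by rwa [hQp]) hQ) ?_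
      filter_upwards [hQR, hR.tendsto.eventually h2, hR.idem] with t h4 h5 h6
      rw [h4, h5 h6, sub_self]
    filter_upwards [h3] with x hx hQx
    rw [hQx] at hx
    exact sub_eq_zero.1 hx
  intro a
  cases a with
  | inl k =>
    filter_upwards [hT (Sum.inl k), hT (Sum.inr k)] with x h1 h2 hx
    rw [complexField_inl, map_add, map_smul, h1 hx, h2 hx]
  | inr k =>
    filter_upwards [hT (Sum.inl k), hT (Sum.inr k)] with x h1 h2 hx
    rw [complexField_inr, map_sub, map_smul, h1 hx, h2 hx]

/-- The local orbits near `p ∈ M` and `p^c`: the complexified orbit is the fixed point set of a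
holomorphic retraction, invariant under `σ`, and the CR orbit is its trace on `{τ = t̄}`. -/
theorem exists_orbit_comparison (hΘ : M.IsComplexDefining Θ) {p : CSpace m d}
    (hp : p ∈ M.carrier) (hreg : ∀ᶠ x in 𝓝 (pc p), IsRegular Θ x)
    (hφ : AnalyticAt ℝ M.φ (realCoord m d p)) {U : Set ((CSpace m d × CSpace m d) × ℂ)}
    (hU : U ∈ 𝓝 (pc p, (0 : ℂ))) :
    ∃ (V : Type) (_ : NormedAddCommGroup V) (_ : NormedSpace ℂ V) (_ : FiniteDimensional ℂ V)
      (σ : V → CSpace m d × CSpace m d) (v₀ : V) (π : CSpace m d × CSpace m d →L[ℂ] V) (H : V → V),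
      IsLocalRetraction ℂ (fun x => σ (H (π x))) (pc p) ∧
      IsChainMap (complexFlow Θ) U (pc p) v₀ σ ∧ AnalyticAt ℂ σ v₀ ∧
      AnalyticAt ℂ H (π (pc p)) ∧ H (π (pc p)) = v₀ ∧
      (∀ᶠ y in 𝓝 (π (pc p)), π (σ (H y)) = y) ∧
      (∀ᶠ q in 𝓝 (pc p), σ (H (π q)) = q ↔ σ (H (π (sigma q))) = sigma q) ∧
      ∀ K ≥ 2 * (2 * m + d), ∃ δ₀ > 0, ∀ δ, 0 < δ → δ < δ₀ →
        (∀ᶠ t in 𝓝 p, t ∈ crOrbit M Θ K δ p ↔ σ (H (π (pc t))) = pc t) ∧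
        ∀ᶠ q in 𝓝 (pc p), q ∈ complexOrbit M Θ K δ (pc p) ↔ σ (H (π q)) = q := by
  have hq : pc p ∈ complexification M Θ := (pc_mem_complexification hΘ).2 hp
  have h0 := hreg.self_of_nhds
  have hsys := isFlowSystem_complexFlow hq hreg
  obtain ⟨V, _, _, _, σ, v₀, π, H, hR, hRX, hdim, hchain, hσ, hH, hH0, hHinv, horb⟩ :=
    hsys.exists_orbit_retraction hq hU
  obtain ⟨Φ, hsys'⟩ := exists_crFlow hΘ hp hreg
  obtain ⟨V', _, _, _, σ', v₀', π', H', hR', hRX', hdim', -, -, -, -, -, horb'⟩ :=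
    hsys'.exists_orbit_retraction hp univ_mem
  refine ⟨V, inferInstance, inferInstance, inferInstance, σ, v₀, π, H, hR, hchain, hσ, hH, hH0,
    hHinv, ?_⟩
  set R := fun x => σ (H (π x)) with hRdef
  set R' := fun x => σ' (H' (π' x)) with hRdef'
  have hpc : Tendsto pc (𝓝 p) (𝓝 (pc p)) := continuous_pc.tendsto p
  have hV : Module.finrank ℂ V ≤ 2 * m + d := by
    rw [← hdim]
    refine finrank_range_le_of_mem_complexification hq h0.analytic hR ?_
    obtain ⟨δ₀, hδ₀, h1⟩ := horb _ le_rfl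
    filter_upwards [h1 (δ₀ / 2) (by positivity) (by linarith)] with x hx hRx
    exact localOrbit_subset_self hq (hx.2 hRx)
  have hV' : Module.finrank ℝ V' ≤ 2 * m + d := by
    rw [← hdim']
    refine finrank_range_le_of_mem_carrier hp hφ hR' ?_
    obtain ⟨δ₀, hδ₀, h1⟩ := horb' _ le_rfl
    filter_upwards [h1 (δ₀ / 2) (by positivity) (by linarith)] with x hx hRx
    exact localOrbit_subset_self hp (hx.2 hRx)
  -- the CR orbit is contained in the trace of the complexified orbit
  have hsub : ∀ᶠ t in 𝓝 p, R' t = t → R (pc t) = pc t := by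
    obtain ⟨δ₀, hδ₀, h1⟩ := horb' _ le_rfl
    obtain ⟨δ₁, hδ₁, h2⟩ := hR.restrictScalars.localOrbit_subset
      (Y := realField Θ)
      (fun a => (analyticAt_realField a h0.analytic h0.analytic_conj).restrictScalars)
      (fun a => (isTangentTo_realField hRX a).restrictScalars hR.analytic) univ_mem
      (2 * Module.finrank ℝ V')
    have h3 : 0 < min (δ₀ / 2) δ₁ := lt_min (by positivity) hδ₁
    filter_upwards [h1 (min (δ₀ / 2) δ₁) h3
      (lt_of_le_of_lt (min_le_left _ _) (by linarith))] with t ht hRt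
    exact (h2 _ (min_le_right _ _) _ _
      (localOrbit_mono_image (fun a x y => flowStep_pc hΘ a x y) t (ht.2 hRt))).2
  obtain ⟨Q, hQ, hQR, hQX⟩ := exists_complexified_retraction hreg hR' hRX'
  -- One inclusion: the complexified CR orbit lies in the complexified orbit, because on the
  -- antidiagonal `Q` takes values in the CR orbit.
  have hRQ : ∀ᶠ q in 𝓝 (pc p), R (Q q) = Q q := by
    refine (eventually_eq_zero_of_antidiagonal (F := fun q => R (Q q) - Q q)
      ((AnalyticAt.fun_comp (g := R) (by rw [hQ.fixed]; exact hR.analytic) hQ.analytic).sub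
        hQ.analytic) ?_).mono fun x hx => sub_eq_zero.1 hx
    filter_upwards [hQR, hR'.tendsto.eventually hsub, hR'.idem] with t h1 h2 h3
    rw [h1, h2 h3, sub_self]
  -- The other inclusion: the holomorphic fields are tangent to `Q`, so the complexified orbit
  -- cannot leave its fixed points.
  have hQR' : ∀ᶠ q in 𝓝 (pc p), R q = q → Q q = q := by
    obtain ⟨δ₀, hδ₀, h1⟩ := horb _ le_rfl
    obtain ⟨δ₁, hδ₁, h2⟩ := hQ.localOrbit_subset (Y := complexField Θ)
      (fun a => analyticAt_complexField a h0.analytic h0.analytic_conj) hQX univ_mem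
      (2 * Module.finrank ℂ V)
    have h3 : 0 < min (δ₀ / 2) δ₁ := lt_min (by positivity) hδ₁
    filter_upwards [h1 (min (δ₀ / 2) δ₁) h3
      (lt_of_le_of_lt (min_le_left _ _) (by linarith))] with t ht hRt
    exact (h2 _ (min_le_right _ _) _ _ (ht.2 hRt)).2
  have heq : ∀ᶠ q in 𝓝 (pc p), R q = q ↔ Q q = q := by
    filter_upwards [hRQ, hQR'] with q h1 h2
    exact ⟨h2, fun h => by rw [h] at h1; exact h1⟩
  have hsig : Tendsto sigma (𝓝 (pc p)) (𝓝 (pc p)) := by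
    have := (sigmaL m d).continuous.tendsto (pc p)
    rwa [sigmaL_apply, sigma_pc] at this
  -- Both sides are holomorphic and agree on the antidiagonal, which `sigma` fixes. This reality of
  -- `Q` passes to the common fixed point set.
  have hQσ : ∀ᶠ q in 𝓝 (pc p), sigma (Q (sigma q)) = Q q := by
    refine (eventually_eq_zero_of_antidiagonal (F := fun q => sigma (Q (sigma q)) - Q q)
      ((analyticAt_sigma_conj (by rw [sigma_pc]; exact hQ.analytic)).sub
        hQ.analytic) ?_).mono fun x hx => sub_eq_zero.1 hx
    filter_upwards [hQR] with t h1
    rw [sigma_pc, h1, sigma_pc, sub_self]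
  refine ⟨?_, fun K hK => ?_⟩
  · filter_upwards [heq, hsig.eventually heq, hQσ] with q h1 h2 h3
    refine h1.trans (Iff.trans ?_ h2.symm)
    rw [← h3]
    constructor
    · intro h
      rw [← sigma_sigma (Q (sigma q)), h]
    · intro h
      rw [h, sigma_sigma]
  · obtain ⟨δ₀, hδ₀, h1⟩ := horb K (le_trans (by omega) hK)
    obtain ⟨δ₁, hδ₁, h2⟩ := horb' K (le_trans (by omega) hK)
    refine ⟨min δ₀ δ₁, lt_min hδ₀ hδ₁, fun δ hδ hδ' => ⟨?_,
      h1 δ hδ (hδ'.trans_le (min_le_left _ _))⟩⟩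
    filter_upwards [h2 δ hδ (hδ'.trans_le (min_le_right _ _)), hpc.eventually heq, hQR]
      with t h3 h4 h5
    refine h3.trans (Iff.trans ?_ h4.symm)
    rw [h5]
    exact pc_injective.eq_iff.symm

end Comparison

/-! ### Real defining equations with independent differentials -/

section RealEquations

variable {m d : ℕ}

/-- Coordinates of the displacement `q - (R q + σ R σ q) / 2` of a retraction `R`. -/
noncomputable def displacement {c : ℕ} (ℓ : Fin c → CSpace m d × CSpace m d →L[ℂ] ℂ)
    (R : CSpace m d × CSpace m d → CSpace m d × CSpace m d) (q : CSpace m d × CSpace m d) :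
    Fin c → ℂ :=
  fun l => ℓ l (q - (1 / 2 : ℂ) • (R q + sigma (R (sigma q))))

/-- Real equations, with linearly independent differentials, of the fixed point set of a
holomorphic retraction, when this set is invariant under `σ`. -/
theorem exists_real_equations {p : CSpace m d}
    {R : CSpace m d × CSpace m d → CSpace m d × CSpace m d} (hR : IsLocalRetraction ℂ R (pc p))
    (hσ : ∀ᶠ q in 𝓝 (pc p), R q = q ↔ R (sigma q) = sigma q) :
    ∃ (c : ℕ) (ℓ : Fin c → CSpace m d × CSpace m d →L[ℂ] ℂ),
      AnalyticAt ℂ (displacement ℓ R) (pc p) ∧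
      (∀ q, star (displacement ℓ R q) = displacement ℓ R (sigma q)) ∧
      displacement ℓ R (pc p) = 0 ∧
      Function.Surjective (fderiv ℂ (displacement ℓ R) (pc p)) ∧
      Function.Surjective (fderiv ℝ (fun t l => (displacement ℓ R (pc t) l).re) p) ∧
      ∀ᶠ q in 𝓝 (pc p), displacement ℓ R q = 0 ↔ R q = q := by
  let R₂ : CSpace m d × CSpace m d → CSpace m d × CSpace m d := fun q => sigma (R (sigma q))
  have hsig : Tendsto sigma (𝓝 (pc p)) (𝓝 (pc p)) := by
    have := (sigmaL m d).continuous.tendsto (pc p)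
    rwa [sigmaL_apply, sigma_pc] at this
  have hR₂ : IsLocalRetraction ℂ R₂ (pc p) := by
    refine ⟨analyticAt_sigma_conj (by rw [sigma_pc]; exact hR.analytic), ?_, ?_⟩
    · simp only [R₂, sigma_pc, hR.fixed]
    · filter_upwards [hsig.eventually hR.idem] with q hq
      simp only [R₂, sigma_sigma, hq]
  have h12 : ∀ᶠ q in 𝓝 (pc p), R (R₂ q) = R₂ q := by
    filter_upwards [hsig.eventually hR.idem, hR₂.tendsto.eventually hσ] with q h1 h2
    refine h2.2 ?_
    simp only [R₂, sigma_sigma, h1]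
  have h21 : ∀ᶠ q in 𝓝 (pc p), R₂ (R q) = R q := by
    filter_upwards [hR.idem, hR.tendsto.eventually hσ] with q h1 h2
    simp only [R₂, h2.1 h1, sigma_sigma]
  -- Averaging `R` with its conjugate `R₂` makes the displacement commute with `sigma`. It still
  -- vanishes on the fixed point set, which `R` and `R₂` share.
  let f : CSpace m d × CSpace m d → CSpace m d × CSpace m d :=
    fun q => q - (1 / 2 : ℂ) • (R q + R₂ q)
  have hf : AnalyticAt ℂ f (pc p) := analyticAt_id.sub
    ((analyticAt_const (v := (1 / 2 : ℂ))).smul (hR.analytic.add hR₂.analytic))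
  have hfσ : ∀ q, f (sigma q) = sigma (f q) := fun q => by
    have : star (1 / 2 : ℂ) = 1 / 2 := by simp
    simp only [f, R₂, sigma_sub, sigma_smul, sigma_add, sigma_sigma, this]
    rw [add_comm (R (sigma q))]
  set P := fderiv ℂ R (pc p) with hP
  set P₂ := fderiv ℂ R₂ (pc p) with hP₂
  set D := fderiv ℂ f (pc p) with hD
  have hDP : ∀ v, D v = v - (1 / 2 : ℂ) • (P v + P₂ v) := fun v => by
    have h1 : HasFDerivAt f (ContinuousLinearMap.id ℂ _ - (1 / 2 : ℂ) • (P + P₂)) (pc p) :=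
      (hasFDerivAt_id _).sub ((hR.analytic.differentiableAt.hasFDerivAt.add
        hR₂.analytic.differentiableAt.hasFDerivAt).const_smul (1 / 2 : ℂ))
    rw [hD, h1.fderiv]
    rfl
  have hDσ : ∀ v, D (sigma v) = sigma (D v) := by
    have h1 : HasFDerivAt f (D.restrictScalars ℝ) (sigma (pc p)) := by
      rw [sigma_pc]; exact hf.differentiableAt.hasFDerivAt.restrictScalars ℝ
    have h2 := h1.comp (pc p) (sigmaL m d).hasFDerivAt
    have h3 := (sigmaL m d).hasFDerivAt.comp (pc p)
      (hf.differentiableAt.hasFDerivAt.restrictScalars ℝ)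
    have h4 := h2.unique (h3.congr_of_eventuallyEq (Eventually.of_forall hfσ))
    exact fun v => congrArg (fun A => A v) h4
  -- `D` commutes with `sigma`, so it preserves the antidiagonal and is the complexification of a
  -- real map `δ`. Coordinates on the range of `δ` select independent real equations.
  let δ : CSpace m d →L[ℝ] CSpace m d :=
    (ContinuousLinearMap.fst ℝ _ _).comp ((D.restrictScalars ℝ).comp (pcL m d))
  have hδ : ∀ t, D (pc t) = pc (δ t) := fun t =>
    (exists_pc_of_sigma_eq (by rw [← hDσ, sigma_pc])).symm
  let b := Module.finBasis ℝ (δ : CSpace m d →ₗ[ℝ] CSpace m d).range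
  choose g hg using fun i => (b.coord i).exists_extend
  choose ℓ hℓ using fun i => exists_extension_functional (g i)
  have hℓδ : ∀ i t, ℓ i (D (pc t)) = (b.coord i ⟨δ t, t, rfl⟩ : ℝ) := fun i t => by
    rw [hδ, hℓ, ← hg]
    rfl
  have hℓσ : ∀ i q, star (ℓ i q) = ℓ i (sigma q) := fun i q => by
    obtain ⟨t, t', rfl⟩ := exists_pc_add_pc q
    rw [sigma_add, sigma_smul, sigma_pc, sigma_pc]
    simp only [map_add, map_smul, hℓ, star_add, smul_eq_mul, star_mul', RCLike.star_def,
      Complex.conj_ofReal, Complex.conj_I]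
  have hχ : displacement ℓ R = fun q => (ContinuousLinearMap.pi ℓ) (f q) := rfl
  have hχa : AnalyticAt ℂ (displacement ℓ R) (pc p) :=
    ((ContinuousLinearMap.pi ℓ).analyticAt _).comp hf
  have hχd : ∀ v l, fderiv ℂ (displacement ℓ R) (pc p) v l = ℓ l (D v) := fun v l => by
    have h1 : HasFDerivAt (displacement ℓ R) ((ContinuousLinearMap.pi ℓ).comp D) (pc p) :=
      (ContinuousLinearMap.pi ℓ).hasFDerivAt.comp _ hf.differentiableAt.hasFDerivAt
    rw [h1.fderiv]
    rfl
  have hsurj : ∀ y : Fin _ → ℝ, ∃ t, ∀ l, b.coord l ⟨δ t, t, rfl⟩ = y l := fun y => by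
    obtain ⟨t, ht⟩ := (b.equivFun.symm y).2
    refine ⟨t, fun l => ?_⟩
    have h1 : (⟨δ t, t, rfl⟩ : (δ : CSpace m d →ₗ[ℝ] CSpace m d).range) = b.equivFun.symm y :=
      Subtype.ext ht
    rw [h1, Module.Basis.coord_apply]
    exact congrFun (b.equivFun.apply_symm_apply y) l
  refine ⟨_, ℓ, hχa, fun q => ?_, ?_, fun y => ?_, fun y => ?_, ?_⟩
  · ext l
    rw [Pi.star_apply, hχ]
    show star (ℓ l (f q)) = ℓ l (f (sigma q))
    rw [hℓσ, hfσ]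
  · rw [hχ]
    have : f (pc p) = 0 := by
      simp only [f, hR.fixed, hR₂.fixed]
      rw [← two_smul ℂ, smul_smul]
      simp
    simp only [this, map_zero]
  · obtain ⟨t, ht⟩ := hsurj fun l => (y l).re
    obtain ⟨t', ht'⟩ := hsurj fun l => (y l).im
    refine ⟨pc t + Complex.I • pc t', ?_⟩
    ext l
    rw [hχd, map_add, map_add, map_smul, map_smul, hℓδ, hℓδ, ht, ht', smul_eq_mul, mul_comm,
      Complex.re_add_im]
  · obtain ⟨t, ht⟩ := hsurj y
    refine ⟨t, ?_⟩
    let S : (Fin (Module.finrank ℝ (δ : CSpace m d →ₗ[ℝ] CSpace m d).range) → ℂ) →L[ℝ]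
        (Fin (Module.finrank ℝ (δ : CSpace m d →ₗ[ℝ] CSpace m d).range) → ℝ) :=
      ContinuousLinearMap.pi fun l => Complex.reCLM.comp (ContinuousLinearMap.proj l)
    have h0 : HasFDerivAt (fun t => displacement ℓ R (pc t))
        (((fderiv ℂ (displacement ℓ R) (pc p)).restrictScalars ℝ).comp (pcL m d)) p :=
      (hχa.differentiableAt.hasFDerivAt.restrictScalars ℝ).comp p (pcL m d).hasFDerivAt
    have h1 : HasFDerivAt (fun t l => (displacement ℓ R (pc t) l).re)
        (S.comp (((fderiv ℂ (displacement ℓ R) (pc p)).restrictScalars ℝ).comp (pcL m d))) p :=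
      S.hasFDerivAt.comp p h0
    rw [h1.fderiv]
    ext l
    show (fderiv ℂ (displacement ℓ R) (pc p) (pc t) l).re = y l
    rw [hχd, hℓδ, ht, Complex.ofReal_re]
  · refine hR.eq_of_fderiv_ker_le hχa ?_ fun v hv => ?_
    · filter_upwards [hR.idem, h21] with q h1 h2
      have : f (R q) = 0 := by
        simp only [f, h1, h2]
        rw [← two_smul ℂ, smul_smul]
        simp
      rw [hχ]
      simp only [this, map_zero]
    · have h0 : D v = 0 := by
        obtain ⟨t, t', rfl⟩ := exists_pc_add_pc v
        have h1 : ∀ l, b.coord l ⟨δ t, t, rfl⟩ = 0 ∧ b.coord l ⟨δ t', t', rfl⟩ = 0 := fun l => by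
          have h2 := congrFun hv l
          rw [hχd, map_add, map_add, map_smul, map_smul, hℓδ, hℓδ, smul_eq_mul, mul_comm] at h2
          exact ⟨by simpa using congrArg Complex.re h2, by simpa using congrArg Complex.im h2⟩
        have h3 : δ t = 0 := congrArg Subtype.val (b.forall_coord_eq_zero_iff.1 fun l => (h1 l).1)
        have h4 : δ t' = 0 := congrArg Subtype.val (b.forall_coord_eq_zero_iff.1 fun l => (h1 l).2)
        have h5 : pc (0 : CSpace m d) = 0 := (pcL m d).map_zero
        rw [map_add, map_smul, hδ, hδ, h3, h4, h5, smul_zero, add_zero]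
      have h6 : P.comp P₂ = P₂ := hR.fderiv_comp hR₂ h12
      have h7 : P (P₂ v) = P₂ v := congrArg (fun A => A v) h6
      rw [hDP, sub_eq_zero] at h0
      -- From `D v = 0`, `v = (P v + P₂ v) / 2`; since `P P₂ = P₂`, this is `P` of the chosen
      -- vector.
      refine ⟨(1 / 2 : ℂ) • (v + P₂ v), ?_⟩
      show P _ = v
      rw [map_smul, map_add, h7]
      exact h0.symm

end RealEquations

/-! ### Algebraic dependence in integral domains -/

section AlgebraicDependence

/-- `a` is algebraic over the subalgebra generated by `s`. -/
def IsAlgebraicOver (k : Type) {A : Type} [Field k] [CommRing A] [Algebra k A] (s : Set A) (a : A) :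
    Prop :=
  IsAlgebraic (Algebra.adjoin k s) a

namespace IsAlgebraicOver

variable {k A : Type} [Field k] [CommRing A] [IsDomain A] [Algebra k A] {s t : Set A} {a b : A}

theorem of_mem_adjoin (h : a ∈ Algebra.adjoin k s) : IsAlgebraicOver k s a :=
  isAlgebraic_algebraMap (⟨a, h⟩ : Algebra.adjoin k s)

theorem add (ha : IsAlgebraicOver k s a) (hb : IsAlgebraicOver k s b) :
    IsAlgebraicOver k s (a + b) :=
  IsAlgebraic.add ha hb

theorem mul (ha : IsAlgebraicOver k s a) (hb : IsAlgebraicOver k s b) :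
    IsAlgebraicOver k s (a * b) :=
  IsAlgebraic.mul ha hb

theorem trans (ha : IsAlgebraicOver k s a) (h : ∀ b ∈ s, IsAlgebraicOver k t b) :
    IsAlgebraicOver k t a :=
  IsAlgebraic.adjoin_of_forall_isAlgebraic (fun b hb => h b hb.1) ha

end IsAlgebraicOver

/-- More elements than generators, all algebraic over them, are algebraically dependent. -/
theorem exists_aeval_eq_zero_of_card_lt {k A ι : Type} [Field k] [CommRing A] [IsDomain A]
    [Algebra k A] [Fintype ι] {n : ℕ} (a : Fin n → A) (hn : n < Fintype.card ι) (b : ι → A)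
    (hb : ∀ i, IsAlgebraicOver k (Set.range a) (b i)) :
    ∃ Q : MvPolynomial ι k, Q ≠ 0 ∧ MvPolynomial.aeval b Q = 0 := by
  by_contra! hcon
  have hind : AlgebraicIndependent k b := by
    rw [algebraicIndependent_iff]
    intro Q hQ
    by_contra h
    exact hcon Q h hQ
  -- Exchange argument in the matroid of algebraic independence: an independent set inside the
  -- closure of `n` elements has at most `n` elements.
  have h1 : (AlgebraicIndependent.matroid k A).Indep (Set.range b) := by
    rw [AlgebraicIndependent.matroid_indep_iff]
    exact hind.to_subtype_range
  have h2 : Set.range b ⊆ (AlgebraicIndependent.matroid k A).closure (Set.range a) := by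
    rw [AlgebraicIndependent.matroid_closure_eq]
    rintro _ ⟨i, rfl⟩
    exact hb i
  have h3 := h1.encard_le_eRk_of_subset h2
  rw [Matroid.eRk_closure_eq] at h3
  have h4 := h3.trans (Matroid.eRk_le_encard _ _)
  have h5 : (Set.range a).encard ≤ n := by
    rw [← Set.image_univ]
    refine (Set.encard_image_le _ _).trans ?_
    simp
  have h6 : (Set.range b).encard = Fintype.card ι := by
    rw [← Set.image_univ, hind.injective.injOn.encard_image]
    simp
  rw [h6] at h4
  have := h4.trans h5
  norm_cast at this
  omega

/-- A root of a polynomial with algebraic coefficients is algebraic. -/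
theorem isAlgebraicOver_of_aeval_eq_zero {k A ι : Type} [Field k] [CommRing A] [IsDomain A]
    [Algebra k A] {s : Set A} {c : ι → A} {f : A} {P : MvPolynomial (Option ι) k}
    (hc : ∀ i, IsAlgebraicOver k s (c i))
    (hP : MvPolynomial.aeval (fun o : Option ι => o.elim f c) P = 0) {T : k}
    (hT : MvPolynomial.aeval (fun o : Option ι => o.elim (algebraMap k A T) c) P ≠ 0) :
    IsAlgebraicOver k s f := by
  have h1 : IsAlgebraicOver k (Set.range c) f := by
    let c' : ι → Algebra.adjoin k (Set.range c) :=
      fun i => ⟨c i, Algebra.subset_adjoin ⟨i, rfl⟩⟩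
    let p : Polynomial (Algebra.adjoin k (Set.range c)) :=
      MvPolynomial.aeval (fun o : Option ι => o.elim Polynomial.X fun i => Polynomial.C (c' i)) P
    have hp : ∀ g : A, Polynomial.aeval g p =
        MvPolynomial.aeval (fun o : Option ι => o.elim g c) P := fun g => by
      have := MvPolynomial.comp_aeval_apply (R := k)
        (fun o : Option ι => o.elim Polynomial.X fun i => Polynomial.C (c' i))
        ((Polynomial.aeval (R := Algebra.adjoin k (Set.range c)) g).restrictScalars k) P
      refine this.trans ?_
      congr 2
      ext o
      cases o with
      | none => simp
      | some i => simp [c']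
    refine ⟨p, fun h => hT ?_, ?_⟩
    · rw [← hp, h, map_zero]
    · rw [hp, hP]
  refine h1.trans ?_
  rintro _ ⟨i, rfl⟩
  exact hc i

end AlgebraicDependence

/-! ### The integral domain of analytic germs -/

section Germs

variable (𝕜 L : Type) [RCLike 𝕜] [RCLike L] [NormedAlgebra 𝕜 L] {E : Type} [NormedAddCommGroup E]
  [NormedSpace 𝕜 E]

/-- The `L`-valued functions that are analytic at `x`. -/
def analyticFunctions (x : E) : Subalgebra L (E → L) where
  carrier := {f | AnalyticAt 𝕜 f x}
  mul_mem' := fun hf hg => AnalyticAt.mul hf hg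
  add_mem' := fun hf hg => AnalyticAt.add hf hg
  algebraMap_mem' := fun _ => analyticAt_const

/-- The functions with vanishing germ. -/
def germIdeal (x : E) : Ideal (analyticFunctions 𝕜 L x) where
  carrier := {f | ∀ᶠ y in 𝓝 x, f.1 y = 0}
  add_mem' := fun {f g} hf hg => by
    filter_upwards [hf, hg] with y h1 h2
    show f.1 y + g.1 y = 0
    rw [h1, h2, add_zero]
  zero_mem' := Eventually.of_forall fun _ => rfl
  smul_mem' := fun f g hg => by
    filter_upwards [hg] with y h
    show f.1 y * g.1 y = 0
    rw [h, mul_zero]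

/-- If `f` is nonzero at a point of a ball, `g` vanishes near that point, hence on the whole ball by
analytic continuation. This makes the ring of germs a domain. -/
theorem eventually_eq_zero_or_of_mul {x : E} {f g : E → L} (hf : AnalyticAt 𝕜 f x)
    (hg : AnalyticAt 𝕜 g x) (h : ∀ᶠ y in 𝓝 x, f y * g y = 0) :
    (∀ᶠ y in 𝓝 x, f y = 0) ∨ ∀ᶠ y in 𝓝 x, g y = 0 := by
  let _ : NormedSpace ℝ E := NormedSpace.restrictScalars ℝ 𝕜 E
  obtain ⟨ε, hε, hB⟩ := Metric.eventually_nhds_iff_ball.1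
    ((hf.eventually_analyticAt.and hg.eventually_analyticAt).and h)
  by_cases hf0 : ∀ y ∈ ball x ε, f y = 0
  · exact Or.inl (eventually_nhds_iff_ball.2 ⟨ε, hε, hf0⟩)
  right
  push Not at hf0
  obtain ⟨y, hy, hfy⟩ := hf0
  have h1 : g =ᶠ[𝓝 y] 0 := by
    filter_upwards [isOpen_ball.mem_nhds hy, (hB y hy).1.1.continuousAt.eventually_ne hfy]
      with z hz hfz
    exact (mul_eq_zero.1 (hB z hz).2).resolve_left hfz
  have h2 := AnalyticOnNhd.eqOn_zero_of_preconnected_of_eventuallyEq_zero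
    (fun z hz => (hB z hz).1.2) (convex_ball x ε).isPreconnected hy h1
  exact eventually_nhds_iff_ball.2 ⟨ε, hε, fun z hz => h2 hz⟩

instance (x : E) : (germIdeal 𝕜 L x).IsPrime where
  ne_top' := fun h => by
    have h1 : (1 : analyticFunctions 𝕜 L x) ∈ germIdeal 𝕜 L x := h ▸ Submodule.mem_top
    exact one_ne_zero (Eventually.self_of_nhds (p := fun y => (1 : E → L) y = 0) h1)
  mem_or_mem' := fun {f g} h => eventually_eq_zero_or_of_mul 𝕜 L f.2 g.2 h

/-- The ring of germs at `x` of `L`-valued analytic functions. -/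
def AnalyticGerm (x : E) : Type := analyticFunctions 𝕜 L x ⧸ germIdeal 𝕜 L x

noncomputable instance (x : E) : CommRing (AnalyticGerm 𝕜 L x) :=
  inferInstanceAs (CommRing (analyticFunctions 𝕜 L x ⧸ germIdeal 𝕜 L x))

noncomputable instance (x : E) : Algebra L (AnalyticGerm 𝕜 L x) :=
  inferInstanceAs (Algebra L (analyticFunctions 𝕜 L x ⧸ germIdeal 𝕜 L x))

instance (x : E) : IsDomain (AnalyticGerm 𝕜 L x) :=
  inferInstanceAs (IsDomain (analyticFunctions 𝕜 L x ⧸ germIdeal 𝕜 L x))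

variable {L}

/-- The germ of an analytic function. -/
def germ {x : E} {f : E → L} (hf : AnalyticAt 𝕜 f x) : AnalyticGerm 𝕜 L x :=
  Ideal.Quotient.mk _ ⟨f, hf⟩

variable {𝕜}

theorem germ_eq_zero {x : E} {f : E → L} (hf : AnalyticAt 𝕜 f x) :
    germ 𝕜 hf = 0 ↔ ∀ᶠ y in 𝓝 x, f y = 0 :=
  Ideal.Quotient.eq_zero_iff_mem

theorem germ_congr {x : E} {f g : E → L} (hf : AnalyticAt 𝕜 f x) (hg : AnalyticAt 𝕜 g x)
    (h : ∀ᶠ y in 𝓝 x, f y = g y) : germ 𝕜 hf = germ 𝕜 hg := by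
  refine Ideal.Quotient.eq.2 ?_
  show ∀ᶠ y in 𝓝 x, f y - g y = 0
  exact h.mono fun y hy => sub_eq_zero.2 hy

theorem germ_add {x : E} {f g : E → L} (hf : AnalyticAt 𝕜 f x) (hg : AnalyticAt 𝕜 g x) :
    germ 𝕜 (hf.add hg) = germ 𝕜 hf + germ 𝕜 hg := rfl

theorem germ_mul {x : E} {f g : E → L} (hf : AnalyticAt 𝕜 f x) (hg : AnalyticAt 𝕜 g x) :
    germ 𝕜 (hf.mul hg) = germ 𝕜 hf * germ 𝕜 hg := rfl

theorem germ_const {x : E} (c : L) :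
    germ 𝕜 (analyticAt_const (v := c) : AnalyticAt 𝕜 (fun _ : E => c) x) =
      algebraMap L (AnalyticGerm 𝕜 L x) c := rfl

theorem analyticAt_eval {x : E} {ι : Type} {f : ι → E → L} (hf : ∀ i, AnalyticAt 𝕜 (f i) x)
    (P : MvPolynomial ι L) : AnalyticAt 𝕜 (fun y => MvPolynomial.eval (fun i => f i y) P) x := by
  induction P using MvPolynomial.induction_on with
  | C a => simpa using analyticAt_const
  | add p q hp hq =>
    simp only [map_add]
    exact hp.add hq
  | mul_X p i hp =>
    simp only [map_mul, MvPolynomial.eval_X]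
    exact hp.mul (hf i)

theorem aeval_germ {x : E} {ι : Type} {f : ι → E → L} (hf : ∀ i, AnalyticAt 𝕜 (f i) x)
    (P : MvPolynomial ι L) :
    MvPolynomial.aeval (fun i => germ 𝕜 (hf i)) P = germ 𝕜 (analyticAt_eval hf P) := by
  induction P using MvPolynomial.induction_on with
  | C a =>
    rw [MvPolynomial.aeval_C, ← germ_const]
    exact germ_congr _ _ (Eventually.of_forall fun y => (MvPolynomial.eval_C a).symm)
  | add p q hp hq =>
    rw [map_add, hp, hq, ← germ_add]
    exact germ_congr _ _ (Eventually.of_forall fun y => (map_add _ p q).symm)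
  | mul_X p i hp =>
    rw [map_mul, hp, MvPolynomial.aeval_X, ← germ_mul]
    exact germ_congr _ _ (Eventually.of_forall fun y => by simp)

theorem eventually_eval_eq_zero_iff {x : E} {ι : Type} {f : ι → E → L}
    (hf : ∀ i, AnalyticAt 𝕜 (f i) x) (P : MvPolynomial ι L) :
    MvPolynomial.aeval (fun i => germ 𝕜 (hf i)) P = 0 ↔
      ∀ᶠ y in 𝓝 x, MvPolynomial.eval (fun i => f i y) P = 0 := by
  rw [aeval_germ, germ_eq_zero]

end Germs

/-! ### Nash germs as germs algebraic over the linear functionals -/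

section Nash

variable {𝕜 L : Type} [RCLike 𝕜] [RCLike L] [NormedAlgebra 𝕜 L] {E : Type} [NormedAddCommGroup E]
  [NormedSpace 𝕜 E]

theorem isAlgebraicOver_germ {x : E} {s : Set (AnalyticGerm 𝕜 L x)} {ι : Type} {c : ι → E → L}
    (hca : ∀ i, AnalyticAt 𝕜 (c i) x)
    (hc : ∀ i, IsAlgebraicOver L s (germ 𝕜 (hca i))) {f : E → L}
    (hf : AnalyticAt 𝕜 f x) {P : MvPolynomial (Option ι) L}
    (hP : ∀ᶠ y in 𝓝 x, MvPolynomial.eval (fun o => o.elim (f y) (fun i => c i y)) P = 0) {T : L}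
    (hT : ¬ ∀ᶠ y in 𝓝 x, MvPolynomial.eval (fun o => o.elim T (fun i => c i y)) P = 0) :
    IsAlgebraicOver L s (germ 𝕜 hf) := by
  have key : ∀ {g : E → L} (hg : AnalyticAt 𝕜 g x),
      MvPolynomial.aeval (fun o : Option ι => o.elim (germ 𝕜 hg) fun i => germ 𝕜 (hca i)) P = 0 ↔
        ∀ᶠ y in 𝓝 x, MvPolynomial.eval (fun o => o.elim (g y) (fun i => c i y)) P = 0 := by
    intro g hg
    have h1 : ∀ o : Option ι, AnalyticAt 𝕜 (fun y => o.elim (g y) (fun i => c i y)) x := by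
      rintro (_ | i)
      · exact hg
      · exact hca i
    rw [← eventually_eval_eq_zero_iff h1]
    have h2 : (fun o : Option ι => o.elim (germ 𝕜 hg) fun i => germ 𝕜 (hca i)) =
        fun o => germ 𝕜 (h1 o) := by
      ext o
      cases o <;> rfl
    rw [h2]
  refine isAlgebraicOver_of_aeval_eq_zero (k := L) hc ((key hf).2 hP) (T := T) ?_
  rw [← germ_const, Ne, key]
  exact hT

variable (𝕜) in
/-- The germ of `f` at `x` is analytic and algebraic over the polynomials in the linear
functionals. -/
def IsNashAt (f : E → L) (x : E) : Prop :=
  ∃ hf : AnalyticAt 𝕜 f x, IsAlgebraicOver L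
    (Set.range fun T : E →L[𝕜] L => germ 𝕜 (T.analyticAt x)) (germ 𝕜 hf)

namespace IsNashAt

variable {x : E} {f g : E → L}

theorem linear (T : E →L[𝕜] L) : IsNashAt 𝕜 (fun y => T y) x :=
  ⟨T.analyticAt x, .of_mem_adjoin (Algebra.subset_adjoin ⟨T, rfl⟩)⟩

theorem const (c : L) : IsNashAt 𝕜 (fun _ : E => c) x :=
  ⟨analyticAt_const, by
    rw [germ_const]
    exact .of_mem_adjoin (Subalgebra.algebraMap_mem _ _)⟩

theorem add (hf : IsNashAt 𝕜 f x) (hg : IsNashAt 𝕜 g x) : IsNashAt 𝕜 (fun y => f y + g y) x :=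
  ⟨hf.1.add hg.1, hf.2.add hg.2⟩

theorem mul (hf : IsNashAt 𝕜 f x) (hg : IsNashAt 𝕜 g x) : IsNashAt 𝕜 (fun y => f y * g y) x :=
  ⟨hf.1.mul hg.1, hf.2.mul hg.2⟩

theorem congr (hf : IsNashAt 𝕜 f x) (h : ∀ᶠ y in 𝓝 x, f y = g y) : IsNashAt 𝕜 g x := by
  have h1 : AnalyticAt 𝕜 g x := hf.1.congr h
  refine ⟨h1, ?_⟩
  rw [← germ_congr hf.1 h1 h]
  exact hf.2

theorem sum {ι : Type} (s : Finset ι) {f : ι → E → L} (h : ∀ i ∈ s, IsNashAt 𝕜 (f i) x) :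
    IsNashAt 𝕜 (fun y => ∑ i ∈ s, f i y) x := by
  classical
  induction s using Finset.induction_on with
  | empty => simpa using const (0 : L)
  | insert a s ha ih =>
    simp only [Finset.sum_insert ha]
    exact (h a (Finset.mem_insert_self a s)).add
      (ih fun i hi => h i (Finset.mem_insert_of_mem hi))

theorem root {ι : Type} {c : ι → E → L} (hc : ∀ i, IsNashAt 𝕜 (c i) x)
    (hf : AnalyticAt 𝕜 f x) {P : MvPolynomial (Option ι) L}
    (hP : ∀ᶠ y in 𝓝 x, MvPolynomial.eval (fun o => o.elim (f y) (fun i => c i y)) P = 0) {T : L}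
    (hT : ¬ ∀ᶠ y in 𝓝 x, MvPolynomial.eval (fun o => o.elim T (fun i => c i y)) P = 0) :
    IsNashAt 𝕜 f x :=
  ⟨hf, isAlgebraicOver_germ (fun i => (hc i).1) (fun i => (hc i).2) hf hP hT⟩

/-- Transcendence degree: all linear functionals are polynomials in `dim E` coordinates, so more
than `dim E` Nash germs are algebraically dependent. -/
theorem exists_polynomial [FiniteDimensional 𝕜 E] {ι : Type} [Fintype ι] {b : ι → E → L}
    (hb : ∀ i, IsNashAt 𝕜 (b i) x) (hcard : Module.finrank 𝕜 E < Fintype.card ι) :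
    ∃ Q : MvPolynomial ι L, Q ≠ 0 ∧ ∀ᶠ y in 𝓝 x, MvPolynomial.eval (fun i => b i y) Q = 0 := by
  let B := Module.finBasis 𝕜 E
  let e : Fin (Module.finrank 𝕜 E) → E →L[𝕜] L := fun i =>
    (ContinuousLinearMap.toSpanSingleton 𝕜 (1 : L)).comp (LinearMap.toContinuousLinearMap (B.coord i))
  have hle : Algebra.adjoin L (Set.range fun T : E →L[𝕜] L => germ 𝕜 (T.analyticAt x)) ≤
      Algebra.adjoin L (Set.range fun i => germ 𝕜 ((e i).analyticAt x)) := by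
    refine Algebra.adjoin_le ?_
    rintro _ ⟨T, rfl⟩
    have h0 : ∀ i, AnalyticAt 𝕜 (fun y => T (B i) * e i y) x := fun i =>
      analyticAt_const.mul ((e i).analyticAt x)
    have h1 : ∀ s : Finset (Fin (Module.finrank 𝕜 E)),
        germ 𝕜 (Finset.analyticAt_fun_sum s fun i _ => h0 i) =
          ∑ i ∈ s, algebraMap L (AnalyticGerm 𝕜 L x) (T (B i)) * germ 𝕜 ((e i).analyticAt x) := by
      intro s
      induction s using Finset.induction_on with
      | empty =>
        rw [Finset.sum_empty, germ_eq_zero]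
        exact Eventually.of_forall fun y => by simp
      | insert a s ha ih =>
        rw [Finset.sum_insert ha, ← ih, ← germ_const, ← germ_mul, ← germ_add]
        exact germ_congr _ _ (Eventually.of_forall fun y => by simp [Finset.sum_insert ha])
    have h2 : germ 𝕜 (T.analyticAt x) = germ 𝕜 (Finset.analyticAt_fun_sum
        (Finset.univ : Finset (Fin (Module.finrank 𝕜 E))) fun i _ => h0 i) := by
      refine germ_congr _ _ (Eventually.of_forall fun y => ?_)
      conv_lhs => rw [← B.sum_repr y, map_sum]
      refine Finset.sum_congr rfl fun i _ => ?_
      rw [map_smul]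
      simp [e, ContinuousLinearMap.toSpanSingleton_apply]
    show germ 𝕜 (T.analyticAt x) ∈ _
    rw [h2, h1]
    refine Subalgebra.sum_mem _ fun i _ => Subalgebra.mul_mem _ (Subalgebra.algebraMap_mem _ _)
      (Algebra.subset_adjoin ⟨i, rfl⟩)
  obtain ⟨Q, hQ0, hQ⟩ := exists_aeval_eq_zero_of_card_lt (k := L)
    (fun i => germ 𝕜 ((e i).analyticAt x)) hcard (fun i => germ 𝕜 (hb i).1) (fun i =>
      (hb i).2.trans fun y hy => by
        obtain ⟨T, rfl⟩ := hy
        exact .of_mem_adjoin (hle (Algebra.subset_adjoin ⟨T, rfl⟩)))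
  exact ⟨Q, hQ0, (eventually_eval_eq_zero_iff (fun i => (hb i).1) Q).1 hQ⟩

end IsNashAt

theorem eq_zero_of_eventually_eval_eq_zero {n : ℕ} (b : Module.Basis (Fin n) 𝕜 E) {x : E}
    {p : MvPolynomial (Fin n) 𝕜}
    (h : ∀ᶠ y in 𝓝 x, MvPolynomial.eval (fun i => b.repr y i) p = 0) : p = 0 := by
  have := Module.Finite.of_basis b
  let _ : NormedSpace ℝ E := NormedSpace.restrictScalars ℝ 𝕜 E
  have h1 : AnalyticOnNhd 𝕜 (fun y => MvPolynomial.eval (fun i => b.repr y i) p) Set.univ :=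
    fun y _ => analyticAt_eval (fun i => (LinearMap.toContinuousLinearMap (b.coord i)).analyticAt y) p
  have h2 := h1.eqOn_zero_of_preconnected_of_eventuallyEq_zero isPreconnected_univ
    (Set.mem_univ x) h
  refine MvPolynomial.funext fun v => ?_
  have h3 := h2 (Set.mem_univ (b.equivFun.symm v))
  have h4 : (fun i => b.repr (b.equivFun.symm v) i) = v := b.equivFun.apply_symm_apply v
  simp only [h4] at h3
  rw [h3, map_zero]
  rfl

/-- A polynomial vanishing for every constant value of the distinguished variable and all nearby
points vanishes everywhere. The `T` found here certifies nontriviality of a relation after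
substitution. -/
theorem exists_not_eventually_eval_eq_zero {n : ℕ} (b : Module.Basis (Fin n) 𝕜 E) (x : E)
    {P : MvPolynomial (Option (Fin n)) 𝕜} (hP : P ≠ 0) : ∃ T : 𝕜, ¬ ∀ᶠ y in 𝓝 x,
      MvPolynomial.eval (fun o => o.elim T (fun i => b.repr y i)) P = 0 := by
  by_contra! hcon
  refine hP (MvPolynomial.funext fun v => ?_)
  rw [map_zero]
  let p : MvPolynomial (Fin n) 𝕜 :=
    MvPolynomial.aeval (fun o : Option (Fin n) => o.elim (MvPolynomial.C (v none)) MvPolynomial.X) P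
  have hp : ∀ w : Fin n → 𝕜, MvPolynomial.eval w p =
      MvPolynomial.eval (fun o => o.elim (v none) w) P := fun w => by
    have := MvPolynomial.comp_aeval_apply (R := 𝕜)
      (fun o : Option (Fin n) => o.elim (MvPolynomial.C (v none)) MvPolynomial.X)
      (MvPolynomial.aeval w) P
    rw [← MvPolynomial.aeval_eq_eval, ← MvPolynomial.aeval_eq_eval]
    refine this.trans ?_
    congr 2
    ext o
    cases o <;> simp
  have h1 : p = 0 := eq_zero_of_eventually_eval_eq_zero b (x := x) (by simpa only [hp] using hcon (v none))
  have h2 := hp fun i => v (some i)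
  rw [h1, map_zero] at h2
  rw [h2]
  congr 2
  ext o
  cases o <;> rfl

theorem eval_map_ringHom {R S ι : Type} [CommSemiring R] [CommSemiring S] (φ : R →+* S) (v : ι → R)
    (P : MvPolynomial ι R) :
    MvPolynomial.eval (fun i => φ (v i)) (MvPolynomial.map φ P) = φ (MvPolynomial.eval v P) := by
  rw [MvPolynomial.eval_map]
  exact (MvPolynomial.eval₂_comp φ v P).symm

-- Passage from an explicit relation to algebraicity over a ring, where sums and products are
-- immediate. Allowing `L` larger than `𝕜` accommodates complex-valued germs on real spaces.
variable (L) in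
theorem IsAlgebraicAt.isNashAt {f : E → 𝕜} {x : E} (hf : IsAlgebraicAt 𝕜 f x) :
    IsNashAt 𝕜 (fun y => algebraMap 𝕜 L (f y)) x := by
  obtain ⟨hfa, n, b, P, hP, hPf⟩ := hf
  have := Module.Finite.of_basis b
  obtain ⟨T, hT⟩ := exists_not_eventually_eval_eq_zero b x hP
  let A : 𝕜 →L[𝕜] L := ContinuousLinearMap.toSpanSingleton 𝕜 (1 : L)
  have hA : ∀ a, A a = algebraMap 𝕜 L a := fun a => by
    simp [A, ContinuousLinearMap.toSpanSingleton_apply, Algebra.algebraMap_eq_smul_one]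
  have hfa' : AnalyticAt 𝕜 (fun y => algebraMap 𝕜 L (f y)) x := by
    simp only [← hA]
    exact (A.analyticAt _).comp hfa
  refine IsNashAt.root (c := fun i y => algebraMap 𝕜 L (b.repr y i)) (fun i => ?_) hfa'
    (P := MvPolynomial.map (algebraMap 𝕜 L) P) ?_ (T := algebraMap 𝕜 L T) ?_
  · simp only [← hA]
    exact IsNashAt.linear (A.comp (LinearMap.toContinuousLinearMap (b.coord i)))
  · filter_upwards [hPf] with y hy
    have h1 := eval_map_ringHom (algebraMap 𝕜 L) (fun o => o.elim (f y) (fun i => b.repr y i)) P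
    rw [hy, map_zero] at h1
    rw [← h1]
    congr 2
    ext o
    cases o <;> rfl
  · intro h
    refine hT (h.mono fun y hy => ?_)
    have h1 := eval_map_ringHom (algebraMap 𝕜 L) (fun o => o.elim T (fun i => b.repr y i)) P
    refine (algebraMap 𝕜 L).injective ?_
    rw [← h1, map_zero, ← hy]
    congr 2
    ext o
    cases o <;> rfl

theorem IsNashAt.exists_polynomial_of_basis {n : ℕ} {f : E → L} {x : E} (hf : IsNashAt 𝕜 f x)
    (b : Module.Basis (Fin n) 𝕜 E) : ∃ P : MvPolynomial (Option (Fin n)) L, P ≠ 0 ∧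
      ∀ᶠ y in 𝓝 x, MvPolynomial.eval
        (fun o => o.elim (f y) (fun i => algebraMap 𝕜 L (b.repr y i))) P = 0 := by
  have := Module.Finite.of_basis b
  have h1 := IsNashAt.exists_polynomial (𝕜 := 𝕜) (L := L) (x := x)
    (b := fun (o : Option (Fin n)) y => o.elim (f y) (fun i => algebraMap 𝕜 L (b.repr y i)))
    (by
      rintro (_ | i)
      · exact hf
      · refine (IsNashAt.linear ((ContinuousLinearMap.toSpanSingleton 𝕜 (1 : L)).comp
          (LinearMap.toContinuousLinearMap (b.coord i)))).congr (Eventually.of_forall fun y => ?_)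
        simp [ContinuousLinearMap.toSpanSingleton_apply, Algebra.algebraMap_eq_smul_one])
    (by simp [Module.finrank_eq_card_basis b])
  exact h1

theorem IsNashAt.isAlgebraicAt [FiniteDimensional 𝕜 E] {f : E → 𝕜} {x : E} (hf : IsNashAt 𝕜 f x) :
    IsAlgebraicAt 𝕜 f x := by
  obtain ⟨P, hP0, hP⟩ := hf.exists_polynomial_of_basis (Module.finBasis 𝕜 E)
  refine ⟨hf.1, _, Module.finBasis 𝕜 E, P, hP0, hP.mono fun y hy => ?_⟩
  simpa only [Algebra.algebraMap_self, RingHom.id_apply] using hy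

end Nash

/-! ### Composition of algebraic functions -/

section Composition

variable {𝕜 : Type} [RCLike 𝕜] {E F : Type} [NormedAddCommGroup E] [NormedSpace 𝕜 E]
  [NormedAddCommGroup F] [NormedSpace 𝕜 F]

/-- Setting `s = 0` in a relation could make it trivial. Divide first by the largest power of `s`:
the quotient relation holds for `s ≠ 0`, then at `s = 0` by continuity, where it is nontrivial. -/
theorem IsNashAt.restrict [FiniteDimensional 𝕜 E] {h : E × 𝕜 → 𝕜} {x : E}
    (hh : IsNashAt 𝕜 h (x, 0)) : IsAlgebraicAt 𝕜 (fun y => h (y, 0)) x := by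
  let b := Module.finBasis 𝕜 E
  let v : Option (Fin (Module.finrank 𝕜 E)) → E × 𝕜 → 𝕜 :=
    fun o z => o.elim (h z) (fun i => b.repr z.1 i)
  let u : Option (Option (Fin (Module.finrank 𝕜 E))) → E × 𝕜 → 𝕜 :=
    fun o z => o.elim z.2 (fun o => v o z)
  have hv : ∀ o, IsNashAt 𝕜 (v o) (x, 0) := by
    rintro (_ | i)
    · exact hh
    · exact IsNashAt.linear ((LinearMap.toContinuousLinearMap (b.coord i)).comp
        (ContinuousLinearMap.fst 𝕜 E 𝕜))
  have hu : ∀ o, IsNashAt 𝕜 (u o) (x, 0) := by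
    rintro (_ | o)
    · exact IsNashAt.linear (ContinuousLinearMap.snd 𝕜 E 𝕜)
    · exact hv o
  -- The time `s`, the coordinates of `E` and `h` are `dim E + 2` germs on a space of dimension `dim
  -- E + 1`.
  obtain ⟨Q, hQ0, hQ⟩ := IsNashAt.exists_polynomial hu (by simp [Module.finrank_prod])
  set p := MvPolynomial.optionEquivLeft 𝕜 _ Q with hp
  have hp0 : p ≠ 0 := by
    rw [hp, Ne, EmbeddingLike.map_eq_zero_iff]
    exact hQ0
  obtain ⟨q, hpq, hq⟩ := Polynomial.exists_eq_pow_rootMultiplicity_mul_and_not_dvd p hp0 0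
  set k := Polynomial.rootMultiplicity 0 p
  rw [map_zero, sub_zero] at hpq hq
  rw [Polynomial.X_dvd_iff] at hq
  let Q' := (MvPolynomial.optionEquivLeft 𝕜 _).symm q
  have hQ' : MvPolynomial.optionEquivLeft 𝕜 _ Q' = q := AlgEquiv.apply_symm_apply _ q
  have hmul : ∀ z : E × 𝕜, MvPolynomial.eval (fun o => u o z) Q =
      z.2 ^ k * MvPolynomial.eval (fun o => u o z) Q' := fun z => by
    rw [MvPolynomial.optionEquivLeft_elim_eval _ _ (fun o => v o z) z.2 Q, MvPolynomial.optionEquivLeft_elim_eval _ _ (fun o => v o z) z.2 Q',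
      hQ', ← hp, hpq]
    simp
  have hi : Tendsto (fun y : E => (y, (0 : 𝕜))) (𝓝 x) (𝓝 (x, 0)) :=
    (continuous_id.prodMk continuous_const).tendsto x
  refine ⟨AnalyticAt.fun_comp (f := fun y : E => (y, (0 : 𝕜))) hh.1
    (analyticAt_id.prod analyticAt_const), _, b, q.coeff 0, hq, ?_⟩
  filter_upwards [hi.eventually hQ.eventually_nhds, hi.eventually hh.1.eventually_analyticAt]
    with y h1 h2
  have hj : Tendsto (fun s : 𝕜 => (y, s)) (𝓝 0) (𝓝 (y, 0)) :=
    (continuous_const.prodMk continuous_id).tendsto 0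
  have hcont : ContinuousAt (fun s : 𝕜 => MvPolynomial.eval (fun o => u o (y, s)) Q') 0 := by
    have h3 : AnalyticAt 𝕜 (fun z => MvPolynomial.eval (fun o => u o z) Q') (y, 0) := by
      refine analyticAt_eval ?_ Q'
      rintro (_ | _ | i)
      · exact analyticAt_snd
      · exact h2
      · exact ((LinearMap.toContinuousLinearMap (b.coord i)).comp
        (ContinuousLinearMap.fst 𝕜 E 𝕜)).analyticAt (y, 0)
    exact ContinuousAt.comp (g := fun z => MvPolynomial.eval (fun o => u o z) Q')
      h3.continuousAt hj
  have hzero : ∀ᶠ s in 𝓝[≠] (0 : 𝕜), MvPolynomial.eval (fun o => u o (y, s)) Q' = 0 := by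
    filter_upwards [nhdsWithin_le_nhds (hj.eventually h1), self_mem_nhdsWithin] with s h3 h4
    rw [hmul] at h3
    exact (mul_eq_zero.1 h3).resolve_left (pow_ne_zero _ h4)
  have h5 : MvPolynomial.eval (fun o => u o (y, 0)) Q' = 0 :=
    tendsto_nhds_unique (hcont.tendsto.mono_left nhdsWithin_le_nhds)
      (tendsto_const_nhds.congr' (hzero.mono fun s hs => hs.symm))
  have h6 := MvPolynomial.optionEquivLeft_elim_eval _ _ (fun o => v o (y, 0)) 0 Q'
  rw [hQ', ← Polynomial.coeff_zero_eq_eval_zero, Polynomial.coeff_map] at h6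
  exact h6.symm.trans h5

theorem IsNashAt.comp_of_isOpenMap {T : E →L[𝕜] F} (hT : IsOpenMap T) {f : F → 𝕜} {x : E}
    (hf : IsAlgebraicAt 𝕜 f (T x)) : IsNashAt 𝕜 (fun y => f (T y)) x := by
  obtain ⟨hfa, n, b, P, hP0, hP⟩ := hf
  have := Module.Finite.of_basis b
  obtain ⟨a, ha⟩ := exists_not_eventually_eval_eq_zero b (T x) hP0
  refine IsNashAt.root (c := fun i y => b.repr (T y) i) (fun i =>
    IsNashAt.linear ((LinearMap.toContinuousLinearMap (b.coord i)).comp T))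
    (hfa.comp (T.analyticAt x)) (P := P) ((T.continuous.tendsto x).eventually hP) (T := a) ?_
  intro h
  exact ha (hT.nhds_le x h)

/-- The relation for `f` may degenerate along the image of `g`. Moving `g` by `s • c` towards a
point where the relation is nontrivial restores it in the variables `(y, s)`; `IsNashAt.restrict`
returns to `s = 0`. -/
theorem IsAlgebraicAt.comp [FiniteDimensional 𝕜 E] {f : F → 𝕜} {g : E → F} {x : E}
    (hf : IsAlgebraicAt 𝕜 f (g x)) (hg : AnalyticAt 𝕜 g x)
    (hgT : ∀ T : F →L[𝕜] 𝕜, IsAlgebraicAt 𝕜 (fun y => T (g y)) x) :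
    IsAlgebraicAt 𝕜 (fun y => f (g y)) x := by
  obtain ⟨hfa, n, b, P, hP0, hP⟩ := hf
  have := Module.Finite.of_basis b
  obtain ⟨v, hv⟩ : ∃ v, MvPolynomial.eval v P ≠ 0 := by
    by_contra! hcon
    exact hP0 (MvPolynomial.funext fun v => by rw [hcon v, map_zero])
  let c : F := b.equivFun.symm (fun i => v (some i)) - g x
  let G : E × 𝕜 → F := fun z => g z.1 + z.2 • c
  have hG : AnalyticAt 𝕜 G (x, 0) :=
    (AnalyticAt.fun_comp (g := g) (f := Prod.fst) (x := (x, (0 : 𝕜))) hg analyticAt_fst).add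
      (analyticAt_snd.smul analyticAt_const)
  have hG0 : G (x, 0) = g x := by simp [G]
  have hGt : Tendsto G (𝓝 (x, 0)) (𝓝 (g x)) := by
    have := hG.continuousAt.tendsto
    rwa [hG0] at this
  have hh : IsNashAt 𝕜 (fun z => f (G z)) (x, 0) := by
    refine IsNashAt.root (c := fun i z => b.repr (G z) i) (fun i => ?_)
      (AnalyticAt.fun_comp (g := f) (by rwa [hG0]) hG) (P := P) (hGt.eventually hP)
      (T := v none) ?_
    · let T : F →L[𝕜] 𝕜 := LinearMap.toContinuousLinearMap (b.coord i)
      have h1 : IsNashAt 𝕜 (fun z : E × 𝕜 => T (g z.1)) (x, 0) :=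
        IsNashAt.comp_of_isOpenMap (T := ContinuousLinearMap.fst 𝕜 E 𝕜) isOpenMap_fst
          (f := fun y => T (g y)) (hgT T)
      have h2 : IsNashAt 𝕜 (fun z : E × 𝕜 => z.2 * T c) (x, 0) :=
        (IsNashAt.linear (ContinuousLinearMap.snd 𝕜 E 𝕜)).mul (IsNashAt.const (T c))
      refine (h1.add h2).congr (Eventually.of_forall fun z => ?_)
      show T (g z.1) + z.2 * T c = T (g z.1 + z.2 • c)
      rw [map_add, map_smul, smul_eq_mul]
    · intro h
      have hj : Tendsto (fun s : 𝕜 => (x, s)) (𝓝 0) (𝓝 (x, 0)) :=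
        (continuous_const.prodMk continuous_id).tendsto 0
      have h1 : AnalyticOnNhd 𝕜 (fun s : 𝕜 => MvPolynomial.eval
          (fun o : Option (Fin n) => o.elim (v none) (fun i => b.repr (G (x, s)) i)) P)
          Set.univ := by
        intro s _
        refine analyticAt_eval (f := fun (o : Option (Fin n)) (s : 𝕜) =>
          o.elim (v none) (fun i => b.repr (G (x, s)) i)) ?_ P
        rintro (_ | i)
        · exact analyticAt_const
        · have hc : AnalyticAt 𝕜 (fun s : 𝕜 => G (x, s)) s := by
            show AnalyticAt 𝕜 (fun s : 𝕜 => g x + s • c) s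
            exact analyticAt_const.add (analyticAt_id.smul analyticAt_const)
          exact ((LinearMap.toContinuousLinearMap (b.coord i)).analyticAt _).comp hc
      let _ : NormedSpace ℝ 𝕜 := NormedSpace.restrictScalars ℝ 𝕜 𝕜
      have h2 := h1.eqOn_zero_of_preconnected_of_eventuallyEq_zero isPreconnected_univ
        (Set.mem_univ 0) (hj.eventually h)
      have h3 := h2 (Set.mem_univ 1)
      refine hv ?_
      have h4 : G (x, 1) = b.equivFun.symm (fun i => v (some i)) := by simp [G, c]
      have h5 : (fun o : Option (Fin n) => o.elim (v none) (fun i => b.repr (G (x, 1)) i)) = v := by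
        ext o
        cases o with
        | none => rfl
        | some i =>
          rw [h4]
          exact congrFun (b.equivFun.apply_symm_apply fun i => v (some i)) i
      simp only [h5] at h3
      exact h3
  have := hh.restrict
  simpa [G] using this

end Composition

/-! ### Algebraic maps and their local inverses -/

section AlgebraicMaps

variable {𝕜 : Type} [RCLike 𝕜] {E F G : Type} [NormedAddCommGroup E] [NormedSpace 𝕜 E]
  [NormedAddCommGroup F] [NormedSpace 𝕜 F] [NormedAddCommGroup G] [NormedSpace 𝕜 G]

theorem IsAlgebraicAt.eventually {f : E → 𝕜} {x : E} (hf : IsAlgebraicAt 𝕜 f x) :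
    ∀ᶠ y in 𝓝 x, IsAlgebraicAt 𝕜 f y := by
  obtain ⟨h, n, b, P, hP0, hP⟩ := hf
  have := Module.Finite.of_basis b
  filter_upwards [h.eventually_analyticAt, hP.eventually_nhds] with y h1 h2
  exact ⟨h1, n, b, P, hP0, h2⟩

theorem IsAlgebraicAt.congr {f g : E → 𝕜} {x : E} (hf : IsAlgebraicAt 𝕜 f x)
    (h : ∀ᶠ y in 𝓝 x, f y = g y) : IsAlgebraicAt 𝕜 g x := by
  obtain ⟨h1, n, b, P, hP0, hP⟩ := hf
  refine ⟨h1.congr h, n, b, P, hP0, ?_⟩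
  filter_upwards [h, hP] with y h2 h3
  rw [← h2, h3]

variable (𝕜) in
/-- The map `f` is analytic at `x` with algebraic components. -/
def IsAlgebraicMapAt (f : E → F) (x : E) : Prop :=
  AnalyticAt 𝕜 f x ∧ ∀ T : F →L[𝕜] 𝕜, IsAlgebraicAt 𝕜 (fun y => T (f y)) x

theorem IsAlgebraicMapAt.clm_comp {f : E → F} {x : E} (hf : IsAlgebraicMapAt 𝕜 f x) (T : F →L[𝕜] G) :
    IsAlgebraicMapAt 𝕜 (fun y => T (f y)) x :=
  ⟨(T.analyticAt _).comp hf.1, fun S => hf.2 (S.comp T)⟩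

namespace IsAlgebraicMapAt

variable [FiniteDimensional 𝕜 E] {f g : E → F} {x : E}

theorem linear (T : E →L[𝕜] F) : IsAlgebraicMapAt 𝕜 (fun y => T y) x :=
  ⟨T.analyticAt x, fun S => (IsNashAt.linear (S.comp T)).isAlgebraicAt⟩

theorem const (c : F) : IsAlgebraicMapAt 𝕜 (fun _ : E => c) x :=
  ⟨analyticAt_const, fun S => (IsNashAt.const (S c)).isAlgebraicAt⟩

theorem add (hf : IsAlgebraicMapAt 𝕜 f x) (hg : IsAlgebraicMapAt 𝕜 g x) :
    IsAlgebraicMapAt 𝕜 (fun y => f y + g y) x :=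
  ⟨hf.1.add hg.1, fun S => ((((hf.2 S).isNashAt 𝕜).add ((hg.2 S).isNashAt 𝕜)).congr
    (Eventually.of_forall fun y => (S.map_add (f y) (g y)).symm)).isAlgebraicAt⟩

theorem sub (hf : IsAlgebraicMapAt 𝕜 f x) (hg : IsAlgebraicMapAt 𝕜 g x) :
    IsAlgebraicMapAt 𝕜 (fun y => f y - g y) x := by
  simp only [sub_eq_add_neg]
  exact hf.add (hg.clm_comp (-ContinuousLinearMap.id 𝕜 F))

theorem prodMk {g : E → G} (hf : IsAlgebraicMapAt 𝕜 f x) (hg : IsAlgebraicMapAt 𝕜 g x) :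
    IsAlgebraicMapAt 𝕜 (fun y => (f y, g y)) x := by
  have h := (hf.clm_comp (ContinuousLinearMap.inl 𝕜 F G)).add
    (hg.clm_comp (ContinuousLinearMap.inr 𝕜 F G))
  simpa using h

theorem comp {g : F → G} (hg : IsAlgebraicMapAt 𝕜 g (f x)) (hf : IsAlgebraicMapAt 𝕜 f x) :
    IsAlgebraicMapAt 𝕜 (fun y => g (f y)) x :=
  ⟨hg.1.fun_comp hf.1, fun T => (hg.2 T).comp hf.1 hf.2⟩

theorem of_basis {n : ℕ} (b : Module.Basis (Fin n) 𝕜 F) (hf : AnalyticAt 𝕜 f x)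
    (h : ∀ i, IsAlgebraicAt 𝕜 (fun y => b.repr (f y) i) x) : IsAlgebraicMapAt 𝕜 f x := by
  refine ⟨hf, fun T => ?_⟩
  refine ((IsNashAt.sum Finset.univ fun i _ => ((h i).isNashAt 𝕜).mul
    (IsNashAt.const (T (b i)))).congr (Eventually.of_forall fun y => ?_)).isAlgebraicAt
  conv_rhs => rw [← b.sum_repr (f y), map_sum]
  exact Finset.sum_congr rfl fun i _ => (T.map_smul _ _).symm

theorem eventually [FiniteDimensional 𝕜 F] (hf : IsAlgebraicMapAt 𝕜 f x) :
    ∀ᶠ y in 𝓝 x, IsAlgebraicMapAt 𝕜 f y := by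
  let b := Module.finBasis 𝕜 F
  have := FiniteDimensional.complete 𝕜 F
  filter_upwards [hf.1.eventually_analyticAt, eventually_all.2 fun i =>
    (hf.2 (LinearMap.toContinuousLinearMap (b.coord i))).eventually] with y h1 h2
  exact of_basis b h1 h2

/-- The inverse of an algebraic map is algebraic. -/
theorem of_right_inverse {g h : E → E} (hh : AnalyticAt 𝕜 h x)
    (hg : IsAlgebraicMapAt 𝕜 g (h x)) (hinv : ∀ᶠ y in 𝓝 x, g (h y) = y) :
    IsAlgebraicMapAt 𝕜 h x := by
  have hcomplete := FiniteDimensional.complete 𝕜 E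
  let b := Module.finBasis 𝕜 E
  have hinj := injective_fderiv_of_left_inverse hh.differentiableAt hg.1.differentiableAt hinv
  have hsurj : (fderiv 𝕜 h x).range = ⊤ :=
    LinearMap.range_eq_top.2 (LinearMap.injective_iff_surjective.1 hinj)
  have hnhds := hh.hasStrictFDerivAt.map_nhds_eq_of_surj hsurj
  refine of_basis b hh fun j => ?_
  have ha : ∀ i, AnalyticAt 𝕜 (fun y => b.repr (h y) i) x := fun i =>
    ((LinearMap.toContinuousLinearMap (b.coord i)).analyticAt _).comp hh
  have hb : ∀ i, AnalyticAt 𝕜 (fun y => b.repr y i) x := fun i =>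
    (LinearMap.toContinuousLinearMap (b.coord i)).analyticAt x
  let a : Fin (Module.finrank 𝕜 E) → AnalyticGerm 𝕜 𝕜 x := fun i => germ 𝕜 (ha i)
  have hca : ∀ i, IsAlgebraicOver 𝕜 (Set.range a) (germ 𝕜 (ha i)) := fun i =>
    .of_mem_adjoin (Algebra.subset_adjoin ⟨i, rfl⟩)
  -- Since `y = g (h y)`, the coordinates of `y` are algebraic over those of `h y`. The relation
  -- stays nontrivial after substituting `h` because `h` is a local diffeomorphism.
  have hcb : ∀ i, IsAlgebraicOver 𝕜 (Set.range a) (germ 𝕜 (hb i)) := fun i => by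
    obtain ⟨P, hP0, hP⟩ := ((hg.2 (LinearMap.toContinuousLinearMap (b.coord i))).isNashAt
      𝕜).exists_polynomial_of_basis b
    obtain ⟨T, hT⟩ := exists_not_eventually_eval_eq_zero b (h x) hP0
    refine isAlgebraicOver_germ ha hca (hb i) (P := P) ?_ (T := T) fun hcon => hT ?_
    · filter_upwards [hh.continuousAt.tendsto.eventually hP, hinv] with y h1 h2
      rw [h2] at h1
      exact h1
    · rw [← hnhds]
      exact hcon
  let f : Option (Fin (Module.finrank 𝕜 E)) → E → 𝕜 :=
    fun o y => o.elim (b.repr (h y) j) (fun i => b.repr y i)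
  have hf : ∀ o, AnalyticAt 𝕜 (f o) x := by
    rintro (_ | i)
    · exact ha j
    · exact hb i
  -- All coordinates of `y` together with one component of `h` are `dim E + 1` elements algebraic
  -- over `dim E`, hence dependent: this is a relation for `h`.
  obtain ⟨Q, hQ0, hQ⟩ := exists_aeval_eq_zero_of_card_lt (k := 𝕜) a
    (ι := Option (Fin (Module.finrank 𝕜 E))) (by simp) (fun o => germ 𝕜 (hf o)) (by
      rintro (_ | i)
      · exact hca j
      · exact hcb i)
  exact ⟨ha j, _, b, Q, hQ0, (eventually_eval_eq_zero_iff hf Q).1 hQ⟩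

end IsAlgebraicMapAt

end AlgebraicMaps

/-! ### Conjugates and real functions with complex relations -/

section Conjugates

theorem IsAlgebraicAt.antilinear {E E' : Type} [NormedAddCommGroup E] [NormedSpace ℂ E]
    [NormedAddCommGroup E'] [NormedSpace ℂ E'] [FiniteDimensional ℂ E] {I : E →L[ℝ] E'}
    (hI : ∀ (c : ℂ) x, I (c • x) = star c • I x) (hopen : IsOpenMap I) {f : E' → ℂ} {x : E}
    (hf : IsAlgebraicAt ℂ f (I x)) : IsAlgebraicAt ℂ (fun y => star (f (I y))) x := by
  obtain ⟨hfa, n, b, P, hP0, hP⟩ := hf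
  obtain ⟨T, hT⟩ := exists_not_eventually_eval_eq_zero b (I x) hP0
  let c : Fin n → E →ₗ[ℂ] ℂ := fun i =>
    { toFun := fun y => star (b.repr (I y) i)
      map_add' := fun y z => by simp
      map_smul' := fun a y => by simp [hI] }
  have hstar : ∀ (v : Option (Fin n) → ℂ), MvPolynomial.eval (fun o => star (v o))
      (MvPolynomial.map (starRingEnd ℂ) P) = star (MvPolynomial.eval v P) := fun v =>
    eval_map_ringHom (starRingEnd ℂ) v P
  have hstar' : ∀ (a : ℂ) (y : E), MvPolynomial.eval
      (fun o : Option (Fin n) => o.elim (star a) (fun i => c i y))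
      (MvPolynomial.map (starRingEnd ℂ) P) =
      star (MvPolynomial.eval (fun o => o.elim a (fun i => b.repr (I y) i)) P) := fun a y => by
    rw [← hstar]
    congr 2
    ext o
    cases o <;> rfl
  have hIt := I.continuous.tendsto x
  refine (IsNashAt.root (𝕜 := ℂ) (c := fun i y => c i y)
    (fun i => IsNashAt.linear (LinearMap.toContinuousLinearMap (c i)))
    (analyticAt_antilinear_comp (J := (starL' ℝ : ℂ ≃L[ℝ] ℂ).toContinuousLinearMap) hI
      (fun c x => star_smul c x) hfa)
    (P := MvPolynomial.map (starRingEnd ℂ) P) ?_ (T := star T) fun hcon => hT ?_).isAlgebraicAt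
  · filter_upwards [hIt.eventually hP] with y hy
    refine (hstar' (f (I y)) y).trans ?_
    rw [hy, star_zero]
  · have h1 : ∀ᶠ y in 𝓝 x,
        MvPolynomial.eval (fun o : Option (Fin n) => o.elim T (fun i => b.repr (I y) i)) P = 0 :=
      hcon.mono fun y hy => star_eq_zero.1 ((hstar' T y).symm.trans hy)
    exact hopen.nhds_le x h1

/-- Take real or imaginary parts of the coefficients of a complex relation; at real arguments both
vanish, and at least one of them is a nonzero polynomial. -/
theorem IsNashAt.isAlgebraicAt_real {E : Type} [NormedAddCommGroup E] [NormedSpace ℝ E]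
    [FiniteDimensional ℝ E] {r : E → ℝ} {x : E} (h : IsNashAt ℝ (fun y => (r y : ℂ)) x) :
    IsAlgebraicAt ℝ r x := by
  let b := Module.finBasis ℝ E
  obtain ⟨Q, hQ0, hQ⟩ := h.exists_polynomial_of_basis b
  have hr : AnalyticAt ℝ r x := (Complex.reCLM.analyticAt _).comp h.1
  let part : (ℂ → ℝ) → MvPolynomial (Option (Fin (Module.finrank ℝ E))) ℝ := fun φ =>
    Q.support.sum fun s => MvPolynomial.monomial s (φ (Q.coeff s))
  have hcoeff : ∀ φ : ℂ → ℝ, φ 0 = 0 → ∀ s, (part φ).coeff s = φ (Q.coeff s) := by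
    intro φ hφ s
    classical
    simp only [part, MvPolynomial.coeff_sum, MvPolynomial.coeff_monomial]
    rw [Finset.sum_ite_eq' Q.support s]
    split_ifs with hs
    · rfl
    · rw [MvPolynomial.notMem_support_iff.1 hs, hφ]
  have heval : ∀ (φ : ℂ →+ ℝ), (∀ (c : ℂ) (a : ℝ), φ (c * a) = φ c * a) →
      ∀ v : Option (Fin (Module.finrank ℝ E)) → ℝ,
      MvPolynomial.eval v (part φ) = φ (MvPolynomial.eval (fun o => (v o : ℂ)) Q) := by
    intro φ hφ v
    rw [MvPolynomial.eval_eq' _ Q, map_sum]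
    simp only [map_sum, MvPolynomial.eval_monomial]
    refine Finset.sum_congr rfl fun s _ => ?_
    rw [← hφ, Finsupp.prod_fintype _ _ (fun i => pow_zero _)]
    push_cast
    rfl
  have hQ' : ∀ᶠ y in 𝓝 x, MvPolynomial.eval (fun o : Option (Fin (Module.finrank ℝ E)) =>
      ((o.elim (r y) (fun i => b.repr y i) : ℝ) : ℂ)) Q = 0 := by
    filter_upwards [hQ] with y hy
    rw [← hy]
    congr 2
    ext o
    cases o <;> rfl
  have hfin : ∀ φ : ℂ →+ ℝ, (∀ (c : ℂ) (a : ℝ), φ (c * a) = φ c * a) → part φ ≠ 0 →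
      IsAlgebraicAt ℝ r x := fun φ hφ h0 => by
    refine ⟨hr, _, b, part φ, h0, ?_⟩
    filter_upwards [hQ'] with y hy
    rw [heval φ hφ, hy, map_zero]
  obtain ⟨s, hs⟩ : ∃ s, Q.coeff s ≠ 0 := by
    by_contra! hcon
    exact hQ0 (MvPolynomial.ext _ _ fun s => by rw [hcon s, MvPolynomial.coeff_zero])
  by_cases hre : (Q.coeff s).re = 0
  · refine hfin Complex.imAddGroupHom (fun c a => by simp) fun h0 => hs (Complex.ext hre ?_)
    have := hcoeff Complex.im rfl s
    rw [← this]
    exact congrArg (MvPolynomial.coeff s) h0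
  · refine hfin Complex.reAddGroupHom (fun c a => by simp) fun h0 => hre ?_
    have := hcoeff Complex.re rfl s
    rw [← this]
    exact congrArg (MvPolynomial.coeff s) h0

end Conjugates

/-! ### Algebraicity of defining functions, flows and equations -/

section AlgebraicOrbits

variable {m d : ℕ} {M : LocalGenericSubmanifold m d} {Θ : (Fin m → ℂ) × CSpace m d → Fin d → ℂ}

theorem isNashAt_graphMap (h : M.IsRealAlgebraic) (T : CSpace m d →L[ℝ] ℂ) :
    IsNashAt ℝ (fun q => T (graphMap M.φ q)) 0 := by
  have h1 : ∀ j, IsNashAt ℝ (fun q => ((M.φ q j : ℝ) : ℂ) *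
      T (imagCoord m d (Pi.single j 1))) 0 := fun j =>
    ((h j).isNashAt ℂ).mul (IsNashAt.const _)
  refine ((IsNashAt.linear (T.comp (complexCoord m d))).add
    (IsNashAt.sum Finset.univ fun j _ => h1 j)).congr (Eventually.of_forall fun q => ?_)
  have h2 : imagCoord m d (M.φ q) = ∑ j, M.φ q j • imagCoord m d (Pi.single j 1) := by
    conv_lhs => rw [← (Pi.basisFun ℝ (Fin d)).sum_repr (M.φ q), map_sum]
    refine Finset.sum_congr rfl fun j _ => ?_
    rw [map_smul, Pi.basisFun_apply, Pi.basisFun_repr]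
  rw [graphMap_eq, map_add, h2, map_sum]
  congr 1
  refine Finset.sum_congr rfl fun j _ => ?_
  rw [map_smul, Complex.real_smul]

theorem LocalGenericSubmanifold.IsComplexDefining.isAlgebraicMapAt (hΘ : M.IsComplexDefining Θ)
    (h : M.IsRealAlgebraic) : IsAlgebraicMapAt ℂ Θ 0 := by
  have hcard : Module.finrank ℂ ((Fin m → ℂ) × CSpace m d) = Module.finrank ℝ (RSpace m d) := by
    simp [Module.finrank_prod]
  let b := Module.finBasisOfFinrankEq ℂ ((Fin m → ℂ) × CSpace m d) hcard
  refine IsAlgebraicMapAt.of_basis (Pi.basisFun ℂ (Fin d)) hΘ.analyticAt_zero fun j => ?_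
  simp only [Pi.basisFun_repr]
  have hΘj : AnalyticAt ℂ (fun x => Θ x j) 0 :=
    ((ContinuousLinearMap.proj (R := ℂ) (φ := fun _ : Fin d => ℂ) j).analyticAt _).comp
      hΘ.analyticAt_zero
  -- Pulled back to the graph, a component of `Θ` is a conjugate coordinate, hence Nash; with the
  -- `2m + d` coordinates it is one germ too many for `ℝ^{2m+d}`. The complex relation found there
  -- propagates off the totally real graph.
  obtain ⟨Q, hQ0, hQ⟩ := IsNashAt.exists_polynomial (𝕜 := ℝ) (L := ℂ) (x := (0 : RSpace m d))
    (b := fun (o : Option (Fin (Module.finrank ℝ (RSpace m d)))) q =>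
      o.elim (Θ (barL m d (graphMap M.φ q)) j) (fun i => b.repr (barL m d (graphMap M.φ q)) i))
    (by
      rintro (_ | i)
      · let T : CSpace m d →L[ℝ] ℂ := (starL' ℝ : ℂ ≃L[ℝ] ℂ).toContinuousLinearMap.comp
          ((ContinuousLinearMap.proj (R := ℝ) (φ := fun _ : Fin d => ℂ) j).comp
            (ContinuousLinearMap.snd ℝ (Fin m → ℂ) (Fin d → ℂ)))
        refine (isNashAt_graphMap h T).congr ?_
        filter_upwards [LocalGenericSubmanifold.eventually_graphMap_mem (M := M)] with q hq
        exact (congrFun (hΘ.apply_graphMap hq) j).symm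
      · exact isNashAt_graphMap h (((LinearMap.toContinuousLinearMap
          (b.coord i)).restrictScalars ℝ).comp (barL m d)))
    (by simp)
  refine ⟨hΘj, _, b, Q, hQ0, ?_⟩
  refine hΘ.eventually_eq_zero_of_graph (analyticAt_eval (𝕜 := ℂ) (L := ℂ)
    (f := fun (o : Option (Fin (Module.finrank ℝ (RSpace m d)))) x =>
      o.elim (Θ x j) (fun i => b.repr x i)) ?_ Q) hQ
  rintro (_ | i)
  · exact hΘj
  · exact (LinearMap.toContinuousLinearMap (b.coord i)).analyticAt 0

theorem isAlgebraicMapAt_conjCoeff (h : IsAlgebraicMapAt ℂ Θ 0) :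
    IsAlgebraicMapAt ℂ (conjCoeff Θ) 0 := by
  have h0 : AnalyticAt ℂ Θ (star 0) := by rw [star_zero]; exact h.1
  refine IsAlgebraicMapAt.of_basis (Pi.basisFun ℂ (Fin d)) (analyticAt_conjCoeff h0) fun j => ?_
  simp only [Pi.basisFun_repr]
  let I := (starL' ℝ : ((Fin m → ℂ) × CSpace m d) ≃L[ℝ] ((Fin m → ℂ) × CSpace m d))
  refine IsAlgebraicAt.antilinear (I := I.toContinuousLinearMap) (f := fun x => Θ x j)
    (fun c x => star_smul c x) I.toHomeomorph.isOpenMap ?_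
  have h1 : I.toContinuousLinearMap 0 = 0 := map_zero _
  rw [h1]
  exact h.2 (ContinuousLinearMap.proj j)

theorem isAlgebraicMapAt_complexFlow (a : Fin m ⊕ Fin m) {q : CSpace m d × CSpace m d}
    (h : IsAlgebraicMapAt ℂ Θ (q.2.1, q.1)) (h' : IsAlgebraicMapAt ℂ (conjCoeff Θ) (q.1.1, q.2)) :
    IsAlgebraicMapAt ℂ (complexFlow Θ a) (q, 0) := by
  let s : (CSpace m d × CSpace m d) × ℂ →L[ℂ] ℂ := ContinuousLinearMap.snd ℂ _ _
  let t : (CSpace m d × CSpace m d) × ℂ →L[ℂ] CSpace m d :=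
    (ContinuousLinearMap.fst ℂ _ _).comp (ContinuousLinearMap.fst ℂ _ _)
  let τ : (CSpace m d × CSpace m d) × ℂ →L[ℂ] CSpace m d :=
    (ContinuousLinearMap.snd ℂ _ _).comp (ContinuousLinearMap.fst ℂ _ _)
  let f : CSpace m d →L[ℂ] (Fin m → ℂ) := ContinuousLinearMap.fst ℂ _ _
  let g : CSpace m d →L[ℂ] (Fin d → ℂ) := ContinuousLinearMap.snd ℂ _ _
  let e : Fin m → ((CSpace m d × CSpace m d) × ℂ →L[ℂ] (Fin m → ℂ)) := fun k =>
    (ContinuousLinearMap.toSpanSingleton ℂ (Pi.single k 1)).comp s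
  have hlin : ∀ {F : Type} [NormedAddCommGroup F] [NormedSpace ℂ F]
      (T : (CSpace m d × CSpace m d) × ℂ →L[ℂ] F), IsAlgebraicMapAt ℂ (fun x => T x) (q, 0) :=
    fun T => IsAlgebraicMapAt.linear T
  cases a with
  | inl k =>
    have h1 : IsAlgebraicMapAt ℂ (fun x => conjCoeff Θ (((f.comp t + e k).prod τ) x)) (q, 0) :=
      IsAlgebraicMapAt.comp (by simpa [f, t, e, s, τ] using h') (hlin _)
    have h2 : IsAlgebraicMapAt ℂ (fun x => conjCoeff Θ (((f.comp t).prod τ) x)) (q, 0) :=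
      IsAlgebraicMapAt.comp (by simpa [f, t, τ] using h') (hlin _)
    exact ((hlin (f.comp t + e k)).prodMk ((hlin (g.comp t)).add (h1.sub h2))).prodMk (hlin τ)
  | inr k =>
    have h1 : IsAlgebraicMapAt ℂ (fun x => Θ (((f.comp τ + e k).prod t) x)) (q, 0) :=
      IsAlgebraicMapAt.comp (by simpa [f, t, e, s, τ] using h) (hlin _)
    have h2 : IsAlgebraicMapAt ℂ (fun x => Θ (((f.comp τ).prod t) x)) (q, 0) :=
      IsAlgebraicMapAt.comp (by simpa [f, t, τ] using h) (hlin _)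
    exact (hlin t).prodMk ((hlin (f.comp τ + e k)).prodMk ((hlin (g.comp τ)).add (h1.sub h2)))

/-- Algebraicity of the flows is known only near the base point and time zero, so the intermediate
points and times must stay in `U`. -/
theorem IsChainMap.isAlgebraicMapAt {𝕜 : Type} [RCLike 𝕜] {E ι V : Type} [NormedAddCommGroup E]
    [NormedSpace 𝕜 E] [FiniteDimensional 𝕜 E] [NormedAddCommGroup V] [NormedSpace 𝕜 V]
    [FiniteDimensional 𝕜 V] {Φ : ι → E × 𝕜 → E} {U : Set (E × 𝕜)} {p : E} {v₀ : V} {σ : V → E}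
    (h : IsChainMap Φ U p v₀ σ) (hU : ∀ z ∈ U, ∀ a, IsAlgebraicMapAt 𝕜 (Φ a) z) :
    IsAlgebraicMapAt 𝕜 σ v₀ := by
  induction h with
  | const => exact IsAlgebraicMapAt.const p
  | step σ a ℓ c hσ hmem ih =>
    exact (hU _ hmem a).comp (f := fun v => (σ v, ℓ v + c))
      (ih.prodMk ((IsAlgebraicMapAt.linear ℓ).add (IsAlgebraicMapAt.const c)))

theorem isAlgebraicAt_displacement {p : CSpace m d} {c : ℕ}
    (ℓ : Fin c → CSpace m d × CSpace m d →L[ℂ] ℂ)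
    {R : CSpace m d × CSpace m d → CSpace m d × CSpace m d} (hR : IsAlgebraicMapAt ℂ R (pc p))
    (l : Fin c) : IsAlgebraicAt ℂ (fun q => displacement ℓ R q l) (pc p) := by
  -- Conjugating on both sides turns `ℓ l ∘ sigma` into a complex linear functional, to which
  -- algebraicity of `R` applies.
  let T : CSpace m d × CSpace m d →L[ℂ] ℂ := LinearMap.toContinuousLinearMap
    { toFun := fun y => star (ℓ l (sigma y))
      map_add' := fun y z => by rw [sigma_add, map_add, star_add]
      map_smul' := fun a y => by simp [sigma_smul] }
  have hopen : IsOpenMap (sigmaL m d) :=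
    IsOpenMap.of_inverse (sigmaL m d).continuous sigma_sigma sigma_sigma
  have h1 : IsAlgebraicAt ℂ (fun q => star (T (R (sigma q)))) (pc p) :=
    IsAlgebraicAt.antilinear (I := sigmaL m d) (f := fun x => T (R x)) sigma_smul hopen (by
      rw [sigmaL_apply, sigma_pc]
      exact hR.2 T)
  have h2 := ((IsNashAt.linear (ℓ l)).add ((IsNashAt.const (-(1 / 2) : ℂ)).mul
    (((hR.2 (ℓ l)).isNashAt ℂ).add (h1.isNashAt ℂ)))).isAlgebraicAt
  refine h2.congr (Eventually.of_forall fun q => ?_)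
  have h3 : star (T (R (sigma q))) = ℓ l (sigma (R (sigma q))) := star_star _
  simp only [displacement, map_sub, map_smul, map_add, smul_eq_mul, h3, Algebra.algebraMap_self,
    RingHom.id_apply]
  ring

/-- The relation for `χ` remains nontrivial on the antidiagonal by the identity principle; reality
of `χ` there gives a real-valued function. -/
theorem IsAlgebraicAt.re_comp_pc {p : CSpace m d} {χ : CSpace m d × CSpace m d → ℂ}
    (h : IsAlgebraicAt ℂ χ (pc p)) (hreal : ∀ t, ((χ (pc t)).re : ℂ) = χ (pc t)) :
    IsAlgebraicAt ℝ (fun t => (χ (pc t)).re) p := by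
  obtain ⟨hχ, n, b, P, hP0, hP⟩ := h
  obtain ⟨T, hT⟩ := exists_not_eventually_eval_eq_zero b (pc p) hP0
  have hpc : Tendsto pc (𝓝 p) (𝓝 (pc p)) := continuous_pc.tendsto p
  refine IsNashAt.isAlgebraicAt_real ?_
  simp only [hreal]
  refine IsNashAt.root (c := fun i t => b.repr (pc t) i) (fun i => IsNashAt.linear
    (((LinearMap.toContinuousLinearMap (b.coord i)).restrictScalars ℝ).comp (pcL m d)))
    (hχ.restrictScalars.comp ((pcL m d).analyticAt p)) (hpc.eventually hP) (T := T)
    fun hcon => hT ?_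
  refine eventually_eq_zero_of_antidiagonal (analyticAt_eval (𝕜 := ℂ) (L := ℂ)
    (f := fun (o : Option (Fin n)) x => o.elim T (fun i => b.repr x i)) ?_ P) hcon
  rintro (_ | i)
  · exact analyticAt_const
  · exact (LinearMap.toContinuousLinearMap (b.coord i)).analyticAt _

end AlgebraicOrbits

/-! ### Points near the origin and conclusion -/

section Main

variable {m d : ℕ} {M : LocalGenericSubmanifold m d} {Θ : (Fin m → ℂ) × CSpace m d → Fin d → ℂ}

theorem LocalGenericSubmanifold.IsComplexDefining.eventually_isAlgebraicMapAt
    (hΘ : M.IsComplexDefining Θ) : ∀ᶠ p in 𝓝 (0 : CSpace m d), M.IsRealAlgebraic →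
      IsAlgebraicMapAt ℂ Θ (star p.1, p) ∧ IsAlgebraicMapAt ℂ (conjCoeff Θ) (p.1, star p) := by
  by_cases h : M.IsRealAlgebraic
  · have h1 := hΘ.isAlgebraicMapAt h
    have c1 : Tendsto (fun p : CSpace m d => ((star p.1, p) : (Fin m → ℂ) × CSpace m d))
        (𝓝 0) (𝓝 0) := by
      have h2 : Continuous fun p : CSpace m d => ((star p.1, p) : (Fin m → ℂ) × CSpace m d) :=
        (continuous_star.comp continuous_fst).prodMk continuous_id
      exact h2.tendsto' 0 0 (Prod.ext (star_zero _) rfl)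
    have c2 : Tendsto (fun p : CSpace m d => ((p.1, star p) : (Fin m → ℂ) × CSpace m d))
        (𝓝 0) (𝓝 0) := by
      have h2 : Continuous fun p : CSpace m d => ((p.1, star p) : (Fin m → ℂ) × CSpace m d) :=
        continuous_fst.prodMk continuous_star
      exact h2.tendsto' 0 0 (Prod.ext rfl (star_zero _))
    filter_upwards [c1.eventually h1.eventually,
      c2.eventually (isAlgebraicMapAt_conjCoeff h1).eventually] with p h3 h4 _
    exact ⟨h3, h4⟩
  · exact Eventually.of_forall fun _ h' => (h h').elim

theorem eventually_isAlgebraicMapAt_complexFlow {p : CSpace m d}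
    (h : M.IsRealAlgebraic →
      IsAlgebraicMapAt ℂ Θ (star p.1, p) ∧ IsAlgebraicMapAt ℂ (conjCoeff Θ) (p.1, star p)) :
    ∀ᶠ z in 𝓝 (pc p, (0 : ℂ)), M.IsRealAlgebraic →
      ∀ a, IsAlgebraicMapAt ℂ (complexFlow Θ a) z := by
  by_cases hM : M.IsRealAlgebraic
  · filter_upwards [eventually_all.2 fun a => (isAlgebraicMapAt_complexFlow (q := pc p) a
      (h hM).1 (h hM).2).eventually] with z hz _
    exact hz
  · exact Eventually.of_forall fun _ h' => (hM h').elim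

/-- The points near which the orbits are compared. -/
theorem LocalGenericSubmanifold.IsComplexDefining.eventually_nice (hΘ : M.IsComplexDefining Θ) :
    ∀ᶠ p in 𝓝 (0 : CSpace m d), (∀ᶠ x in 𝓝 (pc p), IsRegular Θ x) ∧
      AnalyticAt ℝ M.φ (realCoord m d p) ∧
      ∀ᶠ z in 𝓝 (pc p, (0 : ℂ)), M.IsRealAlgebraic →
        ∀ a, IsAlgebraicMapAt ℂ (complexFlow Θ a) z := by
  have c1 : Tendsto pc (𝓝 (0 : CSpace m d)) (𝓝 0) := by
    have := (continuous_pc (m := m) (d := d)).tendsto 0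
    rwa [show pc (0 : CSpace m d) = 0 from Prod.ext rfl (star_zero _)] at this
  have c2 : Tendsto (realCoord m d) (𝓝 0) (𝓝 0) := by
    simpa using (realCoord m d).continuous.tendsto 0
  filter_upwards [c1.eventually hΘ.eventually_isRegular.eventually_nhds,
    c2.eventually M.analyticAt_zero.eventually_analyticAt, hΘ.eventually_isAlgebraicMapAt]
    with p h1 h2 h3
  exact ⟨h1, h2, eventually_isAlgebraicMapAt_complexFlow h3⟩

theorem mem_image_antidiagonal {O : Set (CSpace m d × CSpace m d)} {t : CSpace m d} :
    t ∈ Prod.fst '' (antidiagonal m d ∩ O) ↔ pc t ∈ O := by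
  constructor
  · rintro ⟨⟨t', τ⟩, ⟨h1, h2⟩, rfl⟩
    obtain rfl : τ = star t' := h1
    exact h2
  · exact fun h => ⟨pc t, ⟨rfl, h⟩, rfl⟩

theorem displacement_pc_re {c : ℕ} {ℓ : Fin c → CSpace m d × CSpace m d →L[ℂ] ℂ}
    {R : CSpace m d × CSpace m d → CSpace m d × CSpace m d}
    (h : ∀ q, star (displacement ℓ R q) = displacement ℓ R (sigma q)) (t : CSpace m d)
    (l : Fin c) : ((displacement ℓ R (pc t) l).re : ℂ) = displacement ℓ R (pc t) l := by
  have h1 := congrFun (h (pc t)) l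
  rw [sigma_pc] at h1
  exact Complex.conj_eq_iff_re.1 h1

end Main

end CROrbit

open CROrbit in
theorem theorem2p6p6 {m d : ℕ} (M : CROrbit.LocalGenericSubmanifold m d)
    (Θ : (Fin m → ℂ) × CROrbit.CSpace m d → Fin d → ℂ) (hΘ : M.IsComplexDefining Θ) :
    ∃ r > 0, ∀ p ∈ M.carrier, ‖p‖ < r → ∀ K ≥ 3 * (2 * m + d),
      ∃ δ₀ > 0, ∀ δ δ' : ℝ, 0 < δ → δ < δ₀ → 0 < δ' → δ' < δ₀ →
        CROrbit.IsExtrinsicComplexificationAt p (CROrbit.crOrbit M Θ K δ p)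
          (CROrbit.complexOrbit M Θ K δ' (CROrbit.pc p)) ∧
        (∀ᶠ t in 𝓝 p, t ∈ CROrbit.crOrbit M Θ K δ p ↔
          t ∈ Prod.fst '' (CROrbit.antidiagonal m d ∩
            CROrbit.complexOrbit M Θ K δ' (CROrbit.pc p))) ∧
        (M.IsRealAlgebraic →
          CROrbit.IsAlgebraicSubmanifoldAt ℂ
            (CROrbit.complexOrbit M Θ K δ' (CROrbit.pc p)) (CROrbit.pc p) ∧
          CROrbit.IsAlgebraicSubmanifoldAt ℝ (CROrbit.crOrbit M Θ K δ p) p) := by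
  obtain ⟨r, hr, hnice⟩ := Metric.eventually_nhds_iff_ball.1 hΘ.eventually_nice
  refine ⟨r, hr, fun p hp hpr K hK => ?_⟩
  obtain ⟨hreg, hφ, hU⟩ := hnice p (mem_ball_zero_iff.2 hpr)
  obtain ⟨V, _, _, _, σ, v₀, π, H, hR, hchain, -, hH, hHv, hπ, hsym, horb⟩ :=
    exists_orbit_comparison hΘ hp hreg hφ hU
  obtain ⟨c, ℓ, hχ, hstar, hχ0, hsurj, hsurj', hfix⟩ := exists_real_equations hR hsym
  -- Only `2 (2m + d)` flows are needed. The equations were fixed before `K` and the time bounds,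
  -- which is why the two bounds can be chosen independently.
  obtain ⟨δ₀, hδ₀, hδ⟩ := horb K (by omega)
  have hpc : Tendsto pc (𝓝 p) (𝓝 (pc p)) := continuous_pc.tendsto p
  refine ⟨δ₀, hδ₀, fun δ δ' h0 h1 h0' h1' => ?_⟩
  set R := fun x => σ (H (π x)) with hRdef
  have hcr : ∀ᶠ t in 𝓝 p, t ∈ crOrbit M Θ K δ p ↔ displacement ℓ R (pc t) = 0 := by
    filter_upwards [(hδ δ h0 h1).1, hpc.eventually hfix] with t h2 h3
    rw [h2, h3]
  have hco : ∀ᶠ q in 𝓝 (pc p), q ∈ complexOrbit M Θ K δ' (pc p) ↔ displacement ℓ R q = 0 := by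
    filter_upwards [(hδ δ' h0' h1').2, hfix] with q h2 h3
    rw [h2, h3]
  refine ⟨⟨c, displacement ℓ R, hχ, Eventually.of_forall hstar, hχ0, hsurj, hcr, hco⟩, ?_,
    fun hM => ?_⟩
  · filter_upwards [hcr, hpc.eventually hco] with t h2 h3
    rw [mem_image_antidiagonal, h2, h3]
  -- The neighbourhood `U` in the construction of `σ` was the set where, if `M` is algebraic, the
  -- flows are; `H` is algebraic as a local inverse of `π ∘ σ`.
  · have hσalg : IsAlgebraicMapAt ℂ σ (H (π (pc p))) :=
      hHv.symm ▸ hchain.isAlgebraicMapAt fun z hz a => hz hM a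
    have hHalg : IsAlgebraicMapAt ℂ H (π (pc p)) :=
      IsAlgebraicMapAt.of_right_inverse hH (hσalg.clm_comp π) hπ
    have hRalg : IsAlgebraicMapAt ℂ R (pc p) :=
      hσalg.comp (f := fun x => H (π x)) (hHalg.comp (IsAlgebraicMapAt.linear π))
    have hχalg := isAlgebraicAt_displacement ℓ hRalg
    refine ⟨⟨c, displacement ℓ R, hχalg, hχ0, hsurj, hco⟩,
      ⟨c, fun t l => (displacement ℓ R (pc t) l).re, fun l =>
        (hχalg l).re_comp_pc fun t => displacement_pc_re hstar t l, ?_, hsurj', ?_⟩⟩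
    · funext l
      simp [hχ0]
    · filter_upwards [hcr] with t h2
      rw [h2, funext_iff, funext_iff]
      refine forall_congr' fun l => ?_
      rw [← displacement_pc_re hstar t l]
      simp
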